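/- Let $H$ be a real separable Hilbert space with a countable orthonormal basis $(e^k)$, and write $x^k=\langle x,e^k\rangle$. Let $\mathcal A$ be the infinitesimal generator of a $C_0$-semigroup $(e^{t\mathcal A})_{t\ge 0}$ on $H$, with adjoint $\mathcal A^\dagger$, and let $R$ be a bounded, symmetric, non-negative operator on $H$. Let $(\Omega,\mathcal F,(\mathcal F_t)_{t\ge0},\mathbb Q)$ be a filtered probability space carrying an $R$-Wiener process $W$ on $H$ relative to $(\mathcal F_t)$, given by its projections $\langle W_t,h\rangle$, $h\in H$ (so that cylindrical noise is allowed), and let $X_0$ be an $\mathcal F_0$-measurable $H$-valued random variable with law $\rho_0$. For $t\ge 0$ put $$\mathcal S(t)x=\int_0^t e^{(t-s)\mathcal A}R\,e^{(t-s)\mathcal A^\dagger}x\,ds .$$ Let $T\ge 0$, and suppose that $\operatorname{Tr}R<\infty$ or, more generally, that $\operatorname{Tr}\mathcal S(T)<\infty$. For a probability measure $\rho$ on $H$, the score $D_x\log\rho^{(d)}$ is the family of functions $$\langle D_x\log\rho^{(d)}(x),e^k\rangle=\frac{\partial}{\partial x^k}\log\rho^{(d)}(x^k\mid x^{j\ne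 k}),$$ where $\rho^{(d)}(\cdot\mid x^{j\neq k})$ is the Lebesgue density of the conditional law under $\rho$ of $x^k$ given $(x^j)_{j\neq k}$. The score is said to exist if for every $k$ this density exists in a version that, for almost every $(x^j)_{j\ne k}$, is positive and differentiable in $x^k\in\mathbb R$; it is then determined up to $\rho$-null sets. If $e^k$ is in the range of $\mathcal S(t)$ for every $k$ (so that $\mathcal S(t)$ is injective), then for $y\in H$ the $k$-th coordinate of $\mathcal S(t)^{-1}y$ is read as $\langle \mathcal S(t)^{-1}e^k,y\rangle$; this agrees with the literal meaning when $y$ is in the range of $\mathcal S(t)$. 1. There is a predictable process $X$ with $$X_t=e^{t\mathcal A}X_0+\int_0^t e^{(t-s)\mathcal A}\,dW_s\quad\text{a.s., for every } t\in[0,T],$$ and every such process is a weak solution on $[0,T]$ of $dX_t=\mathcal A X_t\,dt+dW_t$ with initial value $X_0$: its paths are almost surely Bochner integrable on $[0,T]$ and, for all $\zeta\in D(\mathcal A^\dagger)$ and $t\in[0,T]$, almost surely $\langle X_t,\zeta\rangle=\langle X_0,\zeta\rangle+\int_0^t\langle X_s,\mathcal A^\dagger\zeta\rangle\,ds+\langle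 W_t,\zeta\rangle$. Let $X$ be such a process, let $0<t\le T$, and let $\rho_t$ be the law of $X_t$. 2. Suppose that $e^k$ is in the range of $\mathcal S(t)$ for every $k$, and that $\mathbb E[X_0\mid X_t=x]$ exists for $\rho_t$-almost every $x$ (that is, the regular conditional law of $X_0$ given $X_t=x$ has a mean, as is the case if $X_0$ is integrable). Then the score of $\rho_t$ exists and, coordinate by coordinate, for $\rho_t$-almost every $x$, $$D_x\log\rho^{(d)}_t(x)=-\mathcal S(t)^{-1}\left(x-e^{t\mathcal A}\,\mathbb E[X_0\mid X_t=x]\right).$$ 3. Suppose that $e^k$ is in the range of $\mathcal S(t)$ for every $k$. Then for $\rho_0$-almost every $x_0$ the score of the conditional law $\rho_t(\cdot\mid x_0)$ of $X_t$ given $X_0=x_0$ exists and, coordinate by coordinate, for $\rho_t(\cdot\mid x_0)$-almost every $x$, $$D_x\log\rho^{(d)}_t(x\mid x_0)=-\mathcal S(t)^{-1}\left(x-e^{t\mathcal A}x_0\right).$$ 4. If $\mathcal A e^j=b^je^j$ and $Re^j=r^je^j$ for all $j$, then $\mathcal S(t)e^k=s^ke^k$ with $s^k=r^k\,\frac{\exp(2b^kt)-1}{2b^k}$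 for every $k$ with $b^k\neq0$. -/

import Mathlib

open MeasureTheory ProbabilityTheory Filter Topology
open scoped NNReal ENNReal InnerProductSpace

noncomputable section

namespace FDP

section Deterministic

variable {H : Type*} [NormedAddCommGroup H] [InnerProductSpace ℝ H]

/-- `U` is a strongly continuous (`C₀`) semigroup of bounded operators on `H`. -/
structure IsC0Semigroup (U : ℝ≥0 → H →L[ℝ] H) : Prop where
  map_zero : U 0 = ContinuousLinearMap.id ℝ H
  map_add : ∀ s t, U (s + t) = (U s).comp (U t)
  strong_cont : ∀ x, Continuous fun t => U t x

/-- `A` is the infinitesimal generator of `U`: `x` lies in the domain of `A` and `A x = y` exactly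
when `(U h x - x) / h` converges to `y` as `h` decreases to `0`. -/
def IsGenerator (A : H →ₗ.[ℝ] H) (U : ℝ≥0 → H →L[ℝ] H) : Prop :=
  ∀ x y : H, (x, y) ∈ A.graph ↔
    Tendsto (fun h : ℝ≥0 => (h : ℝ)⁻¹ • (U h x - x)) (𝓝[>] 0) (𝓝 y)

/-- The trace of a positive operator, computed in the orthonormal basis `e`. -/
def trace {ι : Type*} (e : HilbertBasis ι ℝ H) (Q : H → H) : ℝ≥0∞ :=
  ∑' k, ENNReal.ofReal ⟪e k, Q (e k)⟫_ℝ

/-- The operator `x ↦ ∫₀ᵗ U(t - s) R U(t - s)† x ds`. -/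
def covOp [CompleteSpace H] (U : ℝ≥0 → H →L[ℝ] H) (R : H →L[ℝ] H) (t : ℝ≥0) (x : H) : H :=
  ∫ s in (0 : ℝ)..t, U (t - s.toNNReal) (R ((U (t - s.toNNReal)).adjoint x))

/-- The coordinate `⟨Q⁻¹ y, v⟩` of `Q⁻¹ y` along a vector `v` in the range of the injective
symmetric operator `Q`. It is read as `⟨Q⁻¹ v, y⟩`, which makes sense for every `y`
and agrees with the literal meaning when `y` is in the range of `Q`
(see `invCoord_of_apply_eq`). -/
def invCoord (Q : H → H) (v y : H) : ℝ :=
  ⟪Function.invFun Q v, y⟫_ℝ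

theorem invCoord_of_apply_eq {Q : H → H} (hsym : ∀ x y, ⟪Q x, y⟫_ℝ = ⟪x, Q y⟫_ℝ)
    {v y z : H} (hv : v ∈ Set.range Q) (hz : Q z = y) : invCoord Q v y = ⟪v, z⟫_ℝ := by
  have h : Q (Function.invFun Q v) = v := Function.invFun_eq hv
  rw [invCoord, ← hz, ← hsym, h]

theorem invCoord_of_eigenvector {Q : H → H} (hinj : Function.Injective Q) {v : H} {c : ℝ}
    (hv : Q (c⁻¹ • v) = v) (y : H) : invCoord Q v y = c⁻¹ * ⟪v, y⟫_ℝ := by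
  have h : Function.invFun Q v = c⁻¹ • v := by
    conv_lhs => rw [← hv]
    exact Function.leftInverse_invFun hinj _
  rw [invCoord, h, real_inner_smul_left]

end Deterministic

section Noise

variable {H : Type*} [NormedAddCommGroup H] [InnerProductSpace ℝ H]
variable {Ω : Type*} {mΩ : MeasurableSpace Ω}

/-- `W` is an `R`-Wiener process on `H` with respect to the filtration `ℱ`, given by its
projections: `W t h` is the real random variable `⟨W_t, h⟩`. If `R` has finite trace this is the
family of projections of an `H`-valued Wiener process with covariance `R`; for `R = I` it is the
cylindrical Wiener process. -/
structure IsWienerProcess (R : H →L[ℝ] H) (ℱ : Filtration ℝ≥0 mΩ) (μ : Measure Ω)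
    (W : ℝ≥0 → H → Ω → ℝ) : Prop where
  adapted : ∀ t h, Measurable[ℱ t] (W t h)
  start : ∀ h, W 0 h =ᵐ[μ] 0
  linear : ∀ t (a b : ℝ) (h g : H),
    W t (a • h + b • g) =ᵐ[μ] fun ω => a * W t h ω + b * W t g ω
  gaussian : ∀ s t h, s ≤ t →
    μ.map (fun ω => W t h ω - W s h ω) = gaussianReal 0 ((t - s) * (⟪h, R h⟫_ℝ).toNNReal)
  indep : ∀ s t h, s ≤ t →
    Indep (MeasurableSpace.comap (fun ω => W t h ω - W s h ω) inferInstance) (ℱ s) μ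
  continuous : ∀ h, ∀ᵐ ω ∂μ, Continuous fun t => W t h ω

/-- A deterministic step function `∑ᵢ 1_{(aᵢ, bᵢ]} vᵢ` on `[0, t]` with values in `H`. -/
structure StepFun (H : Type*) (t : ℝ≥0) where
  n : ℕ
  a : Fin n → ℝ≥0
  b : Fin n → ℝ≥0
  v : Fin n → H
  a_le : ∀ i, a i ≤ b i
  b_le : ∀ i, b i ≤ t

/-- The function represented by a step function. -/
def StepFun.toFun {t : ℝ≥0} (G : StepFun H t) (s : ℝ) : H :=
  ∑ i, (Set.Ioc (G.a i : ℝ) (G.b i : ℝ)).indicator (fun _ => G.v i) s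

/-- The Wiener integral `∑ᵢ (W_{bᵢ}(vᵢ) - W_{aᵢ}(vᵢ))` of a step function. -/
def StepFun.integral {t : ℝ≥0} (G : StepFun H t) (W : ℝ≥0 → H → Ω → ℝ) (ω : Ω) : ℝ :=
  ∑ i, (W (G.b i) (G.v i) ω - W (G.a i) (G.v i) ω)

/-- `I` is the Wiener integral `∫₀ᵗ ⟨g(s), dW_s⟩` of the deterministic function `g`: the `L²` limit
of the integrals of step functions converging to `g` in the norm `(∫₀ᵗ ⟨R g, g⟩ ds)^{1/2}`. -/
def IsWienerIntegral (R : H →L[ℝ] H) (μ : Measure Ω) (W : ℝ≥0 → H → Ω → ℝ) (t : ℝ≥0)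
    (g : ℝ → H) (I : Ω → ℝ) : Prop :=
  AEStronglyMeasurable g (volume.restrict (Set.Icc (0 : ℝ) t)) ∧
  AEStronglyMeasurable I μ ∧
  ∃ G : ℕ → StepFun H t,
    Tendsto (fun n => ∫⁻ s in Set.Icc (0 : ℝ) t,
      ENNReal.ofReal ⟪g s - (G n).toFun s, R (g s - (G n).toFun s)⟫_ℝ) atTop (𝓝 0) ∧
    Tendsto (fun n => eLpNorm (fun ω => (G n).integral W ω - I ω) 2 μ) atTop (𝓝 0)

/-- `Y` is the `H`-valued stochastic integral `∫₀ᵗ Φ(s) dW_s` of the deterministic operator-valued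
function `Φ`: for every `h`, `⟨h, Y⟩` is the Wiener integral `∫₀ᵗ ⟨Φ(s)† h, dW_s⟩`. -/
def IsStochIntegral [CompleteSpace H] (R : H →L[ℝ] H) (μ : Measure Ω) (W : ℝ≥0 → H → Ω → ℝ)
    (t : ℝ≥0) (Φ : ℝ → H →L[ℝ] H) (Y : Ω → H) : Prop :=
  AEStronglyMeasurable Y μ ∧
  ∀ h : H, IsWienerIntegral R μ W t (fun s => (Φ s).adjoint h) (fun ω => ⟪h, Y ω⟫_ℝ)

/-- `X` is given on `[0, T]` by `X_t = U(t) X₀ + ∫₀ᵗ U(t - s) dW_s`, in a predictable version. -/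
structure IsMildSolution [CompleteSpace H] (R : H →L[ℝ] H) (ℱ : Filtration ℝ≥0 mΩ)
    (μ : Measure Ω) (W : ℝ≥0 → H → Ω → ℝ) (U : ℝ≥0 → H →L[ℝ] H) (X₀ : Ω → H) (T : ℝ≥0)
    (X : ℝ≥0 → Ω → H) : Prop where
  predictable : IsStronglyPredictable ℱ X
  formula : ∀ t ≤ T, ∃ Y : Ω → H,
    IsStochIntegral R μ W t (fun s => U (t - s.toNNReal)) Y ∧
    ∀ᵐ ω ∂μ, X t ω = U t (X₀ ω) + Y ω

/-- `X` is a weak solution on `[0, T]` of `dX = A X dt + dW` with initial value `X₀`. -/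
structure IsWeakSolution [CompleteSpace H] (ℱ : Filtration ℝ≥0 mΩ)
    (μ : Measure Ω) (W : ℝ≥0 → H → Ω → ℝ) (A : H →ₗ.[ℝ] H) (X₀ : Ω → H) (T : ℝ≥0)
    (X : ℝ≥0 → Ω → H) : Prop where
  predictable : IsStronglyPredictable ℱ X
  initial : X 0 =ᵐ[μ] X₀
  integrable : ∀ᵐ ω ∂μ, IntegrableOn (fun s : ℝ => X s.toNNReal ω) (Set.Icc 0 T)
  equation : ∀ ζ : A.adjoint.domain, ∀ t ≤ T, ∀ᵐ ω ∂μ,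
    ⟪X t ω, (ζ : H)⟫_ℝ = ⟪X₀ ω, (ζ : H)⟫_ℝ
      + (∫ s in (0 : ℝ)..t, ⟪X s.toNNReal ω, A.adjoint ζ⟫_ℝ) + W t ζ ω

end Noise

section Score

variable {H : Type*} [NormedAddCommGroup H] [InnerProductSpace ℝ H]
  [MeasurableSpace H] [BorelSpace H] {ι : Type*}

/-- The coordinates `(x^j)_{j ≠ k}` of `x` in the basis `e`. -/
def restCoord (e : HilbertBasis ι ℝ H) (k : ι) (x : H) (j : {j : ι // j ≠ k}) : ℝ :=
  ⟪e j, x⟫_ℝ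

/-- `p y u` is a density in `u` (with respect to Lebesgue measure) of the conditional law under `ρ`
of the coordinate `x^k` given `(x^j)_{j ≠ k} = y`, in a version that for almost every `y` is
positive and differentiable in `u` on the whole line. -/
structure IsCondDensity (e : HilbertBasis ι ℝ H) (ρ : Measure H) [IsFiniteMeasure ρ] (k : ι)
    (p : ({j : ι // j ≠ k} → ℝ) → ℝ → ℝ) : Prop where
  measurable : Measurable (Function.uncurry p)
  density : ∀ᵐ y ∂(ρ.map (restCoord e k)),
    condDistrib (fun x : H => ⟪e k, x⟫_ℝ) (restCoord e k) ρ y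
      = (volume : Measure ℝ).withDensity (fun u => ENNReal.ofReal (p y u))
  regular : ∀ᵐ y ∂(ρ.map (restCoord e k)), (∀ u, 0 < p y u) ∧ Differentiable ℝ (p y)

/-- `G` is the score of `ρ`, by coordinates in the basis `e`: for every `k` the conditional law of
`x^k` given `(x^j)_{j ≠ k}` has a positive differentiable density, and for every such version of the
density, `G x k = ∂/∂x^k log p(x^k | x^j, j ≠ k)` for `ρ`-almost every `x`. -/
def IsScore (e : HilbertBasis ι ℝ H) (ρ : Measure H) [IsFiniteMeasure ρ] (G : H → ι → ℝ) : Prop :=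
  ∀ k, (∃ p, IsCondDensity e ρ k p) ∧
    ∀ p, IsCondDensity e ρ k p →
      ∀ᵐ x ∂ρ, HasDerivAt (fun u => Real.log (p (restCoord e k x) u)) (G x k) ⟪e k, x⟫_ℝ

end Score

end FDP

end

open MeasureTheory ProbabilityTheory Filter Topology
open scoped NNReal ENNReal InnerProductSpace

noncomputable section

namespace FDP

/-! ### Coordinates in a Hilbert basis and Borel measurability. -/

section Score

variable {H : Type*} [NormedAddCommGroup H] [InnerProductSpace ℝ H]
  [MeasurableSpace H] [BorelSpace H] {ι : Type*}

/-! The mild formula gives `X t = U t X₀ + Y`, where `Y` is centred Gaussian with covariance `S =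
covOp U R t` and is independent of `X₀`. Let `S q = e k`, `c = ⟪q, e k⟫ = ⟪q, S q⟫` and `N = ⟪q, Y⟫
/ c`. Then `N` has variance `1 / c` and is uncorrelated with `Y - N • e k`, so by Gaussianity it is
independent of `V = U t X₀ + Y - N • e k`. Adding `N • e k` to `V` moves only the coordinate `k`.
Given the other coordinates, `x^k` is therefore a mixture of Gaussians of variance `1 / c`, with a
positive smooth density. Differentiating under the mixture shows that its logarithmic derivative is
the conditional expectation of `-N / Var N = -⟪q, Y⟫` given `X t`. Since `Y = X t - U t X₀`, this is
the score formula; the conditional law given `X₀ = x₀` is the case of a constant initial vector.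
`score_coord_of_indep_gaussian` and `score_coord_gaussian_shift` carry this part.

The facts about `Y` come from a Wiener integral treated as a closed linear relation. `graph` is the
closure of the span of the pairs `(1_(0, p] B v, W_p v)`, where `⟪B h, B g⟫ = ⟪h, R g⟫`. A closed
linear property that holds on these generators holds on the whole graph (`graph_le`): this yields
the isometry `inner_of_mem_graph` and adaptedness. Gaussianity and independence of `ℱ 0`
(`cexp_of_mem_graph`) hold on finite combinations and pass to the closure by continuity. Finite
trace makes the coordinate integrals square summable, which produces an `H`-valued `Y`
(`exists_isStochIntegral`).

A predictable version is the limit of processes frozen at the left end points of finer and finer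
grids, by a mean square modulus of continuity that is uniform in time. The weak equation needs no
stochastic Fubini theorem: its defect is orthogonal in `L²` to every `W_p h`, hence to every Wiener
integral, hence to itself (`noise_equation`). -/

theorem measurable_restCoord (e : HilbertBasis ι ℝ H) (k : ι) : Measurable (restCoord e k) :=
  measurable_pi_lambda _ fun _ => (continuous_const.inner continuous_id).measurable

theorem measurable_coord (v : H) : Measurable fun x : H => ⟪v, x⟫_ℝ :=
  (continuous_const.inner continuous_id).measurable

/-- The coordinates in a Hilbert basis determine the Borel structure. -/
theorem measurableEmbedding_coords [CompleteSpace H] [SecondCountableTopology H] [Countable ι]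
    (e : HilbertBasis ι ℝ H) : MeasurableEmbedding fun (x : H) (j : ι) => ⟪e j, x⟫_ℝ := by
  refine Measurable.measurableEmbedding (measurable_pi_lambda _ fun _ => measurable_coord _) ?_
  intro x y hxy
  apply e.repr.injective
  ext j
  simpa [e.repr_apply_apply] using congrFun hxy j

/-- An injective measurable map between standard Borel spaces has measurable images, so Borel sets
of `H` may be tested after splitting off the coordinate `k`. -/
theorem measurableEmbedding_restCoord_prod [CompleteSpace H] [SecondCountableTopology H]
    [Countable ι] (e : HilbertBasis ι ℝ H) (k : ι) :
    MeasurableEmbedding fun x : H => (restCoord e k x, ⟪e k, x⟫_ℝ) := by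
  refine Measurable.measurableEmbedding
    ((measurable_restCoord e k).prodMk (measurable_coord _)) ?_
  intro x y hxy
  apply e.repr.injective
  ext j
  rw [e.repr_apply_apply, e.repr_apply_apply]
  by_cases hj : j = k
  · subst hj
    exact (Prod.ext_iff.1 hxy).2
  · exact congrFun (Prod.ext_iff.1 hxy).1 ⟨j, hj⟩

theorem measurable_of_forall_coord [CompleteSpace H] [SecondCountableTopology H] [Countable ι]
    (e : HilbertBasis ι ℝ H) {α : Type*} [MeasurableSpace α] {f : α → H}
    (hf : ∀ j, Measurable fun a => ⟪e j, f a⟫_ℝ) : Measurable f :=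
  (measurableEmbedding_coords e).measurable_comp_iff.1 (measurable_pi_lambda _ hf)

end Score

/-! ### Gaussian mixtures on the line. -/

section Mixture

theorem hasDerivAt_gaussianPDFReal (w : ℝ) {v : ℝ≥0} (hv : v ≠ 0) (u : ℝ) :
    HasDerivAt (gaussianPDFReal w v) (-(u - w) / v * gaussianPDFReal w v u) u := by
  have hv' : (v : ℝ) ≠ 0 := by exact_mod_cast hv
  have h1 : HasDerivAt (fun x : ℝ => -(x - w) ^ 2 / (2 * v)) (-(u - w) / v) u := by
    refine HasDerivAt.congr_deriv
      (((((hasDerivAt_id' u).sub_const w).pow 2).neg).div_const (2 * (v : ℝ))) ?_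
    simp only [Nat.cast_ofNat, Nat.add_one_sub_one, pow_one, mul_one]
    field_simp
  rw [gaussianPDFReal_def]
  refine ((h1.exp).const_mul (√(2 * Real.pi * v))⁻¹).congr_deriv ?_
  ring

/-- With `x = u - w`, use `|x| ≤ 1 + x²` and `y * exp (-y) ≤ 1` at `y = x² / (2v)`. The bound is
uniform in `w` and `u`, so differentiating under the mixture requires no moment of the mixing
measure. -/
theorem abs_deriv_gaussianPDFReal_le (w : ℝ) {v : ℝ≥0} (hv : v ≠ 0) (u : ℝ) :
    |-(u - w) / v * gaussianPDFReal w v u| ≤ (√(2 * Real.pi * v))⁻¹ * (1 / v + 2) := by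
  have hv0 : (0 : ℝ) < v := by exact_mod_cast pos_iff_ne_zero.2 hv
  have hs : (0 : ℝ) ≤ (√(2 * Real.pi * v))⁻¹ := by positivity
  rw [gaussianPDFReal]
  have h1 : |-(u - w) / v * ((√(2 * Real.pi * v))⁻¹ * Real.exp (-(u - w) ^ 2 / (2 * v)))|
      = (√(2 * Real.pi * v))⁻¹ * (|u - w| / v * Real.exp (-(u - w) ^ 2 / (2 * v))) := by
    rw [abs_mul, abs_mul, abs_div, abs_neg, abs_of_pos hv0, abs_of_nonneg hs,
      abs_of_pos (Real.exp_pos _)]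
    ring
  rw [h1]
  refine mul_le_mul_of_nonneg_left ?_ hs
  set x := u - w
  have h2 : |x| ≤ 1 + x ^ 2 := by
    rw [← sq_abs]; nlinarith [sq_nonneg (|x| - 1), abs_nonneg x]
  set E := Real.exp (-x ^ 2 / (2 * v))
  have hE : E ≤ 1 := Real.exp_le_one_iff.2 (by
    rw [neg_div]; exact neg_nonpos.2 (by positivity))
  have hE0 : 0 < E := Real.exp_pos _
  have h3 : x ^ 2 / (2 * v) * E ≤ 1 := by
    have : x ^ 2 / (2 * v) ≤ Real.exp (x ^ 2 / (2 * v)) := by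
      linarith [Real.add_one_le_exp (x ^ 2 / (2 * v))]
    calc x ^ 2 / (2 * v) * E ≤ Real.exp (x ^ 2 / (2 * v)) * E :=
          mul_le_mul_of_nonneg_right this hE0.le
      _ = 1 := by rw [← Real.exp_add, neg_div, add_neg_cancel, Real.exp_zero]
  calc |x| / v * E ≤ (1 + x ^ 2) / v * E := by gcongr
    _ = 1 / v * E + 2 * (x ^ 2 / (2 * v) * E) := by field_simp
    _ ≤ 1 / v * 1 + 2 * 1 := by gcongr
    _ = 1 / v + 2 := by ring

theorem gaussianPDFReal_le (w : ℝ) (v : ℝ≥0) (u : ℝ) :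
    gaussianPDFReal w v u ≤ (√(2 * Real.pi * v))⁻¹ := by
  rw [gaussianPDFReal]
  refine mul_le_of_le_one_right (by positivity) (Real.exp_le_one_iff.2 ?_)
  rw [neg_div]; exact neg_nonpos.2 (by positivity)

theorem measurable_gaussianPDFReal_uncurry (v : ℝ≥0) :
    Measurable fun z : ℝ × ℝ => gaussianPDFReal z.1 v z.2 := by
  unfold gaussianPDFReal; fun_prop

theorem measurable_gaussianPDFReal_left (v : ℝ≥0) (u : ℝ) :
    Measurable fun w : ℝ => gaussianPDFReal w v u := by
  unfold gaussianPDFReal; fun_prop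

/-- The density of the convolution of `m` with the centred Gaussian law of variance `v`. -/
def gaussianMix (m : Measure ℝ) (v : ℝ≥0) (u : ℝ) : ℝ := ∫ w, gaussianPDFReal w v u ∂m

/-- The derivative of `gaussianMix`. -/
def gaussianMixDeriv (m : Measure ℝ) (v : ℝ≥0) (u : ℝ) : ℝ :=
  ∫ w, -(u - w) / v * gaussianPDFReal w v u ∂m

theorem integrable_gaussianPDFReal_left (m : Measure ℝ) [IsFiniteMeasure m] (v : ℝ≥0) (u : ℝ) :
    Integrable (fun w => gaussianPDFReal w v u) m :=
  Integrable.of_bound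
    (measurable_gaussianPDFReal_left v u).aestronglyMeasurable
    (√(2 * Real.pi * v))⁻¹ (ae_of_all _ fun w => by
      rw [Real.norm_of_nonneg (gaussianPDFReal_nonneg _ _ _)]; exact gaussianPDFReal_le w v u)

theorem hasDerivAt_gaussianMix (m : Measure ℝ) [IsFiniteMeasure m] {v : ℝ≥0} (hv : v ≠ 0)
    (u : ℝ) : HasDerivAt (gaussianMix m v) (gaussianMixDeriv m v u) u := by
  have h0 : Measurable fun w : ℝ => -(u - w) / (v : ℝ) := by fun_prop
  have hmeas : Measurable fun w : ℝ => -(u - w) / (v : ℝ) * gaussianPDFReal w v u := 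
    h0.mul (measurable_gaussianPDFReal_left v u)
  have hF : ∀ᶠ x in 𝓝 u, AEStronglyMeasurable (fun w => gaussianPDFReal w v x) m :=
    Eventually.of_forall fun x => (integrable_gaussianPDFReal_left m v x).aestronglyMeasurable
  have hb : ∀ᵐ w ∂m, ∀ x ∈ (Set.univ : Set ℝ),
      ‖-(x - w) / v * gaussianPDFReal w v x‖ ≤ (√(2 * Real.pi * v))⁻¹ * (1 / v + 2) :=
    ae_of_all _ fun w x _ => (Real.norm_eq_abs _).trans_le (abs_deriv_gaussianPDFReal_le w hv x)
  have hd : ∀ᵐ w ∂m, ∀ x ∈ (Set.univ : Set ℝ), HasDerivAt (fun x => gaussianPDFReal w v x)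
      (-(x - w) / v * gaussianPDFReal w v x) x :=
    ae_of_all _ fun w x _ => hasDerivAt_gaussianPDFReal w hv x
  have key := hasDerivAt_integral_of_dominated_loc_of_deriv_le (𝕜 := ℝ) univ_mem hF
    (integrable_gaussianPDFReal_left m v u) hmeas.aestronglyMeasurable
    hb (integrable_const _) hd
  exact key.2

theorem gaussianMix_pos (m : Measure ℝ) [IsFiniteMeasure m] [NeZero m] {v : ℝ≥0} (hv : v ≠ 0)
    (u : ℝ) : 0 < gaussianMix m v u := by
  rw [gaussianMix, integral_pos_iff_support_of_nonneg
    (fun w => gaussianPDFReal_nonneg w v u) (integrable_gaussianPDFReal_left m v u)]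
  have : Function.support (fun w => gaussianPDFReal w v u) = Set.univ := by
    ext w; simpa using (gaussianPDFReal_pos w v u hv).ne'
  rw [this]
  exact Measure.measure_univ_pos.2 (NeZero.ne m)

variable {𝓨 : Type*} [MeasurableSpace 𝓨]

theorem measurable_gaussianMix (κ : Kernel 𝓨 ℝ) [IsMarkovKernel κ] (v : ℝ≥0) :
    Measurable (Function.uncurry fun y u => gaussianMix (κ y) v u) := by
  have : StronglyMeasurable fun z : 𝓨 × ℝ =>
      ∫ w, gaussianPDFReal w v z.2 ∂(κ.prodMkRight ℝ z) := by
    refine StronglyMeasurable.integral_kernel_prod_right (κ := κ.prodMkRight ℝ)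
      (f := fun (z : 𝓨 × ℝ) w => gaussianPDFReal w v z.2) ?_
    exact ((measurable_gaussianPDFReal_uncurry v).comp
      (measurable_snd.prodMk (measurable_snd.comp measurable_fst))).stronglyMeasurable
  exact this.measurable

end Mixture

theorem _root_.Measurable.gaussianPDF {α : Type*} [MeasurableSpace α] {f g : α → ℝ}
    (hf : Measurable f) (hg : Measurable g) (v : ℝ≥0) :
    Measurable fun a => gaussianPDF (f a) v (g a) := by
  unfold ProbabilityTheory.gaussianPDF gaussianPDFReal
  fun_prop

/-! ### Joint laws after adding independent Gaussian noise. -/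

section MixtureLaw

variable {𝓨 : Type*} [MeasurableSpace 𝓨] {Ω : Type*} {mΩ : MeasurableSpace Ω}
  {P : Measure Ω} [IsProbabilityMeasure P]

/-- Given `(r, w)`, independence makes `w + N` Gaussian with mean `w`. The last coordinate `w` is
retained so that `N` can be recovered as `z.1.2 - z.2`. -/
theorem map_mixture_eq_withDensity {r : Ω → 𝓨} {w N : Ω → ℝ} (hr : Measurable r)
    (hw : Measurable w) (hN : Measurable N) {v : ℝ≥0} (hv : v ≠ 0)
    (hlaw : P.map N = gaussianReal 0 v) (hind : IndepFun (fun ω => (r ω, w ω)) N P) :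
    P.map (fun ω => ((r ω, w ω + N ω), w ω))
      = (((P.map r).prod volume) ⊗ₘ (condDistrib w r P).prodMkRight ℝ).withDensity
          fun z => gaussianPDF z.2 v z.1.2 := by
  have := Measure.isProbabilityMeasure_map (μ := P) hr.aemeasurable
  refine Measure.ext_of_lintegral _ fun f hf => ?_
  have hpdf' : Measurable fun z : (𝓨 × ℝ) × ℝ => gaussianPDF z.2 v z.1.2 :=
    measurable_snd.gaussianPDF (measurable_snd.comp measurable_fst) v
  have hg : Measurable fun z : (𝓨 × ℝ) × ℝ => gaussianPDF z.2 v z.1.2 * f z := hpdf'.mul hf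
  rw [lintegral_map hf (by fun_prop), lintegral_withDensity_eq_lintegral_mul _ hpdf' hf]
  simp only [Pi.mul_apply]
  rw [Measure.lintegral_compProd hg, lintegral_prod _ (by
    exact (Measurable.lintegral_kernel_prod_right' hg).aemeasurable)]
  have hjoint := (indepFun_iff_map_prod_eq_prod_map_map (hr.prodMk hw).aemeasurable
    hN.aemeasurable).1 hind
  have hfm : Measurable fun q : (𝓨 × ℝ) × ℝ => f ((q.1.1, q.1.2 + q.2), q.1.2) := by fun_prop
  have h1 : ∫⁻ ω, f ((r ω, w ω + N ω), w ω) ∂P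
      = ∫⁻ q, f ((q.1.1, q.1.2 + q.2), q.1.2) ∂((P.map fun ω => (r ω, w ω)).prod (P.map N)) := by
    rw [← hjoint, lintegral_map hfm ((hr.prodMk hw).prodMk hN)]
  have h2 : ∀ a : 𝓨 × ℝ, ∫⁻ n, f ((a.1, a.2 + n), a.2) ∂(gaussianReal 0 v)
      = ∫⁻ u, gaussianPDF a.2 v u * f ((a.1, u), a.2) := by
    intro a
    have hm : Measurable fun u : ℝ => f ((a.1, u), a.2) := by fun_prop
    rw [← lintegral_map (f := fun u => f ((a.1, u), a.2)) (g := fun n => a.2 + n) hm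
      (measurable_const_add _), gaussianReal_map_const_add, zero_add,
      gaussianReal_of_var_ne_zero _ hv,
      lintegral_withDensity_eq_lintegral_mul _ (measurable_gaussianPDF _ _) hm]
    rfl
  rw [h1, hlaw, lintegral_prod _ hfm.aemeasurable, lintegral_congr h2,
    ← compProd_map_condDistrib hw.aemeasurable, Measure.lintegral_compProd (by
      refine Measurable.lintegral_prod_right'
        (f := fun q : (𝓨 × ℝ) × ℝ => gaussianPDF q.1.2 v q.2 * f ((q.1.1, q.2), q.1.2)) ?_
      exact ((measurable_snd.comp measurable_fst).gaussianPDF measurable_snd v).mul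
        (by fun_prop))]
  refine lintegral_congr fun y => ?_
  simp only [Kernel.prodMkRight_apply]
  rw [lintegral_lintegral_swap]
  refine ((measurable_fst.gaussianPDF measurable_snd v).mul ?_).aemeasurable
  exact (by fun_prop : Measurable fun q : ℝ × ℝ => f ((y, q.2), q.1))

variable {r : Ω → 𝓨} {w N : Ω → ℝ} (hr : Measurable r)
    (hw : Measurable w) (hN : Measurable N) {v : ℝ≥0} (hv : v ≠ 0)
    (hlaw : P.map N = gaussianReal 0 v) (hind : IndepFun (fun ω => (r ω, w ω)) N P)

include hr hw hN hv hlaw hind in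
theorem map_add_eq_withDensity :
    P.map (fun ω => (r ω, w ω + N ω)) = ((P.map r).prod volume).withDensity
      fun z => ENNReal.ofReal (gaussianMix (condDistrib w r P z.1) v z.2) := by
  have := Measure.isProbabilityMeasure_map (μ := P) hr.aemeasurable
  have hpdf' : Measurable fun z : (𝓨 × ℝ) × ℝ => gaussianPDF z.2 v z.1.2 :=
    measurable_snd.gaussianPDF (measurable_snd.comp measurable_fst) v
  have hmap : P.map (fun ω => (r ω, w ω + N ω))
      = (P.map (fun ω => ((r ω, w ω + N ω), w ω))).map Prod.fst := by
    rw [Measure.map_map measurable_fst (by fun_prop)]; rfl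
  ext B hB
  rw [hmap, map_mixture_eq_withDensity hr hw hN hv hlaw hind, Measure.map_apply measurable_fst hB,
    withDensity_apply _ (measurable_fst hB), withDensity_apply _ hB,
    ← Set.prod_univ, Measure.setLIntegral_compProd hpdf' hB MeasurableSet.univ]
  refine lintegral_congr fun z => ?_
  rw [gaussianMix, ofReal_integral_eq_lintegral_ofReal (integrable_gaussianPDFReal_left _ _ _)
    (ae_of_all _ fun _ => gaussianPDFReal_nonneg _ _ _)]
  simp [gaussianPDF]

-- On the joint law `-N / v` is the logarithmic derivative of the Gaussian density, so integrating
-- `w` out leaves the derivative of the mixture density. Together with `map_add_eq_withDensity` this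
-- identifies `gaussianMixDeriv / gaussianMix` as the conditional expectation of `-N / v` given `(r,
-- w + N)`.
include hr hw hN hv hlaw hind in
theorem integral_mixture_eq (hint : Integrable N P) :
    Integrable (fun z : 𝓨 × ℝ => gaussianMixDeriv (condDistrib w r P z.1) v z.2)
      ((P.map r).prod volume) ∧
    ∀ B : Set (𝓨 × ℝ), MeasurableSet B →
      ∫ ω in (fun ω => (r ω, w ω + N ω)) ⁻¹' B, -(N ω) / v ∂P
        = ∫ z in B, gaussianMixDeriv (condDistrib w r P z.1) v z.2 ∂((P.map r).prod volume) := by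
  have := Measure.isProbabilityMeasure_map (μ := P) hr.aemeasurable
  set M := ((P.map r).prod volume) ⊗ₘ (condDistrib w r P).prodMkRight ℝ with hM
  have hJ := map_mixture_eq_withDensity hr hw hN hv hlaw hind
  rw [← hM] at hJ
  have hτ : Measurable fun ω => ((r ω, w ω + N ω), w ω) := by fun_prop
  have hpdf' : Measurable fun z : (𝓨 × ℝ) × ℝ => gaussianPDF z.2 v z.1.2 :=
    measurable_snd.gaussianPDF (measurable_snd.comp measurable_fst) v
  have hψ : Measurable fun z : (𝓨 × ℝ) × ℝ => -(z.1.2 - z.2) / (v : ℝ) := by fun_prop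
  have hfin : ∀ᵐ z ∂M, gaussianPDF z.2 v z.1.2 < ∞ := ae_of_all _ fun _ => gaussianPDF_lt_top
  have hI : Integrable (fun z : (𝓨 × ℝ) × ℝ => -(z.1.2 - z.2) / (v : ℝ))
      (M.withDensity fun z => gaussianPDF z.2 v z.1.2) := by
    rw [← hJ, integrable_map_measure hψ.aestronglyMeasurable hτ.aemeasurable]
    refine (hint.neg.div_const (v : ℝ)).congr (ae_of_all _ fun ω => ?_)
    simp
  have hIM : Integrable (fun z : (𝓨 × ℝ) × ℝ =>
      -(z.1.2 - z.2) / (v : ℝ) * gaussianPDFReal z.2 v z.1.2) M := by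
    refine ((integrable_withDensity_iff_integrable_smul' hpdf' hfin).1 hI).congr
      (ae_of_all _ fun z => ?_)
    simp [toReal_gaussianPDF, mul_comm]
  refine ⟨(show Integrable _ ((Kernel.const Unit _ ⊗ₖ Kernel.prodMkLeft Unit _) ()) from
    hIM).integral_compProd, fun B hB => ?_⟩
  have h1 : ∫ ω in (fun ω => (r ω, w ω + N ω)) ⁻¹' B, -(N ω) / v ∂P
      = ∫ z in B ×ˢ Set.univ, -(z.1.2 - z.2) / (v : ℝ)
          ∂(P.map fun ω => ((r ω, w ω + N ω), w ω)) := by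
    rw [setIntegral_map (hB.prod MeasurableSet.univ) hψ.aestronglyMeasurable hτ.aemeasurable]
    have : (fun ω => ((r ω, w ω + N ω), w ω)) ⁻¹' (B ×ˢ (Set.univ : Set ℝ))
        = (fun ω => (r ω, w ω + N ω)) ⁻¹' B := by ext; simp
    rw [this]
    simp
  rw [h1, hJ, setIntegral_withDensity_eq_setIntegral_toReal_smul hpdf' 
      (ae_of_all _ fun _ => gaussianPDF_lt_top) _ (hB.prod MeasurableSet.univ), hM,
    Measure.setIntegral_compProd hB MeasurableSet.univ (by
      refine (hIM.congr (ae_of_all _ fun z => ?_)).integrableOn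
      simp [toReal_gaussianPDF, mul_comm])]
  simp [gaussianMixDeriv, toReal_gaussianPDF, mul_comm]

end MixtureLaw

/-! ### One coordinate of the score. -/

section ScoreCoord

theorem lintegral_gaussianMix (m : Measure ℝ) [IsProbabilityMeasure m] {v : ℝ≥0} (hv : v ≠ 0) :
    ∫⁻ u, ENNReal.ofReal (gaussianMix m v u) = 1 := by
  have h : ∀ u, ENNReal.ofReal (gaussianMix m v u) = ∫⁻ w, gaussianPDF w v u ∂m := fun u => by
    rw [gaussianMix, ofReal_integral_eq_lintegral_ofReal (integrable_gaussianPDFReal_left _ _ _)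
      (ae_of_all _ fun _ => gaussianPDFReal_nonneg _ _ _)]
    rfl
  rw [lintegral_congr h, lintegral_lintegral_swap
    (measurable_snd.gaussianPDF measurable_fst v).aemeasurable]
  simp [lintegral_gaussianPDF_eq_one _ hv]

variable {H : Type*} [NormedAddCommGroup H] [InnerProductSpace ℝ H] [CompleteSpace H]
  [SecondCountableTopology H] [MeasurableSpace H] [BorelSpace H] {ι : Type*} [Countable ι]
  {Ω : Type*} {mΩ : MeasurableSpace Ω} {P : Measure Ω} [IsProbabilityMeasure P]

/-- If `ρ` is the law of `V + N eᵏ`, where `N` is Gaussian and independent of `V`, then the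
coordinate `k` of the score of `ρ` exists and is the conditional expectation of `-N / Var N`. -/
theorem score_coord_of_indep_gaussian (e : HilbertBasis ι ℝ H) (k : ι) {V : Ω → H} {N : Ω → ℝ}
    (hV : Measurable V) (hN : Measurable N) {v : ℝ≥0} (hv : v ≠ 0)
    (hlaw : P.map N = gaussianReal 0 v) (hind : IndepFun V N P)
    (ρ : Measure H) [IsFiniteMeasure ρ] (hρ : ρ = P.map fun ω => V ω + N ω • e k)
    {G : H → ℝ} (hG : Integrable G ρ)
    (hGB : ∀ B, MeasurableSet B →
      ∫ x in B, G x ∂ρ = ∫ ω in (fun ω => V ω + N ω • e k) ⁻¹' B, -(N ω) / v ∂P) :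
    (∃ p, IsCondDensity e ρ k p) ∧ ∀ p, IsCondDensity e ρ k p →
      ∀ᵐ x ∂ρ, HasDerivAt (fun u => Real.log (p (restCoord e k x) u)) (G x) ⟪e k, x⟫_ℝ := by
  have hX : Measurable fun ω => V ω + N ω • e k := by fun_prop
  have : IsProbabilityMeasure ρ := hρ ▸ Measure.isProbabilityMeasure_map hX.aemeasurable
  set r : Ω → ({j : ι // j ≠ k} → ℝ) := fun ω => restCoord e k (V ω) with hr_def
  set w : Ω → ℝ := fun ω => ⟪e k, V ω⟫_ℝ with hw_def
  have hr : Measurable r := (measurable_restCoord e k).comp hV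
  have hw : Measurable w := (measurable_coord _).comp hV
  have hind' : IndepFun (fun ω => (r ω, w ω)) N P :=
    hind.comp ((measurable_restCoord e k).prodMk (measurable_coord (e k))) measurable_id
  set κ := condDistrib w r P
  have hφ := measurableEmbedding_restCoord_prod e k
  set φ : H → ({j : ι // j ≠ k} → ℝ) × ℝ := fun x => (restCoord e k x, ⟪e k, x⟫_ℝ) with hφ_def
  have hrX : ∀ ω, restCoord e k (V ω + N ω • e k) = r ω := fun ω => by
    ext j
    have : ⟪e j, e k⟫_ℝ = 0 := e.orthonormal.2 j.2
    simp [restCoord, hr_def, inner_add_right, inner_smul_right, this]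
  have hφX : ∀ ω, φ (V ω + N ω • e k) = (r ω, w ω + N ω) := fun ω => by
    have : ⟪e k, e k⟫_ℝ = 1 := by
      rw [real_inner_self_eq_norm_sq, e.orthonormal.1 k, one_pow]
    simp only [hφ_def, hrX, hw_def, inner_add_right, inner_smul_right, this, mul_one]
  set m := P.map r with hm_def
  have hmρ : ρ.map (restCoord e k) = m := by
    rw [hρ, Measure.map_map (measurable_restCoord e k) hX]
    exact congrArg P.map (funext hrX)
  have : IsProbabilityMeasure m := Measure.isProbabilityMeasure_map hr.aemeasurable
  have hΛ : ρ.map φ = (m.prod volume).withDensity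
      fun z => ENNReal.ofReal (gaussianMix (κ z.1) v z.2) := by
    rw [hρ, Measure.map_map hφ.measurable hX]
    exact (congrArg P.map (funext hφX)).trans
      (map_add_eq_withDensity hr hw hN hv hlaw hind')
  have hp : Measurable (Function.uncurry fun y u => ENNReal.ofReal (gaussianMix (κ y) v u)) :=
    (measurable_gaussianMix κ v).ennreal_ofReal
  have hp' : Measurable fun z : ({j : ι // j ≠ k} → ℝ) × ℝ =>
    ENNReal.ofReal (gaussianMix (κ z.1) v z.2) := hp
  -- the kernel with the density `gaussianMix`
  set η : Kernel ({j : ι // j ≠ k} → ℝ) ℝ := (Kernel.const _ (volume : Measure ℝ)).withDensity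
    fun y u => ENNReal.ofReal (gaussianMix (κ y) v u) with hη
  have hηy : ∀ y, η y = (volume : Measure ℝ).withDensity
      fun u => ENNReal.ofReal (gaussianMix (κ y) v u) := fun y => by
    rw [hη, Kernel.withDensity_apply _ hp, Kernel.const_apply]
  have : IsFiniteKernel η := ⟨1, ENNReal.one_lt_top, fun y => by
    rw [hηy, withDensity_apply _ MeasurableSet.univ, Measure.restrict_univ,
      lintegral_gaussianMix _ hv]⟩
  have hcond : condDistrib (fun x : H => ⟪e k, x⟫_ℝ) (restCoord e k) ρ
      =ᵐ[ρ.map (restCoord e k)] η := by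
    refine condDistrib_ae_eq_of_measure_eq_compProd _ (measurable_coord _).aemeasurable ?_
    rw [hmρ, hη, Measure.compProd_withDensity hp, Measure.compProd_const]
    exact hΛ
  have hcd : IsCondDensity e ρ k fun y u => gaussianMix (κ y) v u :=
    ⟨measurable_gaussianMix κ v, hcond.mono fun y hy => hy.trans (hηy y),
      ae_of_all _ fun y => ⟨fun u => gaussianMix_pos _ hv u,
        fun u => (hasDerivAt_gaussianMix (κ y) hv u).differentiableAt⟩⟩
  refine ⟨⟨_, hcd⟩, fun p hpc => ?_⟩
  -- The claim concerns every admissible version `p`. Two versions agree Lebesgue-almost everywhere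
  -- for almost every `y`, and continuity makes them equal on the whole line.
  have hpe : ∀ᵐ y ∂(ρ.map (restCoord e k)), p y = gaussianMix (κ y) v := by
    filter_upwards [hpc.density, hpc.regular, hcd.density, hcd.regular] with y h1 h2 h3 h4
    have h5 := h1.symm.trans h3
    have h6 : Measurable fun u => ENNReal.ofReal (p y u) :=
      (hpc.measurable.comp measurable_prodMk_left).ennreal_ofReal
    have h7 := (withDensity_eq_iff_of_sigmaFinite h6.aemeasurable
      (hp.comp measurable_prodMk_left).aemeasurable).1 h5
    refine (Continuous.ae_eq_iff_eq volume h2.2.continuous h4.2.continuous).1 ?_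
    filter_upwards [h7] with u hu
    exact (ENNReal.ofReal_eq_ofReal_iff (h2.1 u).le (h4.1 u).le).1 hu
  set s : ({j : ι // j ≠ k} → ℝ) × ℝ → ℝ := fun z =>
    gaussianMixDeriv (κ z.1) v z.2 / gaussianMix (κ z.1) v z.2 with hs_def
  have hNint : Integrable N P := by
    have h := (memLp_id_gaussianReal (μ := 0) (v := v) 1).integrable (by simp)
    rw [← hlaw] at h
    exact h.comp_measurable hN
  obtain ⟨hd1, hd2⟩ := integral_mixture_eq hr hw hN hv hlaw hind' hNint
  have hsp : ∀ z, (ENNReal.ofReal (gaussianMix (κ z.1) v z.2)).toReal • s z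
      = gaussianMixDeriv (κ z.1) v z.2 := fun z => by
    have := gaussianMix_pos (κ z.1) hv z.2
    rw [ENNReal.toReal_ofReal this.le, hs_def, smul_eq_mul]
    field_simp
  have hsΛ : Integrable s (ρ.map φ) := by
    rw [hΛ, integrable_withDensity_iff_integrable_smul' hp' (ae_of_all _ fun _ => by simp)]
    exact hd1.congr (ae_of_all _ fun z => (hsp z).symm)
  have hsρ : Integrable (s ∘ φ) ρ := hsΛ.comp_measurable hφ.measurable
  -- Both functions are integrable and have the same integral over every Borel set, namely that of
  -- `-N / v` over the preimage. Since `φ` is a measurable embedding, each Borel `B` is the preimage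
  -- of the measurable set `φ '' B`.
  have hGs : G =ᵐ[ρ] s ∘ φ := by
    refine Integrable.ae_eq_of_forall_setIntegral_eq _ _ hG hsρ fun B hB _ => ?_
    have hB' := hφ.measurableSet_image.2 hB
    have hBφ : φ ⁻¹' (φ '' B) = B := hφ.injective.preimage_image B
    have h1 : ∫ x in B, (s ∘ φ) x ∂ρ = ∫ z in φ '' B, s z ∂(ρ.map φ) := by
      rw [hφ.setIntegral_map, hBφ]
      rfl
    have h2 : (fun ω => V ω + N ω • e k) ⁻¹' B = (fun ω => (r ω, w ω + N ω)) ⁻¹' (φ '' B) := by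
      conv_lhs => rw [← hBφ]
      ext ω
      rw [Set.mem_preimage, Set.mem_preimage, hφX, Set.mem_preimage]
    rw [hGB B hB, h1, h2, hd2 _ hB', hΛ,
      setIntegral_withDensity_eq_setIntegral_toReal_smul hp' (ae_of_all _ fun _ => by simp) _ hB']
    exact integral_congr_ae (ae_of_all _ fun z => (hsp z).symm)
  filter_upwards [hGs, ae_of_ae_map (measurable_restCoord e k).aemeasurable hpe] with x hx1 hx2
  rw [hx1, hx2]
  exact (hasDerivAt_gaussianMix (κ (restCoord e k x)) hv _).log (gaussianMix_pos _ hv _).ne'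

end ScoreCoord

/-! ### Splitting a Gaussian vector along a basis direction. -/

section GaussianShift

theorem charFun_map_apply {E : Type*} [NormedAddCommGroup E] [InnerProductSpace ℝ E]
    [MeasurableSpace E] [BorelSpace E] [SecondCountableTopology E] {Ω : Type*} {mΩ : MeasurableSpace Ω}
    {P : Measure Ω} {Y : Ω → E}
    (hY : Measurable Y) (h : E) :
    charFun (P.map Y) h = ∫ ω, Complex.exp ((⟪Y ω, h⟫_ℝ : ℝ) * Complex.I) ∂P := by
  rw [charFun_apply, integral_map hY.aemeasurable]
  exact Measurable.aestronglyMeasurable (by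
    have := (continuous_id.inner continuous_const : Continuous fun x : E => ⟪x, h⟫_ℝ).measurable
    fun_prop)

variable {H : Type*} [NormedAddCommGroup H] [InnerProductSpace ℝ H] [CompleteSpace H]
  [SecondCountableTopology H] [MeasurableSpace H] [BorelSpace H] {ι : Type*} [Countable ι]
  {Ω : Type*} {mΩ : MeasurableSpace Ω} {P : Measure Ω} [IsProbabilityMeasure P]

/-- Let `Y` be a centred Gaussian vector with covariance `S`, independent of `X₀`. If `S q = eᵏ`,
then the coordinate `k` of the score of the law of `L X₀ + Y` is the conditional expectation of
`-⟨q, Y⟩`. -/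
theorem score_coord_gaussian_shift (e : HilbertBasis ι ℝ H) (k : ι) {X₀ Y : Ω → H}
    (hX₀ : Measurable X₀) (hY : Measurable Y) (hind : IndepFun X₀ Y P) (L : H →L[ℝ] H)
    (S : H →ₗ[ℝ] H) (hsym : ∀ x y, ⟪S x, y⟫_ℝ = ⟪x, S y⟫_ℝ) (hpos : ∀ x, 0 ≤ ⟪x, S x⟫_ℝ)
    (hchar : ∀ h, charFun (P.map Y) h = Complex.exp ((-(⟪h, S h⟫_ℝ / 2) : ℝ)))
    {q : H} (hq : S q = e k)
    (ρ : Measure H) [IsFiniteMeasure ρ] (hρ : ρ = P.map fun ω => L (X₀ ω) + Y ω)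
    {G : H → ℝ} (hG : Integrable G ρ)
    (hGB : ∀ B, MeasurableSet B →
      ∫ x in B, G x ∂ρ = ∫ ω in (fun ω => L (X₀ ω) + Y ω) ⁻¹' B, -⟪q, Y ω⟫_ℝ ∂P) :
    (∃ p, IsCondDensity e ρ k p) ∧ ∀ p, IsCondDensity e ρ k p →
      ∀ᵐ x ∂ρ, HasDerivAt (fun u => Real.log (p (restCoord e k x) u)) (G x) ⟪e k, x⟫_ℝ := by
  set c : ℝ := ⟪q, e k⟫_ℝ with hc_def
  have hSq : ∀ h, ⟪q, S h⟫_ℝ = ⟪e k, h⟫_ℝ := fun h => by rw [← hsym, hq]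
  have hc : 0 < c := by
    refine lt_of_le_of_ne (by simpa [hq] using hpos q) fun h0 => ?_
    -- the form `⟨·, S ·⟩` at `q + s eᵏ` is affine plus quadratic in `s`, hence negative somewhere
    set d := ⟪e k, S (e k)⟫_ℝ
    have hd : 0 ≤ d := hpos _
    have h1 : ∀ s : ℝ, 0 ≤ 2 * s + s ^ 2 * d := fun s => by
      have := hpos (q + s • e k)
      simp only [map_add, map_smul, inner_add_left, inner_add_right, inner_smul_left,
        inner_smul_right, hq, hSq, real_inner_self_eq_norm_sq, e.orthonormal.1 k] at this
      simp only [← hc_def, ← h0, RCLike.conj_to_real] at this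
      nlinarith [this]
    -- At this `s` the form equals `-(2 + d) / (1 + d)²`, which is negative. Taking `1 + d` rather
    -- than `d` covers the case `d = 0`.
    have h2 := h1 (-(1 / (1 + d)))
    have h3 : 0 < 1 + d := by linarith
    have h4 : 2 * -(1 / (1 + d)) + (-(1 / (1 + d))) ^ 2 * d
        = -(2 + d) / (1 + d) ^ 2 := by field_simp; ring
    rw [h4, neg_div] at h2
    have : 0 < (2 + d) / (1 + d) ^ 2 := by positivity
    linarith
  -- This is a regression: `⟪q, Y⟫` has variance `c` and covariance `⟪h, e k⟫` with `⟪h, Y⟫`, so `Y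
  -- - N • e k` is uncorrelated with `N`.
  set N : Ω → ℝ := fun ω => ⟪q, Y ω⟫_ℝ / c with hN_def
  have hN : Measurable N := ((measurable_coord q).comp hY).div_const c
  set V : Ω → H := fun ω => L (X₀ ω) + Y ω - N ω • e k with hV_def
  have hV : Measurable V := by
    have : Measurable fun ω => L (X₀ ω) := L.measurable.comp hX₀
    fun_prop
  have hVN : ∀ ω, V ω + N ω • e k = L (X₀ ω) + Y ω := fun ω => by simp [hV_def]
  obtain ⟨v, hvc⟩ : ∃ v : ℝ≥0, (v : ℝ) = 1 / c :=
    ⟨(1 / c).toNNReal, Real.coe_toNNReal _ (by positivity)⟩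
  have hv : v ≠ 0 := fun h => by
    rw [h, NNReal.coe_zero] at hvc
    exact (one_div_pos.2 hc).ne hvc
  have hquad : ∀ (h : H) (a : ℝ), ⟪h + a • q, S (h + a • q)⟫_ℝ
      = ⟪h, S h⟫_ℝ + 2 * a * ⟪e k, h⟫_ℝ + a ^ 2 * c := fun h a => by
    simp only [map_add, map_smul, inner_add_left, inner_add_right, inner_smul_left,
      inner_smul_right, hq, hSq, RCLike.conj_to_real]
    rw [real_inner_comm h (e k)]
    ring
  have hjoint : ∀ (h : H) (θ : ℝ),
      ∫ ω, Complex.exp (((⟪V ω, h⟫_ℝ + ⟪N ω, θ⟫_ℝ : ℝ) : ℂ) * Complex.I) ∂P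
      = charFun (P.map X₀) (L.adjoint h)
        * Complex.exp ((-((⟪h, S h⟫_ℝ + (θ ^ 2 - ⟪e k, h⟫_ℝ ^ 2) / c) / 2) : ℝ)) := by
    intro h θ
    -- For this `a`, `⟪V, h⟫ + θ N = ⟪X₀, L† h⟫ + ⟪Y, h + a q⟫`. The quadratic form at `h + a q` is
    -- a function of `h` plus `θ² / c`; the joint characteristic function thus factorises, which is
    -- the independence of `V` and `N`.
    set a : ℝ := (θ - ⟪e k, h⟫_ℝ) / c with ha
    have h1 := (indepFun_iff_charFun_prod hX₀.aemeasurable hY.aemeasurable).1 hind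
      (WithLp.toLp 2 (L.adjoint h, h + a • q))
    have hm : Measurable fun ω => WithLp.toLp 2 (X₀ ω, Y ω) := by fun_prop
    rw [charFun_map_apply hm, hchar, hquad] at h1
    simp only [WithLp.prod_inner_apply] at h1
    convert h1 using 4 with ω
    · congr 2
      rw [ContinuousLinearMap.adjoint_inner_right]
      simp only [hV_def, hN_def, inner_add_left, inner_sub_left, inner_add_right,
        inner_smul_left, inner_smul_right, RCLike.conj_to_real, ha, real_inner_comm q (Y ω)]
      simp only [RCLike.inner_apply, RCLike.conj_to_real]
      field_simp
      ring
    · rw [ha]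
      congr 2
      field_simp
      ring
  have hV1 : ∀ h, charFun (P.map V) h = charFun (P.map X₀) (L.adjoint h)
        * Complex.exp ((-((⟪h, S h⟫_ℝ - ⟪e k, h⟫_ℝ ^ 2 / c) / 2) : ℝ)) := fun h => by
    have := hjoint h 0
    rw [charFun_map_apply hV]
    simp only [inner_zero_right, add_zero] at this
    rw [this]
    congr 3
    ring
  have hN1 : ∀ θ, charFun (P.map N) θ = Complex.exp ((-(θ ^ 2 / c / 2) : ℝ)) := fun θ => by
    have := hjoint 0 θ
    rw [charFun_map_apply hN]
    have hPX := Measure.isProbabilityMeasure_map (μ := P) hX₀.aemeasurable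
    simp only [inner_zero_right, zero_add, map_zero, charFun_zero, probReal_univ] at this
    rw [this]
    simp
  have hlaw : P.map N = gaussianReal 0 v := by
    have := Measure.isProbabilityMeasure_map (μ := P) hN.aemeasurable
    refine Measure.ext_of_charFun (funext fun θ => ?_)
    rw [hN1, charFun_gaussianReal]
    congr 1
    rw [show ((v : ℝ≥0) : ℂ) = ((v : ℝ) : ℂ) from rfl, hvc]
    push_cast
    ring
  have hindVN : IndepFun V N P := by
    refine (indepFun_iff_charFun_prod hV.aemeasurable hN.aemeasurable).2 fun t => ?_
    have hm : Measurable fun ω => WithLp.toLp 2 (V ω, N ω) := by fun_prop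
    rw [charFun_map_apply hm, hV1, hN1]
    simp only [WithLp.prod_inner_apply]
    rw [hjoint, mul_assoc, ← Complex.exp_add, ← Complex.ofReal_add]
    congr 3
    ring
  refine score_coord_of_indep_gaussian e k hV hN hv hlaw hindVN ρ (by simpa only [hVN] using hρ)
    hG fun B hB => ?_
  rw [hGB B hB]
  simp only [hVN]
  refine integral_congr_ae (ae_of_all _ fun ω => ?_)
  simp only [hN_def, hvc]
  field_simp

end GaussianShift

/-! ### Semigroups, generators and measurability. -/

section Semigroup

variable {H : Type*} [NormedAddCommGroup H] [InnerProductSpace ℝ H] [CompleteSpace H]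
  {U : ℝ≥0 → H →L[ℝ] H}

namespace IsC0Semigroup

theorem exists_norm_le (hU : IsC0Semigroup U) (T : ℝ≥0) :
    ∃ M, 0 ≤ M ∧ ∀ t ≤ T, ‖U t‖ ≤ M := by
  obtain ⟨C, hC⟩ := banach_steinhaus (g := fun t : Set.Icc (0 : ℝ≥0) T => U t) fun x => by
    obtain ⟨C, hC⟩ := (isCompact_Icc.image (hU.strong_cont x)).isBounded.exists_norm_le
    exact ⟨C, fun t => hC _ ⟨t, t.2, rfl⟩⟩
  exact ⟨C, (norm_nonneg _).trans (hC ⟨0, by simp⟩), fun t ht => hC ⟨t, zero_le, ht⟩⟩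

omit [CompleteSpace H] in
theorem continuous_toNNReal (hU : IsC0Semigroup U) (x : H) :
    Continuous fun s : ℝ => U s.toNNReal x :=
  (hU.strong_cont x).comp continuous_real_toNNReal

/-- By the semigroup law `(U h - 1) ∫₀ᵗ U s x ds` is the integral over `[t, t + h]` minus the
integral over `[0, h]`. Divided by `h`, these are difference quotients of the primitive of a
continuous function. -/
theorem intervalIntegral_mem_graph (hU : IsC0Semigroup U) {A : H →ₗ.[ℝ] H} (hA : IsGenerator A U)
    (t : ℝ≥0) (x : H) : (∫ s in (0 : ℝ)..t, U s.toNNReal x, U t x - x) ∈ A.graph := by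
  have hc := hU.continuous_toNNReal x
  set f : ℝ → H := fun s => U s.toNNReal x with hf
  have hint : ∀ a b, IntervalIntegrable f volume a b := fun a b => hc.intervalIntegrable a b
  rw [hA]
  have hderiv : ∀ r, HasDerivAt (fun r => ∫ s in (0 : ℝ)..r, f s) (f r) r := fun r =>
    intervalIntegral.integral_hasDerivAt_right (hint 0 r)
      (hc.stronglyMeasurableAtFilter _ _) hc.continuousAt
  have hcoe : Tendsto (fun h : ℝ≥0 => (h : ℝ)) (𝓝[>] 0) (𝓝[≠] 0) := by
    refine tendsto_nhdsWithin_of_tendsto_nhds_of_eventually_within _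
      (NNReal.continuous_coe.tendsto' 0 0 rfl |>.mono_left nhdsWithin_le_nhds) ?_
    filter_upwards [self_mem_nhdsWithin] with h hh
    exact (NNReal.coe_pos.2 hh).ne'
  have h1 := (hasDerivAt_iff_tendsto_slope_zero.1 (hderiv t)).comp hcoe
  have h2 := (hasDerivAt_iff_tendsto_slope_zero.1 (hderiv 0)).comp hcoe
  have h3 := h1.sub h2
  have h4 : f t - f 0 = U t x - x := by simp [hf, hU.map_zero]
  rw [h4] at h3
  refine h3.congr fun h => ?_
  have h5 : U h (∫ s in (0 : ℝ)..t, f s) = ∫ s in (h : ℝ)..(h + t), f s := by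
    rw [← ContinuousLinearMap.intervalIntegral_comp_comm _ (hint _ _)]
    have : ∫ s in (h : ℝ)..(h + t), f s = ∫ s in (0 : ℝ)..t, f (h + s) := by
      rw [intervalIntegral.integral_comp_add_left]; simp
    rw [this]
    refine intervalIntegral.integral_congr fun s hs => ?_
    rw [Set.uIcc_of_le (NNReal.coe_nonneg t)] at hs
    simp only [hf]
    rw [Real.toNNReal_add (NNReal.coe_nonneg h) hs.1, hU.map_add, Real.toNNReal_coe]
    rfl
  rw [h5]
  simp only [Function.comp_apply, zero_add, intervalIntegral.integral_same, sub_zero]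
  rw [← smul_sub]
  congr 1
  have h6 := intervalIntegral.integral_add_adjacent_intervals (hint 0 h) (hint h (h + t))
  rw [add_comm (t : ℝ) h, ← h6]
  abel

/-- The averages `h⁻¹ ∫₀ʰ U s x ds` lie in the domain and tend to `x`. Density is what makes
`A.adjoint` a genuine adjoint. -/
theorem dense_domain (hU : IsC0Semigroup U) {A : H →ₗ.[ℝ] H} (hA : IsGenerator A U) :
    Dense (A.domain : Set H) := by
  intro x
  have hc := hU.continuous_toNNReal x
  have hderiv : HasDerivAt (fun r => ∫ s in (0 : ℝ)..r, U s.toNNReal x) (U (0 : ℝ).toNNReal x) 0 :=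
    intervalIntegral.integral_hasDerivAt_right (hc.intervalIntegrable 0 0)
      (hc.stronglyMeasurableAtFilter _ _) hc.continuousAt
  have h1 := (hasDerivAt_iff_tendsto_slope_zero.1 hderiv).mono_left
    (nhdsWithin_mono (s := Set.Ioi (0 : ℝ)) 0 fun y hy => (Set.mem_Ioi.1 hy).ne')
  have h2 : U (0 : ℝ).toNNReal x = x := by simp [hU.map_zero]
  rw [h2] at h1
  refine mem_closure_of_tendsto h1 ?_
  filter_upwards [self_mem_nhdsWithin] with h hh
  simp only [zero_add, intervalIntegral.integral_same, sub_zero]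
  refine A.domain.smul_mem _ ?_
  have := hU.intervalIntegral_mem_graph hA h.toNNReal x
  rw [Real.coe_toNNReal _ (Set.mem_Ioi.1 hh).le] at this
  exact LinearPMap.mem_domain_of_mem_graph this

/-- The weak form of `(d/dt) U(t) x = A U(t) x`. -/
theorem inner_sub_eq_intervalIntegral (hU : IsC0Semigroup U) {A : H →ₗ.[ℝ] H}
    (hA : IsGenerator A U) (ζ : A.adjoint.domain) (t : ℝ≥0) (x : H) :
    ⟪U t x, (ζ : H)⟫_ℝ - ⟪x, (ζ : H)⟫_ℝ
      = ∫ s in (0 : ℝ)..t, ⟪U s.toNNReal x, A.adjoint ζ⟫_ℝ := by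
  have hc := hU.continuous_toNNReal x
  -- The orbit of a general `x` need not meet the domain of `A`, but its time integral lies there,
  -- and `A` maps it to `U t x - x`.
  obtain ⟨y, hy1, hy2⟩ := LinearPMap.mem_graph_iff _ |>.1 (hU.intervalIntegral_mem_graph hA t x)
  have h1 := LinearPMap.adjoint_isFormalAdjoint (hU.dense_domain hA) ζ y
  simp only at hy1 hy2
  rw [hy1, hy2] at h1
  rw [← inner_sub_left, real_inner_comm, ← h1]
  have h2 : ∀ s : ℝ, ⟪U s.toNNReal x, A.adjoint ζ⟫_ℝ
      = innerSL ℝ (A.adjoint ζ) (U s.toNNReal x) := fun s => by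
    rw [innerSL_apply_apply, real_inner_comm]
  simp only [h2]
  rw [ContinuousLinearMap.intervalIntegral_comp_comm _ (hc.intervalIntegrable 0 t),
    innerSL_apply_apply]

omit [CompleteSpace H] in
/-- The semigroup acts on an eigenvector of its generator by the exponential. -/
theorem apply_eigenvector (hU : IsC0Semigroup U) {A : H →ₗ.[ℝ] H} (hA : IsGenerator A U)
    {x : H} {b : ℝ} (hx : (x, b • x) ∈ A.graph) (t : ℝ≥0) : U t x = Real.exp (b * t) • x := by
  have hlim := (hA _ _).1 hx
  set u : ℝ → H := fun s => U s.toNNReal x with hu_def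
  have hu : ∀ s : ℝ, 0 ≤ s → HasDerivWithinAt u (b • u s) (Set.Ici s) s := by
    intro s hs
    rw [hasDerivWithinAt_iff_tendsto_slope, Set.Ici_sdiff_left]
    have h1 : Tendsto (fun y : ℝ => (y - s).toNNReal) (𝓝[>] s) (𝓝[>] 0) := by
      refine tendsto_nhdsWithin_of_tendsto_nhds_of_eventually_within _ ?_ ?_
      · exact (Continuous.tendsto' (by fun_prop) _ _ (by simp)).mono_left nhdsWithin_le_nhds
      · filter_upwards [self_mem_nhdsWithin] with y hy
        exact Real.toNNReal_pos.2 (sub_pos.2 hy)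
    have h2 := (((U s.toNNReal).continuous.tendsto _).comp hlim).comp h1
    rw [map_smul] at h2
    refine h2.congr' ?_
    filter_upwards [self_mem_nhdsWithin] with y hy
    have hy' : 0 ≤ y - s := (sub_pos.2 hy).le
    have hys : y.toNNReal = s.toNNReal + (y - s).toNNReal := by
      rw [← Real.toNNReal_add hs hy']; congr 1; ring
    simp only [Function.comp_apply, slope, vsub_eq_sub, hu_def, hys, hU.map_add, map_smul, map_sub,
      Real.coe_toNNReal _ hy', ContinuousLinearMap.comp_apply]
  -- The generator gives right derivatives only. This suffices: a continuous function whose right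
  -- derivative vanishes is constant.
  have hconst := constant_of_has_deriv_right_zero (f := fun s => Real.exp (-(b * s)) • u s)
    (a := 0) (b := t) (by
      exact ((by fun_prop : Continuous fun s : ℝ => Real.exp (-(b * s))).smul
        (hU.continuous_toNNReal x)).continuousOn) (fun s hs => by
      have h1 : HasDerivWithinAt (fun s => Real.exp (-(b * s))) (Real.exp (-(b * s)) * -b)
          (Set.Ici s) s := by
        have := (((hasDerivAt_id' s).const_mul b).neg.exp).hasDerivWithinAt (s := Set.Ici s)
        simpa using this
      refine (h1.smul (hu s hs.1)).congr_deriv ?_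
      rw [smul_smul, ← add_smul]
      simp) t ⟨t.2, le_rfl⟩
  simp only [hu_def, Real.toNNReal_coe, mul_zero, neg_zero, Real.exp_zero, Real.toNNReal_zero,
    hU.map_zero, one_smul, ContinuousLinearMap.id_apply] at hconst
  calc U t x = Real.exp (b * t) • Real.exp (-(b * t)) • U t x := by
        rw [smul_smul, ← Real.exp_add, add_neg_cancel, Real.exp_zero, one_smul]
    _ = _ := by rw [hconst]

variable [MeasurableSpace H] [BorelSpace H] [SecondCountableTopology H] {ι : Type*} [Countable ι]
  {α : Type*} [MeasurableSpace α]

/-- Strong continuity of the adjoint semigroup is not needed: `⟪e j, U† g⟫ = ⟪U e j, g⟫`, and the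
orbit of `e j` is continuous. -/
theorem measurable_adjoint_apply (hU : IsC0Semigroup U) (e : HilbertBasis ι ℝ H)
    {f : α → ℝ≥0} {g : α → H} (hf : Measurable f) (hg : Measurable g) :
    Measurable fun a => (U (f a)).adjoint (g a) := by
  refine measurable_of_forall_coord e fun j => ?_
  simp only [ContinuousLinearMap.adjoint_inner_right]
  exact ((hU.strong_cont _).measurable.comp hf).inner hg

theorem measurable_apply (hU : IsC0Semigroup U) (e : HilbertBasis ι ℝ H)
    {f : α → ℝ≥0} {g : α → H} (hf : Measurable f) (hg : Measurable g) :
    Measurable fun a => U (f a) (g a) := by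
  refine measurable_of_forall_coord e fun j => ?_
  simp only [← ContinuousLinearMap.adjoint_inner_left]
  exact (hU.measurable_adjoint_apply e hf measurable_const).inner hg

end IsC0Semigroup

end Semigroup

/-! ### The covariance operator. -/

section CovarianceOperator

variable {H : Type*} [NormedAddCommGroup H] [InnerProductSpace ℝ H] [CompleteSpace H]
  [SecondCountableTopology H] {ι : Type*} [Countable ι]
  {U : ℝ≥0 → H →L[ℝ] H}

namespace IsC0Semigroup

theorem measurable_covIntegrand [MeasurableSpace H] [BorelSpace H] (hU : IsC0Semigroup U)
    (e : HilbertBasis ι ℝ H) (R : H →L[ℝ] H) (t : ℝ≥0) (x : H) :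
    Measurable fun s : ℝ => U (t - s.toNNReal) (R ((U (t - s.toNNReal)).adjoint x)) := by
  have hf : Measurable fun s : ℝ => t - s.toNNReal := by fun_prop
  exact hU.measurable_apply e hf
    (R.continuous.measurable.comp (hU.measurable_adjoint_apply e hf measurable_const))

theorem intervalIntegrable_covIntegrand (hU : IsC0Semigroup U)
    (e : HilbertBasis ι ℝ H) (R : H →L[ℝ] H) (t : ℝ≥0) (x : H) (a b : ℝ) :
    IntervalIntegrable (fun s : ℝ => U (t - s.toNNReal) (R ((U (t - s.toNNReal)).adjoint x)))
      volume a b := by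
  borelize H
  obtain ⟨M, hM0, hM⟩ := hU.exists_norm_le t
  refine (intervalIntegrable_const (c := M * (‖R‖ * (M * ‖x‖)))).mono_fun
    (hU.measurable_covIntegrand e R t x).aestronglyMeasurable (ae_of_all _ fun s => ?_)
  -- Subtraction in `ℝ≥0` is truncated, so the time stays in `[0, t]` for every real `s`.
  have h1 : ‖U (t - s.toNNReal)‖ ≤ M := hM _ tsub_le_self
  rw [Real.norm_of_nonneg (by positivity)]
  refine ((U (t - s.toNNReal)).le_of_opNorm_le h1 _).trans ?_
  refine mul_le_mul_of_nonneg_left ((R.le_opNorm _).trans ?_) hM0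
  refine mul_le_mul_of_nonneg_left ?_ (norm_nonneg _)
  exact ContinuousLinearMap.le_of_opNorm_le _ (by rwa [LinearIsometryEquiv.norm_map]) _

/-- The orientation `t - s` matches the integrand of the mild formula. The reversed form
`inner_covOp` has an integrand free of `t`, which gives monotonicity in `t`. -/
theorem inner_covOp_eq (hU : IsC0Semigroup U) (e : HilbertBasis ι ℝ H) (R : H →L[ℝ] H)
    (t : ℝ≥0) (x y : H) : ⟪x, covOp U R t y⟫_ℝ
      = ∫ s in (0 : ℝ)..t,
        ⟪(U (t - s.toNNReal)).adjoint x, R ((U (t - s.toNNReal)).adjoint y)⟫_ℝ := by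
  rw [covOp, ← innerSL_apply_apply ℝ, ← ContinuousLinearMap.intervalIntegral_comp_comm _
    (hU.intervalIntegrable_covIntegrand e R t y 0 t)]
  simp only [innerSL_apply_apply, ContinuousLinearMap.adjoint_inner_left]

/-- The bilinear form of the covariance operator. -/
theorem inner_covOp (hU : IsC0Semigroup U) (e : HilbertBasis ι ℝ H) (R : H →L[ℝ] H)
    (t : ℝ≥0) (x y : H) : ⟪x, covOp U R t y⟫_ℝ
      = ∫ s in (0 : ℝ)..t,
        ⟪(U s.toNNReal).adjoint x, R ((U s.toNNReal).adjoint y)⟫_ℝ := by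
  rw [hU.inner_covOp_eq e]
  have := intervalIntegral.integral_comp_sub_left (a := 0) (b := t)
    (fun s : ℝ => ⟪(U s.toNNReal).adjoint x, R ((U s.toNNReal).adjoint y)⟫_ℝ) t
  rw [sub_self, sub_zero] at this
  rw [← this]
  refine intervalIntegral.integral_congr fun s hs => ?_
  rw [Set.uIcc_of_le (NNReal.coe_nonneg t)] at hs
  rw [NNReal.sub_def, Real.coe_toNNReal _ hs.1]

omit [SecondCountableTopology H] in
theorem _root_.FDP.abs_inner_adjoint_le (R : H →L[ℝ] H) {T : ℝ≥0} {M : ℝ}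
    (hM0 : 0 ≤ M) (hM : ∀ t ≤ T, ‖U t‖ ≤ M) {s : ℝ≥0} (hs : s ≤ T) (x y : H) :
    |⟪(U s).adjoint x, R ((U s).adjoint y)⟫_ℝ| ≤ (M * ‖x‖) * (‖R‖ * (M * ‖y‖)) := by
  have h1 : ∀ z, ‖(U s).adjoint z‖ ≤ M * ‖z‖ := fun z =>
    ContinuousLinearMap.le_of_opNorm_le _ (by rw [LinearIsometryEquiv.norm_map]; exact hM s hs) _
  refine (abs_real_inner_le_norm _ _).trans ?_
  gcongr
  · exact h1 x
  · exact (R.le_opNorm _).trans (by gcongr; exact h1 y)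

theorem intervalIntegrable_inner_adjoint (hU : IsC0Semigroup U) (e : HilbertBasis ι ℝ H)
    (R : H →L[ℝ] H) (x y : H) {a b : ℝ} (hab : a ≤ b) :
    IntervalIntegrable (fun s : ℝ => ⟪(U s.toNNReal).adjoint x, R ((U s.toNNReal).adjoint y)⟫_ℝ)
      volume a b := by
  borelize H
  obtain ⟨M, hM0, hM⟩ := hU.exists_norm_le b.toNNReal
  refine IntervalIntegrable.mono_fun' (g := fun _ => (M * ‖x‖) * (‖R‖ * (M * ‖y‖)))
    intervalIntegrable_const ?_ ?_
  · have hm : ∀ z, Measurable fun s : ℝ => (U s.toNNReal).adjoint z := fun z =>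
      hU.measurable_adjoint_apply e measurable_real_toNNReal measurable_const
    exact ((hm x).inner (R.continuous.measurable.comp (hm y))).aestronglyMeasurable
  · rw [Set.uIoc_of_le hab]
    filter_upwards [ae_restrict_mem measurableSet_Ioc] with s hs
    exact abs_inner_adjoint_le R hM0 hM (Real.toNNReal_le_toNNReal hs.2) x y

theorem inner_covOp_comm (hU : IsC0Semigroup U) (e : HilbertBasis ι ℝ H) {R : H →L[ℝ] H}
    (hR : R.IsPositive) (t : ℝ≥0) (x y : H) :
    ⟪covOp U R t x, y⟫_ℝ = ⟪x, covOp U R t y⟫_ℝ := by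
  rw [real_inner_comm, hU.inner_covOp e, hU.inner_covOp e]
  refine intervalIntegral.integral_congr fun s _ => ?_
  rw [← hR.inner_left_eq_inner_right, real_inner_comm]

/-- `covOp` as a linear map. -/
def covLin (hU : IsC0Semigroup U) (e : HilbertBasis ι ℝ H) (R : H →L[ℝ] H) (t : ℝ≥0) :
    H →ₗ[ℝ] H where
  toFun := covOp U R t
  map_add' x y := by
    simp only [covOp, _root_.map_add]
    exact intervalIntegral.integral_add (hU.intervalIntegrable_covIntegrand e R t x 0 t)
      (hU.intervalIntegrable_covIntegrand e R t y 0 t)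
  map_smul' c x := by
    simp only [covOp, map_smul, RingHom.id_apply]
    exact intervalIntegral.integral_smul _ _

theorem inner_covOp_nonneg (hU : IsC0Semigroup U) (e : HilbertBasis ι ℝ H) {R : H →L[ℝ] H}
    (hR : R.IsPositive) (t : ℝ≥0) (x : H) : 0 ≤ ⟪x, covOp U R t x⟫_ℝ := by
  rw [hU.inner_covOp e]
  exact intervalIntegral.integral_nonneg t.2 fun s _ => hR.inner_nonneg_right _

theorem inner_covOp_mono (hU : IsC0Semigroup U) (e : HilbertBasis ι ℝ H) {R : H →L[ℝ] H}
    (hR : R.IsPositive) {s t : ℝ≥0} (hst : s ≤ t) (x : H) :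
    ⟪x, covOp U R s x⟫_ℝ ≤ ⟪x, covOp U R t x⟫_ℝ := by
  rw [hU.inner_covOp e, hU.inner_covOp e]
  exact intervalIntegral.integral_mono_interval le_rfl s.2 hst
    (ae_of_all _ fun s => hR.inner_nonneg_right _)
    (hU.intervalIntegrable_inner_adjoint e R x x t.2)

theorem tendsto_inner_covOp_zero (hU : IsC0Semigroup U) (e : HilbertBasis ι ℝ H)
    (R : H →L[ℝ] H) (x : H) :
    Tendsto (fun t : ℝ≥0 => ⟪x, covOp U R t x⟫_ℝ) (𝓝 0) (𝓝 0) := by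
  obtain ⟨M, hM0, hM⟩ := hU.exists_norm_le 1
  have h1 : Tendsto (fun t : ℝ≥0 => (M * ‖x‖) * (‖R‖ * (M * ‖x‖)) * (t : ℝ)) (𝓝 0) (𝓝 0) :=
    Continuous.tendsto' (by fun_prop) _ _ (by simp)
  refine squeeze_zero_norm' ?_ h1
  filter_upwards [eventually_le_nhds (zero_lt_one : (0 : ℝ≥0) < 1)] with t ht
  rw [hU.inner_covOp e]
  refine (intervalIntegral.norm_integral_le_of_norm_le_const (C := (M * ‖x‖) * (‖R‖ * (M * ‖x‖)))
    fun s hs => ?_).trans ?_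
  · rw [Set.uIoc_of_le (NNReal.coe_nonneg t)] at hs
    exact abs_inner_adjoint_le R hM0 hM
      (Real.toNNReal_le_iff_le_coe.2 (hs.2.trans (by exact_mod_cast ht))) x x
  · rw [sub_zero, NNReal.abs_eq]

omit [SecondCountableTopology H] [Countable ι] in
/-- The covariance operator when the generator and the noise are diagonal. -/
theorem covOp_eigenvector (hU : IsC0Semigroup U) {A : H →ₗ.[ℝ] H} (hA : IsGenerator A U)
    (e : HilbertBasis ι ℝ H) {R : H →L[ℝ] H} {b r : ι → ℝ}
    (hb : ∀ j, ∃ hj : e j ∈ A.domain, A ⟨e j, hj⟩ = b j • e j) (hr : ∀ j, R (e j) = r j • e j)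
    (t : ℝ≥0) {k : ι} (hk : b k ≠ 0) :
    covOp U R t (e k) = (r k * ((Real.exp (2 * b k * t) - 1) / (2 * b k))) • e k := by
  have hUe : ∀ j s, U s (e j) = Real.exp (b j * s) • e j := fun j s => by
    obtain ⟨hj, hAj⟩ := hb j
    refine hU.apply_eigenvector hA ?_ s
    rw [← hAj]
    exact A.mem_graph ⟨e j, hj⟩
  have hUa : ∀ s, (U s).adjoint (e k) = Real.exp (b k * s) • e k := fun s => by
    apply e.repr.injective
    ext j
    rw [e.repr_apply_apply, e.repr_apply_apply, ContinuousLinearMap.adjoint_inner_right, hUe,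
      inner_smul_left, inner_smul_right, RCLike.conj_to_real]
    by_cases hjk : j = k
    · rw [hjk]
    · rw [e.orthonormal.2 hjk, mul_zero, mul_zero]
  have h1 : covOp U R t (e k)
      = ∫ s in (0 : ℝ)..t, (r k * Real.exp (2 * b k * (t - s))) • e k := by
    refine intervalIntegral.integral_congr fun s hs => ?_
    rw [Set.uIcc_of_le (NNReal.coe_nonneg t)] at hs
    have hts : ((t - s.toNNReal : ℝ≥0) : ℝ) = t - s := by
      rw [NNReal.coe_sub (Real.toNNReal_le_iff_le_coe.2 hs.2), Real.coe_toNNReal _ hs.1]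
    simp only [hUa, map_smul, hr, hUe, smul_smul, hts]
    congr 1
    rw [show 2 * b k * (t - s) = b k * (t - s) + b k * (t - s) by ring, Real.exp_add]
    ring
  rw [h1, intervalIntegral.integral_smul_const, intervalIntegral.integral_const_mul,
    intervalIntegral.integral_comp_sub_left (fun s => Real.exp (2 * b k * s)),
    intervalIntegral.integral_comp_mul_left _ (mul_ne_zero two_ne_zero hk), integral_exp]
  simp [div_eq_inv_mul]

end IsC0Semigroup

end CovarianceOperator

/-! ### The Wiener process in `L²` and the isometry. -/

section WienerIsometry

variable {H : Type*} [NormedAddCommGroup H] [InnerProductSpace ℝ H]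
  {Ω : Type*} {mΩ : MeasurableSpace Ω} {μ : Measure Ω}
  {ℱ : Filtration ℝ≥0 mΩ} {R : H →L[ℝ] H} {W : ℝ≥0 → H → Ω → ℝ}

namespace IsWienerProcess

theorem measurable (hW : IsWienerProcess R ℱ μ W) (t : ℝ≥0) (h : H) : Measurable (W t h) :=
  (hW.adapted t h).mono (ℱ.le t) le_rfl

theorem map_eq_gaussianReal (hW : IsWienerProcess R ℱ μ W) (t : ℝ≥0) (h : H) :
    μ.map (W t h) = gaussianReal 0 (t * (⟪h, R h⟫_ℝ).toNNReal) := by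
  have h1 := hW.gaussian 0 t h zero_le
  rw [tsub_zero] at h1
  rw [← h1]
  refine Measure.map_congr ?_
  filter_upwards [hW.start h] with ω hω
  simp [hω]

theorem memLp (hW : IsWienerProcess R ℱ μ W) (t : ℝ≥0) (h : H) : MemLp (W t h) 2 μ := by
  have h1 := memLp_id_gaussianReal (μ := 0) (v := t * (⟪h, R h⟫_ℝ).toNNReal) 2
  rw [← hW.map_eq_gaussianReal t h] at h1
  exact (memLp_map_measure_iff aestronglyMeasurable_id (hW.measurable t h).aemeasurable).1 h1

/-- The Wiener process at time `t` as a linear map into `L²`. -/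
def toLp (hW : IsWienerProcess R ℱ μ W) (t : ℝ≥0) : H →ₗ[ℝ] Lp ℝ 2 μ where
  toFun h := (hW.memLp t h).toLp (W t h)
  map_add' h g := by
    rw [← MemLp.toLp_add]
    refine MemLp.toLp_congr _ _ ?_
    filter_upwards [hW.linear t 1 1 h g] with ω hω
    simpa using hω
  map_smul' c h := by
    rw [RingHom.id_apply, ← MemLp.toLp_const_smul]
    refine MemLp.toLp_congr _ _ ?_
    filter_upwards [hW.linear t c 0 h 0] with ω hω
    simpa using hω

theorem coeFn_toLp (hW : IsWienerProcess R ℱ μ W) (t : ℝ≥0) (h : H) :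
    hW.toLp t h =ᵐ[μ] W t h := (hW.memLp t h).coeFn_toLp

theorem toLp_zero (hW : IsWienerProcess R ℱ μ W) (h : H) : hW.toLp 0 h = 0 := by
  refine Lp.ext ?_
  filter_upwards [hW.coeFn_toLp 0 h, hW.start h, Lp.coeFn_zero ℝ 2 μ] with ω h1 h2 h3
  rw [h1, h2, h3]

theorem norm_toLp_sub_sq (hW : IsWienerProcess R ℱ μ W) (hR : R.IsPositive) {s t : ℝ≥0}
    (hst : s ≤ t) (h : H) :
    ‖hW.toLp t h - hW.toLp s h‖ ^ 2 = (t - s) * ⟪h, R h⟫_ℝ := by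
  rw [← real_inner_self_eq_norm_sq, L2.inner_def]
  have h1 : ∫ a, ⟪(hW.toLp t h - hW.toLp s h : Lp ℝ 2 μ) a,
      (hW.toLp t h - hW.toLp s h : Lp ℝ 2 μ) a⟫_ℝ ∂μ
      = ∫ a, (W t h a - W s h a) ^ 2 ∂μ := by
    refine integral_congr_ae ?_
    filter_upwards [Lp.coeFn_sub (hW.toLp t h) (hW.toLp s h), hW.coeFn_toLp t h,
      hW.coeFn_toLp s h] with ω h1 h2 h3
    rw [h1, Pi.sub_apply, h2, h3, real_inner_self_eq_norm_sq, Real.norm_eq_abs, sq_abs]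
  have hm : Measurable fun a => W t h a - W s h a := (hW.measurable t h).sub (hW.measurable s h)
  have h2 : ∫ a, (W t h a - W s h a) ^ 2 ∂μ
      = ∫ x, x ^ 2 ∂(gaussianReal 0 ((t - s) * (⟪h, R h⟫_ℝ).toNNReal)) := by
    rw [← hW.gaussian s t h hst, integral_map hm.aemeasurable (by fun_prop)]
  have h3 := variance_fun_id_gaussianReal (μ := 0) (v := (t - s) * (⟪h, R h⟫_ℝ).toNNReal)
  rw [variance_of_integral_eq_zero (by fun_prop) (by simp)] at h3
  rw [h1, h2, h3, NNReal.coe_mul, NNReal.coe_sub hst, Real.coe_toNNReal _ (hR.inner_nonneg_right h)]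

/-- Independence factorises the expectation and the increment has mean zero. Allowing an arbitrary
`Z` from the past serves both the covariance formula and the induction in `cexp_pair`. -/
theorem inner_toLp_increment (hW : IsWienerProcess R ℱ μ W) {s t : ℝ≥0} (hst : s ≤ t) (h : H)
    {Z : Ω → ℝ} (hZ : Measurable[ℱ s] Z) (hZ2 : MemLp Z 2 μ) :
    ⟪hZ2.toLp Z, hW.toLp t h - hW.toLp s h⟫_ℝ = 0 := by
  rw [L2.inner_def]
  have h1 : ∫ a, ⟪hZ2.toLp Z a, (hW.toLp t h - hW.toLp s h : Lp ℝ 2 μ) a⟫_ℝ ∂μ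
      = ∫ a, (W t h a - W s h a) * Z a ∂μ := by
    refine integral_congr_ae ?_
    filter_upwards [Lp.coeFn_sub (hW.toLp t h) (hW.toLp s h), hW.coeFn_toLp t h,
      hW.coeFn_toLp s h, hZ2.coeFn_toLp] with ω h1 h2 h3 h4
    rw [h1, Pi.sub_apply, h2, h3, h4]
    simp
  have hm : Measurable fun a => W t h a - W s h a := (hW.measurable t h).sub (hW.measurable s h)
  have hind : IndepFun (fun a => W t h a - W s h a) Z μ :=
    indep_of_indep_of_le_right (hW.indep s t h hst) hZ.comap_le
  have h2 : ∫ a, (W t h a - W s h a) ∂μ = 0 := by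
    have : ∫ x, x ∂(μ.map fun a => W t h a - W s h a) = 0 := by
      rw [hW.gaussian s t h hst, integral_id_gaussianReal]
    rwa [integral_map hm.aemeasurable (by fun_prop)] at this
  rw [h1, hind.integral_fun_mul_eq_mul_integral hm.aestronglyMeasurable
    hZ2.aestronglyMeasurable, h2, zero_mul]

/-- Polarisation: by linearity in the direction, the variances determine the covariances. -/
theorem inner_toLp_self (hW : IsWienerProcess R ℱ μ W) (hR : R.IsPositive) (t : ℝ≥0) (h g : H) :
    ⟪hW.toLp t h, hW.toLp t g⟫_ℝ = t * ⟪h, R g⟫_ℝ := by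
  have hn : ∀ x, ‖hW.toLp t x‖ ^ 2 = t * ⟪x, R x⟫_ℝ := fun x => by
    simpa [hW.toLp_zero] using hW.norm_toLp_sub_sq hR (zero_le (a := t)) x
  have h1 := norm_add_sq_real (hW.toLp t h) (hW.toLp t g)
  rw [← map_add, hn, hn, hn] at h1
  simp only [map_add, inner_add_left, inner_add_right] at h1
  have h2 : ⟪g, R h⟫_ℝ = ⟪h, R g⟫_ℝ := by
    rw [real_inner_comm, hR.inner_left_eq_inner_right]
  rw [h2] at h1
  linarith

theorem inner_toLp (hW : IsWienerProcess R ℱ μ W) (hR : R.IsPositive) (s t : ℝ≥0) (h g : H) :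
    ⟪hW.toLp s h, hW.toLp t g⟫_ℝ = min s t * ⟪h, R g⟫_ℝ := by
  have key : ∀ {s t : ℝ≥0} (_ : s ≤ t) (h g : H),
      ⟪hW.toLp s h, hW.toLp t g⟫_ℝ = s * ⟪h, R g⟫_ℝ := fun {s t} hst h g => by
    have h1 := hW.inner_toLp_increment hst g (hW.adapted s h) (hW.memLp s h)
    rw [inner_sub_right, sub_eq_zero] at h1
    exact h1.trans (hW.inner_toLp_self hR s h g)
  rcases le_total s t with hst | hst
  · rw [min_eq_left hst, key hst]
  · rw [min_eq_right hst, real_inner_comm, key hst, real_inner_comm, hR.inner_left_eq_inner_right]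

/-- A factor `B` of `R`: a bounded operator into a Hilbert space with `⟪B h, B g⟫ = ⟪h, R g⟫`. -/
def root (hW : IsWienerProcess R ℱ μ W) (hR : R.IsPositive) : H →L[ℝ] Lp ℝ 2 μ :=
  -- The process at time `1` is itself a factor, since `⟪W₁ h, W₁ g⟫ = ⟪h, R g⟫` in `L²(μ)`; this
  -- replaces the square root of `R`.
  (hW.toLp 1).mkContinuous (√‖R‖) fun h => by
    have h1 : ‖hW.toLp 1 h‖ ^ 2 = ⟪h, R h⟫_ℝ := by
      rw [← real_inner_self_eq_norm_sq, hW.inner_toLp_self hR, NNReal.coe_one, one_mul]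
    refine le_of_sq_le_sq ?_ (by positivity)
    rw [h1, mul_pow, Real.sq_sqrt (norm_nonneg _)]
    calc ⟪h, R h⟫_ℝ ≤ ‖h‖ * ‖R h‖ := real_inner_le_norm _ _
      _ ≤ ‖h‖ * (‖R‖ * ‖h‖) := by gcongr; exact R.le_opNorm h
      _ = ‖R‖ * ‖h‖ ^ 2 := by ring

theorem inner_root (hW : IsWienerProcess R ℱ μ W) (hR : R.IsPositive) (h g : H) :
    ⟪hW.root hR h, hW.root hR g⟫_ℝ = ⟪h, R g⟫_ℝ := by
  have := hW.inner_toLp_self hR 1 h g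
  rwa [NNReal.coe_one, one_mul] at this

/-- The step function `1_(0, p] B v` in `L²(ℝ)`. -/
def stepLp (hW : IsWienerProcess R ℱ μ W) (hR : R.IsPositive) (p : ℝ≥0) :
    H →ₗ[ℝ] Lp (Lp ℝ 2 μ) 2 (volume : Measure ℝ) where
  toFun v := indicatorConstLp 2 (measurableSet_Ioc (a := (0 : ℝ)) (b := p))
    measure_Ioc_lt_top.ne (hW.root hR v)
  map_add' v w := by rw [map_add, indicatorConstLp_add]
  map_smul' c v := by
    refine Lp.ext ?_
    filter_upwards [indicatorConstLp_coeFn (p := 2) (hs := measurableSet_Ioc (a := (0 : ℝ)) (b := p))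
      (hμs := measure_Ioc_lt_top.ne) (c := hW.root hR (c • v)) (μ := volume),
      Lp.coeFn_smul c (indicatorConstLp 2 (measurableSet_Ioc (a := (0 : ℝ)) (b := p))
        measure_Ioc_lt_top.ne (hW.root hR v) (μ := volume)),
      indicatorConstLp_coeFn (p := 2) (hs := measurableSet_Ioc (a := (0 : ℝ)) (b := p))
      (hμs := measure_Ioc_lt_top.ne) (c := hW.root hR v) (μ := volume)] with x h1 h2 h3
    rw [h1, RingHom.id_apply, h2, Pi.smul_apply, h3, map_smul]
    exact Set.indicator_const_smul_apply _ c (fun _ => hW.root hR v) x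

theorem inner_stepLp (hW : IsWienerProcess R ℱ μ W) (hR : R.IsPositive) (s t : ℝ≥0) (h g : H) :
    ⟪hW.stepLp hR s h, hW.stepLp hR t g⟫_ℝ = min s t * ⟪h, R g⟫_ℝ := by
  have : ⟪hW.stepLp hR s h, hW.stepLp hR t g⟫_ℝ
      = volume.real (Set.Ioc (0 : ℝ) s ∩ Set.Ioc (0 : ℝ) t) • ⟪hW.root hR h, hW.root hR g⟫_ℝ :=
    L2.inner_indicatorConstLp_indicatorConstLp (𝕜 := ℝ) measurableSet_Ioc measurableSet_Ioc
      measure_Ioc_lt_top.ne measure_Ioc_lt_top.ne _ _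
  rw [this, hW.inner_root, Set.Ioc_inter_Ioc, max_self, Real.volume_real_Ioc_of_le (by simp),
    smul_eq_mul, sub_zero, NNReal.coe_min]

/-- Finite combinations of the pairs `(1_(0, p] B v, W_p v)`. -/
def pair (hW : IsWienerProcess R ℱ μ W) (hR : R.IsPositive) :
    (ℝ≥0 →₀ H) →ₗ[ℝ] Lp (Lp ℝ 2 μ) 2 (volume : Measure ℝ) × Lp ℝ 2 μ :=
  Finsupp.lsum ℝ fun p => (hW.stepLp hR p).prod (hW.toLp p)

/-- The graph of the Wiener integral on `[0, t]`: the closure of its graph on step functions. -/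
def graph (hW : IsWienerProcess R ℱ μ W) (hR : R.IsPositive) (t : ℝ≥0) :
    Submodule ℝ (Lp (Lp ℝ 2 μ) 2 (volume : Measure ℝ) × Lp ℝ 2 μ) :=
  ((Finsupp.supported H ℝ (Set.Iic t)).map (hW.pair hR)).topologicalClosure

theorem pair_single (hW : IsWienerProcess R ℱ μ W) (hR : R.IsPositive) (p : ℝ≥0) (v : H) :
    hW.pair hR (Finsupp.single p v) = (hW.stepLp hR p v, hW.toLp p v) := by
  simp [pair]

theorem graph_mono (hW : IsWienerProcess R ℱ μ W) (hR : R.IsPositive) {s t : ℝ≥0} (hst : s ≤ t) :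
    hW.graph hR s ≤ hW.graph hR t :=
  Submodule.topologicalClosure_mono
    (Submodule.map_mono (Finsupp.supported_mono (Set.Iic_subset_Iic.2 hst)))

/-- A closed property of linear type holds on the graph if it holds for single steps. -/
theorem graph_le (hW : IsWienerProcess R ℱ μ W) (hR : R.IsPositive) {t : ℝ≥0}
    {S : Submodule ℝ (Lp (Lp ℝ 2 μ) 2 (volume : Measure ℝ) × Lp ℝ 2 μ)}
    (hS : IsClosed (S : Set (Lp (Lp ℝ 2 μ) 2 (volume : Measure ℝ) × Lp ℝ 2 μ)))
    (h : ∀ p ≤ t, ∀ v, (hW.stepLp hR p v, hW.toLp p v) ∈ S) : hW.graph hR t ≤ S := by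
  refine Submodule.topologicalClosure_minimal _ ?_ hS
  rintro _ ⟨f, hf, rfl⟩
  rw [SetLike.mem_coe, Finsupp.mem_supported] at hf
  induction f using Finsupp.induction_linear with
  | zero => simp
  | add f g _ _ =>
    rw [← Finsupp.sum_single (f + g), Finsupp.sum, map_sum]
    exact Submodule.sum_mem _ fun p hp => by rw [pair_single]; exact h p (hf hp) _
  | single p v =>
    rw [← Finsupp.sum_single (Finsupp.single p v), Finsupp.sum, map_sum]
    exact Submodule.sum_mem _ fun p hp => by rw [pair_single]; exact h p (hf hp) _

/-- The Wiener isometry. -/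
theorem inner_of_mem_graph (hW : IsWienerProcess R ℱ μ W) (hR : R.IsPositive) {s t : ℝ≥0}
    {z z' : Lp (Lp ℝ 2 μ) 2 (volume : Measure ℝ) × Lp ℝ 2 μ} (hz : z ∈ hW.graph hR s)
    (hz' : z' ∈ hW.graph hR t) : ⟪z.1, z'.1⟫_ℝ = ⟪z.2, z'.2⟫_ℝ := by
  -- For fixed `y`, the `x` whose two inner products with `y` agree form a closed subspace, so
  -- `graph_le` can be applied in one variable and then in the other.
  let D : (y : Lp (Lp ℝ 2 μ) 2 (volume : Measure ℝ) × Lp ℝ 2 μ) →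
      Submodule ℝ (Lp (Lp ℝ 2 μ) 2 (volume : Measure ℝ) × Lp ℝ 2 μ) := fun y =>
    LinearMap.ker (((innerSL ℝ y.1).comp (ContinuousLinearMap.fst ℝ _ _)
      - (innerSL ℝ y.2).comp (ContinuousLinearMap.snd ℝ _ _) :
      Lp (Lp ℝ 2 μ) 2 (volume : Measure ℝ) × Lp ℝ 2 μ →L[ℝ] ℝ) : _ →ₗ[ℝ] ℝ)
  have hD : ∀ y x, x ∈ D y ↔ ⟪y.1, x.1⟫_ℝ = ⟪y.2, x.2⟫_ℝ := fun y x => by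
    simp [D, sub_eq_zero]
  have hDc : ∀ y, IsClosed (D y : Set (Lp (Lp ℝ 2 μ) 2 (volume : Measure ℝ) × Lp ℝ 2 μ)) :=
    fun y => ContinuousLinearMap.isClosed_ker _
  rw [← hD]
  refine hW.graph_le hR (hDc z) (fun p _ v => ?_) hz'
  rw [hD, real_inner_comm, real_inner_comm _ z.2]
  exact (hD (hW.stepLp hR p v, hW.toLp p v) z).1 (hW.graph_le hR (hDc _) (fun q _ w => by
    rw [hD]
    exact (hW.inner_stepLp hR p q v w).trans (hW.inner_toLp hR p q v w).symm) hz)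

end IsWienerProcess

end WienerIsometry

/-! ### Gaussianity of Wiener integrals and independence of `ℱ 0`. -/

section WienerGaussian

variable {H : Type*} [NormedAddCommGroup H] [InnerProductSpace ℝ H]
  {Ω : Type*} {mΩ : MeasurableSpace Ω} {μ : Measure Ω}
  {ℱ : Filtration ℝ≥0 mΩ} {R : H →L[ℝ] H} {W : ℝ≥0 → H → Ω → ℝ}

/-- The map is 1-Lipschitz: `|exp (iy) - exp (iz)| ≤ |y - z|`, and under a probability measure the
`L¹` norm is at most the `L²` norm. -/
theorem continuous_setIntegral_cexp [IsProbabilityMeasure μ] (F : Set Ω) :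
    Continuous fun y : Lp ℝ 2 μ => ∫ ω in F, Complex.exp ((y ω : ℝ) * Complex.I) ∂μ := by
  have hint : ∀ y : Lp ℝ 2 μ, Integrable (fun ω => Complex.exp ((y ω : ℝ) * Complex.I)) μ := by
    intro y
    refine Integrable.of_bound (C := 1) ?_ (ae_of_all _ fun ω => ?_)
    · have h1 := Lp.aestronglyMeasurable y
      exact Complex.continuous_exp.comp_aestronglyMeasurable
        ((Complex.continuous_ofReal.comp_aestronglyMeasurable h1).mul_const _)
    · rw [Complex.norm_exp_ofReal_mul_I]
  have hC : LipschitzWith 1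
      fun y : Lp ℝ 2 μ => ∫ ω in F, Complex.exp ((y ω : ℝ) * Complex.I) ∂μ := by
    intro y z
    rw [edist_eq_enorm_sub, edist_eq_enorm_sub, ENNReal.coe_one, one_mul,
      ← integral_sub (hint y).integrableOn (hint z).integrableOn, Lp.enorm_def]
    refine (enorm_integral_le_lintegral_enorm _).trans ((setLIntegral_le_lintegral F _).trans ?_)
    have h1 : eLpNorm (⇑(y - z)) 1 μ ≤ eLpNorm (⇑(y - z)) 2 μ :=
      eLpNorm_le_eLpNorm_of_exponent_le (by norm_num) (Lp.aestronglyMeasurable _)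
    refine le_trans ?_ h1
    rw [eLpNorm_one_eq_lintegral_enorm]
    refine lintegral_mono_ae ?_
    filter_upwards [Lp.coeFn_sub y z] with ω hω
    rw [hω, Pi.sub_apply]
    have h2 : Complex.exp ((y ω : ℝ) * Complex.I) - Complex.exp ((z ω : ℝ) * Complex.I)
        = Complex.exp ((z ω : ℝ) * Complex.I)
          * (Complex.exp (Complex.I * ((y ω - z ω : ℝ) : ℂ)) - 1) := by
      rw [mul_sub, ← Complex.exp_add, mul_one]
      congr 2
      push_cast
      ring
    rw [← ofReal_norm, ← ofReal_norm, h2, norm_mul, Complex.norm_exp_ofReal_mul_I,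
      one_mul]
    exact ENNReal.ofReal_le_ofReal (Real.norm_exp_I_mul_ofReal_sub_one_le)
  exact hC.continuous

namespace IsWienerProcess

theorem coeFn_pair_snd (hW : IsWienerProcess R ℱ μ W) (hR : R.IsPositive) (f : ℝ≥0 →₀ H) :
    (hW.pair hR f).2 =ᵐ[μ] fun ω => ∑ p ∈ f.support, W p (f p) ω := by
  have h1 : (hW.pair hR f).2 = ∑ p ∈ f.support, hW.toLp p (f p) := by
    conv_lhs => rw [← Finsupp.sum_single f, Finsupp.sum, map_sum, Prod.snd_sum]
    simp only [pair_single]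
  rw [h1]
  refine (Lp.coeFn_fun_finsetSum _ _).trans ?_
  have h2 : ∀ᵐ ω ∂μ, ∀ p ∈ f.support, hW.toLp p (f p) ω = W p (f p) ω :=
    (ae_ball_iff f.support.countable_toSet).2 fun p _ => hW.coeFn_toLp p (f p)
  filter_upwards [h2] with ω hω
  exact Finset.sum_congr rfl hω

/-- Only single increments are assumed Gaussian; joint Gaussianity is derived by induction on the
latest time `a`. Moving its coefficient to the preceding time `a'` changes the sum by one increment,
which is independent of all that precedes, including `F`, and orthogonal to it, so variances add.
Time `0` is inserted because it always provides an earlier time and `W` vanishes there. Keeping the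
event `F` encodes independence of `ℱ 0`. -/
theorem cexp_pair [IsProbabilityMeasure μ] (hW : IsWienerProcess R ℱ μ W) (hR : R.IsPositive)
    (S : Finset ℝ≥0) {F : Set Ω} (hF : MeasurableSet[ℱ 0] F) :
    ∀ f : ℝ≥0 →₀ H, f.support ⊆ insert 0 S →
      ∫ ω in F, Complex.exp (((hW.pair hR f).2 ω : ℝ) * Complex.I) ∂μ
        = Complex.exp ((-(‖(hW.pair hR f).2‖ ^ 2 / 2) : ℝ)) * μ.real F := by
  classical
  have hzero : ∀ f : ℝ≥0 →₀ H, (hW.pair hR f).2 = 0 →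
      ∫ ω in F, Complex.exp (((hW.pair hR f).2 ω : ℝ) * Complex.I) ∂μ
        = Complex.exp ((-(‖(hW.pair hR f).2‖ ^ 2 / 2) : ℝ)) * μ.real F := by
    intro f hf
    rw [hf]
    have h1 : ∫ ω in F, Complex.exp (((0 : Lp ℝ 2 μ) ω : ℝ) * Complex.I) ∂μ
        = ∫ ω in F, (1 : ℂ) ∂μ := by
      refine integral_congr_ae (ae_restrict_of_ae ?_)
      filter_upwards [Lp.coeFn_zero ℝ 2 μ] with ω hω
      rw [hω]
      simp
    rw [h1]
    simp
  induction S using Finset.induction_on_max with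
  | empty =>
    intro f hf
    have hf0 : f = Finsupp.single 0 (f 0) := by
      refine Finsupp.support_subset_singleton.1 (hf.trans (by simp))
    refine hzero f ?_
    rw [hf0, pair_single, toLp_zero]
  | insert a S ha ih =>
    intro f hf
    rcases eq_or_ne a 0 with rfl | ha0
    · exact ih f (hf.trans (by simp))
    set a' := (insert 0 S).max' (Finset.insert_nonempty 0 S) with ha'
    have ha'mem : a' ∈ insert 0 S := Finset.max'_mem _ _
    have ha'a : a' < a := by
      rcases Finset.mem_insert.1 ha'mem with h | h
      · rw [h]; exact pos_iff_ne_zero.2 ha0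
      · exact ha _ h
    set g : ℝ≥0 →₀ H := f.erase a + Finsupp.single a' (f a) with hg
    have hgs : g.support ⊆ insert 0 S := by
      refine Finsupp.support_add.trans (Finset.union_subset ?_ ?_)
      · rw [Finsupp.support_erase]
        intro x hx
        obtain ⟨hxa, hxf⟩ := Finset.mem_erase.1 hx
        have := hf hxf
        simp only [Finset.mem_insert] at this ⊢
        tauto
      · exact Finsupp.support_single_subset.trans (by simpa using ha'mem)
    have hfg : f = g + (Finsupp.single a (f a) - Finsupp.single a' (f a)) := by
      rw [hg, add_add_sub_cancel, Finsupp.erase_add_single]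
    set inc : Lp ℝ 2 μ := hW.toLp a (f a) - hW.toLp a' (f a) with hinc
    have hfgp : (hW.pair hR f).2 = (hW.pair hR g).2 + inc := by
      conv_lhs => rw [hfg, map_add, map_sub, pair_single, pair_single]
      rfl
    set Zg : Ω → ℝ := fun ω => ∑ p ∈ g.support, W p (g p) ω with hZg
    have hZgm : Measurable[ℱ a'] Zg :=
      Finset.measurable_fun_sum _ fun p hp =>
        (hW.adapted p (g p)).mono (ℱ.mono (Finset.le_max' _ _ (hgs hp))) le_rfl
    have hZgae : (hW.pair hR g).2 =ᵐ[μ] Zg := hW.coeFn_pair_snd hR g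
    have hZg2 : MemLp Zg 2 μ := (memLp_congr_ae hZgae).1 (Lp.memLp _)
    have hZgLp : hZg2.toLp Zg = (hW.pair hR g).2 := Lp.ext (hZg2.coeFn_toLp.trans hZgae.symm)
    have horth : ⟪(hW.pair hR g).2, inc⟫_ℝ = 0 := by
      rw [← hZgLp]; exact hW.inner_toLp_increment ha'a.le (f a) hZgm hZg2
    have hnorm : ‖(hW.pair hR f).2‖ ^ 2
        = ‖(hW.pair hR g).2‖ ^ 2 + (a - a') * ⟪f a, R (f a)⟫_ℝ := by
      rw [hfgp, norm_add_sq_real, horth, hinc, hW.norm_toLp_sub_sq hR ha'a.le]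
      ring
    -- the increment is independent of everything before `a'`
    set X : Ω → ℝ := fun ω => W a (f a) ω - W a' (f a) ω with hX
    have hXm : Measurable X := (hW.measurable _ _).sub (hW.measurable _ _)
    set Φ : Ω → ℂ := F.indicator fun ω => Complex.exp ((Zg ω : ℝ) * Complex.I) with hΦ
    have hΦm : Measurable[ℱ a'] Φ := by
      refine Measurable.indicator ?_ (ℱ.mono zero_le _ hF)
      exact Complex.measurable_exp.comp
        ((Complex.measurable_ofReal.comp hZgm).mul_const _)
    have hind : IndepFun (fun ω => Complex.exp ((X ω : ℝ) * Complex.I)) Φ μ := by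
      have h1 : IndepFun X Φ μ :=
        indep_of_indep_of_le_right (hW.indep a' a (f a) ha'a.le) hΦm.comap_le
      exact h1.comp (φ := fun x : ℝ => Complex.exp ((x : ℝ) * Complex.I)) (ψ := id)
        (by fun_prop) measurable_id
    have hF' : MeasurableSet F := ℱ.le 0 _ hF
    have hchar : ∫ ω, Complex.exp ((X ω : ℝ) * Complex.I) ∂μ
        = Complex.exp ((-((a - a') * ⟪f a, R (f a)⟫_ℝ / 2) : ℝ)) := by
      have h1 : ∫ ω, Complex.exp ((X ω : ℝ) * Complex.I) ∂μ = charFun (μ.map X) 1 := by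
        rw [charFun_map_apply hXm]
        simp
      rw [h1, hW.gaussian a' a (f a) ha'a.le, charFun_gaussianReal]
      congr 1
      simp only [NNReal.coe_mul, NNReal.coe_sub ha'a.le,
        Real.coe_toNNReal _ (hR.inner_nonneg_right (f a))]
      push_cast
      ring
    have hprod : ∫ ω in F, Complex.exp (((hW.pair hR f).2 ω : ℝ) * Complex.I) ∂μ
        = ∫ ω, Complex.exp ((X ω : ℝ) * Complex.I) * Φ ω ∂μ := by
      rw [← integral_indicator hF']
      refine integral_congr_ae ?_
      filter_upwards [hZgae, Lp.coeFn_add (hW.pair hR g).2 inc,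
        Lp.coeFn_sub (hW.toLp a (f a)) (hW.toLp a' (f a)), hW.coeFn_toLp a (f a),
        hW.coeFn_toLp a' (f a)] with ω h1 h2 h3 h4 h5
      by_cases hω : ω ∈ F
      · rw [hΦ, Set.indicator_of_mem hω, Set.indicator_of_mem hω, ← Complex.exp_add, hfgp, h2,
          Pi.add_apply, h1, hinc, h3, Pi.sub_apply, h4, h5, hX]
        congr 1
        push_cast
        ring
      · rw [hΦ, Set.indicator_of_notMem hω, Set.indicator_of_notMem hω, mul_zero]
    have hΦint : ∫ ω, Φ ω ∂μ = Complex.exp ((-(‖(hW.pair hR g).2‖ ^ 2 / 2) : ℝ)) * μ.real F := by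
      rw [← ih g hgs, hΦ, integral_indicator hF']
      refine integral_congr_ae (ae_restrict_of_ae ?_)
      filter_upwards [hZgae] with ω h1
      rw [h1]
    rw [hprod, hind.integral_fun_mul_eq_mul_integral (by fun_prop)
      (hΦm.mono (ℱ.le _) le_rfl).aestronglyMeasurable, hchar, hΦint, hnorm, ← mul_assoc,
      ← Complex.exp_add, ← Complex.ofReal_add]
    congr 4
    ring

/-- Wiener integrals are centred Gaussian and independent of the initial `σ`-algebra. -/
theorem cexp_of_mem_graph [IsProbabilityMeasure μ] (hW : IsWienerProcess R ℱ μ W)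
    (hR : R.IsPositive) {t : ℝ≥0} {z : Lp (Lp ℝ 2 μ) 2 (volume : Measure ℝ) × Lp ℝ 2 μ}
    (hz : z ∈ hW.graph hR t) {F : Set Ω} (hF : MeasurableSet[ℱ 0] F) :
    ∫ ω in F, Complex.exp ((z.2 ω : ℝ) * Complex.I) ∂μ
      = Complex.exp ((-(‖z.2‖ ^ 2 / 2) : ℝ)) * μ.real F := by
  have hclosed : IsClosed {z : Lp (Lp ℝ 2 μ) 2 (volume : Measure ℝ) × Lp ℝ 2 μ |
      ∫ ω in F, Complex.exp ((z.2 ω : ℝ) * Complex.I) ∂μ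
        = Complex.exp ((-(‖z.2‖ ^ 2 / 2) : ℝ)) * μ.real F} := by
    refine isClosed_eq ((continuous_setIntegral_cexp F).comp continuous_snd) ?_
    fun_prop
  refine closure_minimal ?_ hclosed hz
  rintro _ ⟨f, -, rfl⟩
  exact hW.cexp_pair hR f.support hF f (Finset.subset_insert _ _)

end IsWienerProcess

end WienerGaussian

/-! ### Wiener integrals as elements of the closed graph. -/

section WienerIntegral

/-- The sets over which the integral vanishes include the half-lines `Iic p`, a π-system generating
the Borel sets, and are stable under complements and countable disjoint unions. -/
theorem ae_eq_zero_of_forall_setIntegral_Ioc {f : ℝ → ℝ} {t : ℝ}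
    (hf : IntegrableOn f (Set.Ioc 0 t)) (h : ∀ p, 0 ≤ p → p ≤ t → ∫ s in Set.Ioc 0 p, f s = 0) :
    ∀ᵐ s ∂(volume.restrict (Set.Ioc 0 t)), f s = 0 := by
  rcases lt_or_ge t 0 with ht | ht
  · simp [Set.Ioc_eq_empty (not_lt.2 ht.le)]
  have huniv : ∫ s, f s ∂(volume.restrict (Set.Ioc 0 t)) = 0 := h t ht le_rfl
  refine Integrable.ae_eq_zero_of_forall_setIntegral_eq_zero hf fun s hs hfin => ?_
  clear hfin
  induction s, hs using MeasurableSpace.induction_on_inter (borel_eq_generateFrom_Iic ℝ ▸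
    (BorelSpace.measurable_eq (α := ℝ))) isPiSystem_Iic with
  | empty => simp
  | basic u hu =>
    obtain ⟨p, rfl⟩ := hu
    rw [Measure.restrict_restrict measurableSet_Iic, Set.inter_comm, Set.Ioc_inter_Iic]
    rcases le_total 0 (min t p) with hp | hp
    · exact h _ hp (min_le_left _ _)
    · rw [Set.Ioc_eq_empty (not_lt.2 hp)]; simp
  | compl u hu ih => rw [setIntegral_compl hu hf, huniv, ih, sub_zero]
  | iUnion u hd hm ih =>
    rw [integral_iUnion hm hd (Integrable.integrableOn hf), tsum_congr ih, tsum_zero]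

theorem memLp_of_tendsto_eLpNorm {α E : Type*} [MeasurableSpace α] [NormedAddCommGroup E]
    {ν : Measure α} {f : ℕ → Lp E 2 ν} {k : α → E} (hk : AEStronglyMeasurable k ν)
    (hlim : Tendsto (fun n => eLpNorm (⇑(f n) - k) 2 ν) atTop (𝓝 0)) : MemLp k 2 ν := by
  obtain ⟨n, hn⟩ := (hlim.eventually (gt_mem_nhds one_pos)).exists
  have h1 : MemLp (⇑(f n) - k) 2 ν :=
    ⟨(Lp.aestronglyMeasurable _).sub hk, hn.trans ENNReal.one_lt_top⟩
  simpa using (Lp.memLp (f n)).sub h1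

variable {H : Type*} [NormedAddCommGroup H] [InnerProductSpace ℝ H]
  {Ω : Type*} {mΩ : MeasurableSpace Ω} {μ : Measure Ω}
  {ℱ : Filtration ℝ≥0 mΩ} {R : H →L[ℝ] H} {W : ℝ≥0 → H → Ω → ℝ}

/-- The function `g` on `[0, t]`, extended by zero. -/
def cut (t : ℝ≥0) (g : ℝ → H) : ℝ → H := (Set.Icc (0 : ℝ) t).indicator g

/-- A step function as a combination of the functions `1_(0, p] v`. -/
def StepFun.toFinsupp {t : ℝ≥0} (G : StepFun H t) : ℝ≥0 →₀ H :=
  ∑ i, (Finsupp.single (G.b i) (G.v i) - Finsupp.single (G.a i) (G.v i))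

theorem StepFun.toFinsupp_mem {t : ℝ≥0} (G : StepFun H t) :
    G.toFinsupp ∈ Finsupp.supported H ℝ (Set.Iic t) :=
  Submodule.sum_mem _ fun i _ => Submodule.sub_mem _
    (Finsupp.single_mem_supported ℝ _ (G.b_le i))
    (Finsupp.single_mem_supported ℝ _ ((G.a_le i).trans (G.b_le i)))

omit [InnerProductSpace ℝ H] in
theorem StepFun.cut_toFun {t : ℝ≥0} (G : StepFun H t) (s : ℝ) : cut t G.toFun s = G.toFun s := by
  rw [cut, Set.indicator_apply_eq_self]
  intro hs
  refine Finset.sum_eq_zero fun i _ => Set.indicator_of_notMem (fun h => hs ?_) _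
  exact ⟨(G.a i).2.trans h.1.le, h.2.trans (G.b_le i)⟩

namespace IsWienerProcess

theorem coeFn_stepLp (hW : IsWienerProcess R ℱ μ W) (hR : R.IsPositive) (p : ℝ≥0) (v : H) :
    hW.stepLp hR p v =ᵐ[volume] fun s => (Set.Ioc (0 : ℝ) p).indicator (fun _ => hW.root hR v) s :=
  indicatorConstLp_coeFn (hs := measurableSet_Ioc) (hμs := measure_Ioc_lt_top.ne)

/-- This is `1_(a, b] = 1_(0, b] - 1_(0, a]` for `0 ≤ a ≤ b`. -/
theorem coeFn_pair_stepFun (hW : IsWienerProcess R ℱ μ W) (hR : R.IsPositive) {t : ℝ≥0}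
    (G : StepFun H t) : (hW.pair hR G.toFinsupp).1 =ᵐ[volume] fun s => hW.root hR (G.toFun s) := by
  have h1 : (hW.pair hR G.toFinsupp).1
      = ∑ i, (hW.stepLp hR (G.b i) (G.v i) - hW.stepLp hR (G.a i) (G.v i)) := by
    rw [StepFun.toFinsupp, map_sum, Prod.fst_sum]
    simp only [map_sub, pair_single, Prod.fst_sub]
  rw [h1]
  refine (Lp.coeFn_fun_finsetSum _ _).trans ?_
  have h2 := ae_all_iff.2 fun i => Lp.coeFn_sub (hW.stepLp hR (G.b i) (G.v i))
    (hW.stepLp hR (G.a i) (G.v i))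
  have h3 := ae_all_iff.2 fun i => hW.coeFn_stepLp hR (G.b i) (G.v i)
  have h4 := ae_all_iff.2 fun i => hW.coeFn_stepLp hR (G.a i) (G.v i)
  filter_upwards [h2, h3, h4] with s h2 h3 h4
  rw [StepFun.toFun, map_sum]
  refine Finset.sum_congr rfl fun i _ => ?_
  rw [h2, Pi.sub_apply, h3, h4]
  have hab : (G.a i : ℝ) ≤ G.b i := G.a_le i
  have ha : (0 : ℝ) ≤ G.a i := (G.a i).2
  simp only [Set.indicator_apply, Set.mem_Ioc]
  by_cases hs1 : 0 < s <;> by_cases hs2 : s ≤ G.b i <;> by_cases hs3 : s ≤ G.a i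
  all_goals first
    | (exfalso; linarith)
    | simp [hs1, hs2, hs3, not_lt.2, lt_of_not_ge]

theorem coeFn_pair_stepFun_integral (hW : IsWienerProcess R ℱ μ W) (hR : R.IsPositive) {t : ℝ≥0}
    (G : StepFun H t) : (hW.pair hR G.toFinsupp).2 =ᵐ[μ] G.integral W := by
  have h1 : (hW.pair hR G.toFinsupp).2
      = ∑ i, (hW.toLp (G.b i) (G.v i) - hW.toLp (G.a i) (G.v i)) := by
    rw [StepFun.toFinsupp, map_sum, Prod.snd_sum]
    simp only [map_sub, pair_single, Prod.snd_sub]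
  rw [h1]
  refine (Lp.coeFn_fun_finsetSum _ _).trans ?_
  have h2 := ae_all_iff.2 fun i => Lp.coeFn_sub (hW.toLp (G.b i) (G.v i))
    (hW.toLp (G.a i) (G.v i))
  have h3 := ae_all_iff.2 fun i => hW.coeFn_toLp (G.b i) (G.v i)
  have h4 := ae_all_iff.2 fun i => hW.coeFn_toLp (G.a i) (G.v i)
  filter_upwards [h2, h3, h4] with ω h2 h3 h4
  refine Finset.sum_congr rfl fun i _ => ?_
  rw [h2, Pi.sub_apply, h3, h4]

/-- Identifies the seminorm in the definition of `IsWienerIntegral` with an honest `L²` norm after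
applying the factor of `R`. -/
theorem lintegral_eq_eLpNorm_sq (hW : IsWienerProcess R ℱ μ W) (hR : R.IsPositive) (t : ℝ≥0)
    (g : ℝ → H) : ∫⁻ s in Set.Icc (0 : ℝ) t, ENNReal.ofReal ⟪g s, R (g s)⟫_ℝ
      = eLpNorm (fun s => hW.root hR (cut t g s)) 2 volume ^ (2 : ℝ) := by
  have h1 := eLpNorm_nnreal_pow_eq_lintegral (f := fun s => hW.root hR (cut t g s))
    (μ := volume) (p := 2) two_ne_zero
  rw [NNReal.coe_ofNat, ENNReal.coe_ofNat] at h1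
  rw [h1, ← lintegral_indicator measurableSet_Icc]
  refine lintegral_congr fun s => ?_
  have h2 : ∀ x, ‖hW.root hR x‖ₑ ^ (2 : ℝ) = ENNReal.ofReal ⟪x, R x⟫_ℝ := fun x => by
    rw [← hW.inner_root hR, real_inner_self_eq_norm_sq, ← ofReal_norm,
      ENNReal.ofReal_rpow_of_nonneg (norm_nonneg _) zero_le_two, Real.rpow_ofNat]
  by_cases hs : s ∈ Set.Icc (0 : ℝ) t
  · rw [Set.indicator_of_mem hs, cut, Set.indicator_of_mem hs, h2]
  · rw [Set.indicator_of_notMem hs, cut, Set.indicator_of_notMem hs, map_zero]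
    simp

theorem aestronglyMeasurable_root_cut (hW : IsWienerProcess R ℱ μ W) (hR : R.IsPositive)
    {t : ℝ≥0} {g : ℝ → H} (hg : AEStronglyMeasurable g (volume.restrict (Set.Icc (0 : ℝ) t))) :
    AEStronglyMeasurable (fun s => hW.root hR (cut t g s)) volume :=
  (hW.root hR).continuous.comp_aestronglyMeasurable
    ((aestronglyMeasurable_indicator_iff measurableSet_Icc).2 hg)

/-- The two limits in the definition say that the pairs (step function, integral) converge in the
product space, and the graph is closed. Everything proved for the graph thereby applies to any
Wiener integral. -/
theorem mem_graph_of_isWienerIntegral (hW : IsWienerProcess R ℱ μ W) (hR : R.IsPositive)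
    {t : ℝ≥0} {g : ℝ → H} {I : Ω → ℝ} (h : IsWienerIntegral R μ W t g I) :
    ∃ (hg : MemLp (fun s => hW.root hR (cut t g s)) 2 volume) (hI : MemLp I 2 μ),
      (hg.toLp _, hI.toLp _) ∈ hW.graph hR t := by
  obtain ⟨hgm, hIm, G, hG1, hG2⟩ := h
  have hgm' := hW.aestronglyMeasurable_root_cut hR hgm
  have hx : ∀ n, (hW.pair hR (G n).toFinsupp).1 =ᵐ[volume]
      fun s => hW.root hR (cut t (G n).toFun s) := fun n => by
    simpa only [StepFun.cut_toFun] using hW.coeFn_pair_stepFun hR (G n)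
  have hy := fun n => hW.coeFn_pair_stepFun_integral hR (G n)
  have hG1' : Tendsto (fun n => eLpNorm (⇑(hW.pair hR (G n).toFinsupp).1
      - fun s => hW.root hR (cut t g s)) 2 volume) atTop (𝓝 0) := by
    have h1 := (ENNReal.continuous_rpow_const (y := (1 / 2 : ℝ))).tendsto 0 |>.comp hG1
    rw [ENNReal.zero_rpow_of_pos (by norm_num)] at h1
    refine h1.congr fun n => ?_
    rw [Function.comp_apply, hW.lintegral_eq_eLpNorm_sq hR, ← ENNReal.rpow_mul,
      mul_one_div_cancel two_ne_zero, ENNReal.rpow_one, ← eLpNorm_neg]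
    refine eLpNorm_congr_ae ?_
    filter_upwards [hx n] with s hs
    rw [Pi.neg_apply, Pi.sub_apply, hs, ← map_sub, ← map_neg]
    congr 1
    by_cases hs' : s ∈ Set.Icc (0 : ℝ) t <;> simp [cut, hs']
  have hG2' : Tendsto (fun n => eLpNorm (⇑(hW.pair hR (G n).toFinsupp).2 - I) 2 μ)
      atTop (𝓝 0) := by
    refine hG2.congr fun n => eLpNorm_congr_ae ?_
    filter_upwards [hy n] with ω hω
    rw [Pi.sub_apply, hω]
  have hg := memLp_of_tendsto_eLpNorm hgm' hG1'
  have hI := memLp_of_tendsto_eLpNorm hIm hG2'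
  refine ⟨hg, hI, ?_⟩
  refine mem_closure_of_tendsto (f := fun n => hW.pair hR (G n).toFinsupp) (b := atTop) ?_
    (Eventually.of_forall fun n => ⟨_, (G n).toFinsupp_mem, rfl⟩)
  exact (Lp.tendsto_Lp_of_tendsto_eLpNorm _ hg hG1').prodMk_nhds
    (Lp.tendsto_Lp_of_tendsto_eLpNorm _ hI hG2')

end IsWienerProcess

end WienerIntegral

/-! ### Existence of Wiener integrals. -/

section WienerExistence

variable {H : Type*} [NormedAddCommGroup H] [InnerProductSpace ℝ H]
  {Ω : Type*} {mΩ : MeasurableSpace Ω} {μ : Measure Ω}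
  {ℱ : Filtration ℝ≥0 mΩ} {R : H →L[ℝ] H} {W : ℝ≥0 → H → Ω → ℝ}

/-- The step function with the same values as a combination of the functions `1_(0, p] v`. -/
def StepFun.ofFinsupp {t : ℝ≥0} (f : ℝ≥0 →₀ H) (hf : f ∈ Finsupp.supported H ℝ (Set.Iic t)) :
    StepFun H t where
  n := f.support.card
  a _ := 0
  b i := f.support.equivFin.symm i
  v i := f (f.support.equivFin.symm i)
  a_le _ := zero_le
  b_le i := (Finsupp.mem_supported _ _).1 hf (f.support.equivFin.symm i).2

theorem StepFun.sum_ofFinsupp {t : ℝ≥0} {f : ℝ≥0 →₀ H}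
    (hf : f ∈ Finsupp.supported H ℝ (Set.Iic t)) {M : Type*} [AddCommMonoid M]
    (φ : ℝ≥0 → H → M) :
    ∑ i, φ ((StepFun.ofFinsupp f hf).b i) ((StepFun.ofFinsupp f hf).v i)
      = ∑ p ∈ f.support, φ p (f p) := by
  rw [← Finset.sum_coe_sort f.support fun p => φ p (f p)]
  exact f.support.equivFin.symm.sum_comp fun p : f.support => φ p (f p)

namespace IsWienerProcess

theorem coeFn_pair_ofFinsupp (hW : IsWienerProcess R ℱ μ W) (hR : R.IsPositive) {t : ℝ≥0}
    (f : ℝ≥0 →₀ H) (hf : f ∈ Finsupp.supported H ℝ (Set.Iic t)) :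
    (hW.pair hR f).1 =ᵐ[volume] fun s => hW.root hR ((StepFun.ofFinsupp f hf).toFun s) := by
  have h1 : (hW.pair hR (StepFun.ofFinsupp f hf).toFinsupp).1 = (hW.pair hR f).1 := by
    rw [StepFun.toFinsupp, map_sum, Prod.fst_sum]
    conv_rhs => rw [← Finsupp.sum_single f, Finsupp.sum, map_sum, Prod.fst_sum]
    rw [← StepFun.sum_ofFinsupp hf fun p v => (hW.pair hR (Finsupp.single p v)).1]
    refine Finset.sum_congr rfl fun i _ => ?_
    rw [map_sub, Prod.fst_sub, sub_eq_self]
    change (hW.pair hR (Finsupp.single 0 _)).1 = 0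
    rw [pair_single]
    refine Lp.ext ?_
    filter_upwards [hW.coeFn_stepLp hR 0 ((StepFun.ofFinsupp f hf).v i),
      Lp.coeFn_zero (Lp ℝ 2 μ) 2 volume] with s h1 h2
    rw [h1, h2]
    simp
  rw [← h1]
  exact hW.coeFn_pair_stepFun hR _

theorem coeFn_pair_ofFinsupp_integral (hW : IsWienerProcess R ℱ μ W) (hR : R.IsPositive)
    {t : ℝ≥0} (f : ℝ≥0 →₀ H) (hf : f ∈ Finsupp.supported H ℝ (Set.Iic t)) :
    (hW.pair hR f).2 =ᵐ[μ] (StepFun.ofFinsupp f hf).integral W := by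
  have h1 : (hW.pair hR (StepFun.ofFinsupp f hf).toFinsupp).2 = (hW.pair hR f).2 := by
    rw [StepFun.toFinsupp, map_sum, Prod.snd_sum]
    conv_rhs => rw [← Finsupp.sum_single f, Finsupp.sum, map_sum, Prod.snd_sum]
    rw [← StepFun.sum_ofFinsupp hf fun p v => (hW.pair hR (Finsupp.single p v)).2]
    refine Finset.sum_congr rfl fun i _ => ?_
    rw [map_sub, Prod.snd_sub, sub_eq_self]
    change (hW.pair hR (Finsupp.single 0 _)).2 = 0
    rw [pair_single, toLp_zero]
  rw [← h1]
  exact hW.coeFn_pair_stepFun_integral hR _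

/-- Converse of `mem_graph_of_isWienerIntegral`: a sequence of generators converging to the pair
supplies the step functions. -/
theorem isWienerIntegral_of_mem_graph (hW : IsWienerProcess R ℱ μ W) (hR : R.IsPositive)
    {t : ℝ≥0} {g : ℝ → H} {I : Ω → ℝ}
    (hgm : AEStronglyMeasurable g (volume.restrict (Set.Icc (0 : ℝ) t)))
    (hg : MemLp (fun s => hW.root hR (cut t g s)) 2 volume) (hI : MemLp I 2 μ)
    (h : (hg.toLp _, hI.toLp _) ∈ hW.graph hR t) : IsWienerIntegral R μ W t g I := by
  obtain ⟨z, hz, hlim⟩ := mem_closure_iff_seq_limit.1 h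
  choose f hf hfz using hz
  refine ⟨hgm, hI.aestronglyMeasurable, fun n => StepFun.ofFinsupp (f n) (hf n), ?_, ?_⟩
  · have h1 := (Lp.tendsto_Lp_iff_tendsto_eLpNorm _ _ hg).1
      ((continuous_fst.tendsto _).comp hlim)
    have h2 := (ENNReal.continuous_rpow_const (y := (2 : ℝ))).tendsto 0 |>.comp h1
    rw [ENNReal.zero_rpow_of_pos two_pos] at h2
    refine h2.congr fun n => ?_
    rw [hW.lintegral_eq_eLpNorm_sq hR, Function.comp_apply, ← eLpNorm_neg]
    congr 1
    refine eLpNorm_congr_ae ?_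
    filter_upwards [hW.coeFn_pair_ofFinsupp hR (f n) (hf n)] with s hs
    rw [Function.comp_apply, ← hfz, Pi.neg_apply, Pi.sub_apply, hs, ← map_sub, ← map_neg,
      ← StepFun.cut_toFun]
    congr 1
    by_cases hs' : s ∈ Set.Icc (0 : ℝ) t <;> simp [cut, hs']
  · have h1 := (Lp.tendsto_Lp_iff_tendsto_eLpNorm _ _ hI).1
      ((continuous_snd.tendsto _).comp hlim)
    refine h1.congr fun n => eLpNorm_congr_ae ?_
    filter_upwards [hW.coeFn_pair_ofFinsupp_integral hR (f n) (hf n)] with ω hω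
    rw [Function.comp_apply, ← hfz, Pi.sub_apply, hω]

/-- Existence of the Wiener integral, with a version adapted to the horizon. -/
theorem exists_mem_graph [SecondCountableTopology H] (hW : IsWienerProcess R ℱ μ W)
    (hR : R.IsPositive) {t : ℝ≥0} {g : ℝ → H}
    (hg : MemLp (fun s => hW.root hR (cut t g s)) 2 volume) :
    ∃ (I : Ω → ℝ) (hI : MemLp I 2 μ), Measurable[ℱ t] I ∧
      (hg.toLp _, hI.toLp _) ∈ hW.graph hR t := by
  set V := (Finsupp.supported H ℝ (Set.Iic t)).map (hW.pair hR) with hV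
  set x := hg.toLp _ with hx
  -- Steps approximate `x` because anything orthogonal to them is orthogonal to `x`. If `z` is
  -- orthogonal to all `1_(0, p] B v` with `p ≤ t`, then `⟪B v, z s⟫ = 0` for almost every `s` in
  -- `(0, t]`, with a common null set for `v` in a countable dense set and hence for all `v`.
  have hxM : x ∈ (V.map (LinearMap.fst ℝ _ _)).topologicalClosure := by
    rw [← Submodule.orthogonal_orthogonal_eq_closure, Submodule.mem_orthogonal]
    intro z hz
    rw [Submodule.mem_orthogonal] at hz
    have hz' : ∀ p ≤ t, ∀ v, ∫ s in Set.Ioc (0 : ℝ) p, ⟪hW.root hR v, z s⟫_ℝ = 0 := by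
      intro p hp v
      rw [← L2.inner_indicatorConstLp_eq_setIntegral_inner (𝕜 := ℝ) z measurableSet_Ioc
        (hW.root hR v) measure_Ioc_lt_top.ne]
      refine hz (hW.stepLp hR p v) ⟨hW.pair hR (Finsupp.single p v), ⟨_, ?_, rfl⟩, ?_⟩
      · exact Finsupp.single_mem_supported ℝ _ hp
      · rw [pair_single]; rfl
    have hz0 : ∀ v, ∀ᵐ s ∂(volume.restrict (Set.Ioc (0 : ℝ) t)),
        ⟪hW.root hR v, z s⟫_ℝ = 0 := by
      intro v
      refine ae_eq_zero_of_forall_setIntegral_Ioc ?_ fun p hp0 hpt => ?_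
      · exact (integrableOn_Lp_of_measure_ne_top z fact_one_le_two_ennreal.elim
          measure_Ioc_lt_top.ne).const_inner _
      · have := hz' p.toNNReal (Real.toNNReal_le_iff_le_coe.2 hpt) v
        rwa [Real.coe_toNNReal _ hp0] at this
    have hz1 : ∀ᵐ s ∂(volume.restrict (Set.Ioc (0 : ℝ) t)), ∀ v, ⟪hW.root hR v, z s⟫_ℝ = 0 := by
      have h1 := ae_all_iff.2 fun n => hz0 (TopologicalSpace.denseSeq H n)
      filter_upwards [h1] with s hs
      have hd : Set.EqOn (fun v => ⟪hW.root hR v, z s⟫_ℝ) (fun _ => 0)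
          (Set.range (TopologicalSpace.denseSeq H)) := by
        rintro _ ⟨n, rfl⟩
        exact hs n
      exact congrFun (Continuous.ext_on (TopologicalSpace.denseRange_denseSeq H)
        (by fun_prop) continuous_const hd)
    rw [real_inner_comm, L2.inner_def]
    refine integral_eq_zero_of_ae ?_
    rw [ae_restrict_iff' measurableSet_Ioc] at hz1
    filter_upwards [hg.coeFn_toLp, hz1, Measure.ae_ne volume 0] with s h1 h2 h3
    rw [h1]
    by_cases hs : s ∈ Set.Ioc (0 : ℝ) t
    · exact h2 hs _
    · have : cut t g s = 0 := by
        refine Set.indicator_of_notMem (fun h => hs ⟨lt_of_le_of_ne h.1 (Ne.symm h3), h.2⟩) _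
      rw [this, map_zero, inner_zero_left, Pi.zero_apply]
  obtain ⟨u, hu, hulim⟩ := mem_closure_iff_seq_limit.1 hxM
  choose w hwV hwu using hu
  have hsub : V ≤ hW.graph hR t := Submodule.le_topologicalClosure _
  have hiso : ∀ z ∈ hW.graph hR t, ‖z.1‖ = ‖z.2‖ := fun z hz => by
    have := hW.inner_of_mem_graph hR hz hz
    rw [real_inner_self_eq_norm_sq, real_inner_self_eq_norm_sq] at this
    exact (sq_eq_sq₀ (norm_nonneg _) (norm_nonneg _)).1 this
  -- By the isometry the integrals are Cauchy as soon as the integrands are.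
  have hcau : CauchySeq fun n => (w n).2 := by
    rw [Metric.cauchySeq_iff]
    intro ε hε
    obtain ⟨N, hN⟩ := Metric.cauchySeq_iff.1 hulim.cauchySeq ε hε
    refine ⟨N, fun m hm n hn => ?_⟩
    have h1 := hN m hm n hn
    rw [dist_eq_norm, ← hwu, ← hwu] at h1
    rw [dist_eq_norm]
    exact (hiso _ (sub_mem (hsub (hwV m)) (hsub (hwV n)))).symm.trans_lt h1
  obtain ⟨y, hy⟩ := cauchySeq_tendsto_of_complete hcau
  have hxy : (x, y) ∈ hW.graph hR t := by
    refine mem_closure_of_tendsto (f := w) (b := atTop) ?_ (Eventually.of_forall fun n => hwV n)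
    have h1 : Tendsto (fun n => (w n).1) atTop (𝓝 x) := hulim.congr fun n => (hwu n).symm
    exact h1.prodMk_nhds hy
  -- Classes with an `ℱ t`-measurable representative form a closed subspace containing every `W p v`
  -- with `p ≤ t`.
  have hym : AEStronglyMeasurable[ℱ t] y μ := by
    let S : Submodule ℝ (Lp (Lp ℝ 2 μ) 2 (volume : Measure ℝ) × Lp ℝ 2 μ) :=
      (lpMeas ℝ ℝ (ℱ t) 2 μ).comap (LinearMap.snd ℝ _ _)
    have hS : ∀ z, z ∈ S ↔ AEStronglyMeasurable[ℱ t] z.2 μ := fun z =>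
      mem_lpMeas_iff_aestronglyMeasurable (𝕜 := ℝ)
    have hSc : IsClosed (S : Set (Lp (Lp ℝ 2 μ) 2 (volume : Measure ℝ) × Lp ℝ 2 μ)) :=
      (isClosed_aestronglyMeasurable (ℱ.le t)).preimage continuous_snd
    refine (hS _).1 (hW.graph_le hR hSc (fun p hp v => (hS _).2 ?_) hxy)
    exact ⟨W p v, ((hW.adapted p v).mono (ℱ.mono hp) le_rfl).stronglyMeasurable,
      hW.coeFn_toLp p v⟩
  obtain ⟨I, hIm, hIy⟩ := hym
  have hI : MemLp I 2 μ := (memLp_congr_ae hIy).1 (Lp.memLp y)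
  refine ⟨I, hI, hIm.measurable, ?_⟩
  have : hI.toLp I = y := Lp.ext (hI.coeFn_toLp.trans hIy.symm)
  rwa [this]

end IsWienerProcess

end WienerExistence

/-! ### Covariance and characteristic function of the stochastic convolution. -/

section StochasticConvolution

theorem _root_.HilbertBasis.tsum_enorm_sq {ι H : Type*} [NormedAddCommGroup H]
    [InnerProductSpace ℝ H] (e : HilbertBasis ι ℝ H) (x : H) :
    ∑' k, ENNReal.ofReal (⟪e k, x⟫_ℝ ^ 2) = ENNReal.ofReal (‖x‖ ^ 2) := by
  have h := e.hasSum_inner_mul_inner x x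
  rw [real_inner_self_eq_norm_sq] at h
  have h2 : ∀ k, ⟪x, e k⟫_ℝ * ⟪e k, x⟫_ℝ = ⟪e k, x⟫_ℝ ^ 2 := fun k => by
    rw [real_inner_comm, sq]
  simp only [h2] at h
  rw [← h.tsum_eq, ENNReal.ofReal_tsum_of_nonneg (fun k => sq_nonneg _) h.summable]

variable {H : Type*} [NormedAddCommGroup H] [InnerProductSpace ℝ H] [CompleteSpace H]
  [SecondCountableTopology H] {ι : Type*} [Countable ι]
  {Ω : Type*} {mΩ : MeasurableSpace Ω} {μ : Measure Ω}
  {ℱ : Filtration ℝ≥0 mΩ} {R : H →L[ℝ] H} {W : ℝ≥0 → H → Ω → ℝ} {U : ℝ≥0 → H →L[ℝ] H}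

omit [CompleteSpace H] [SecondCountableTopology H] in
theorem lintegral_norm_sq_eq_tsum [MeasurableSpace H] [BorelSpace H] (e : HilbertBasis ι ℝ H)
    {Z : Ω → H} (hZ : AEMeasurable Z μ) :
    ∫⁻ ω, ENNReal.ofReal (‖Z ω‖ ^ 2) ∂μ
      = ∑' k, ∫⁻ ω, ENNReal.ofReal (⟪e k, Z ω⟫_ℝ ^ 2) ∂μ := by
  simp only [← e.tsum_enorm_sq]
  refine lintegral_tsum fun k => ?_
  exact (((measurable_coord (e k)).comp_aemeasurable hZ).pow_const 2).ennreal_ofReal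

/-- The integrand of the stochastic convolution along the direction `h`. -/
def convKer (U : ℝ≥0 → H →L[ℝ] H) (t : ℝ≥0) (h : H) (s : ℝ) : H :=
  (U (t - s.toNNReal)).adjoint h

theorem IsC0Semigroup.aestronglyMeasurable_convKer (hU : IsC0Semigroup U)
    (e : HilbertBasis ι ℝ H) (t : ℝ≥0) (h : H) (ν : Measure ℝ) :
    AEStronglyMeasurable (convKer U t h) ν := by
  borelize H
  exact (hU.measurable_adjoint_apply e (f := fun s : ℝ => t - s.toNNReal) (by fun_prop)
    measurable_const).aestronglyMeasurable

namespace IsWienerProcess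

omit [CompleteSpace H] [SecondCountableTopology H] in
theorem memLp_of_isWienerIntegral (hW : IsWienerProcess R ℱ μ W) (hR : R.IsPositive)
    {t : ℝ≥0} {g : ℝ → H} {I : Ω → ℝ} (hI : IsWienerIntegral R μ W t g I) : MemLp I 2 μ :=
  (hW.mem_graph_of_isWienerIntegral hR hI).choose_spec.choose

omit [CompleteSpace H] [SecondCountableTopology H] in
/-- The covariance of two Wiener integrals. -/
theorem integral_mul_of_isWienerIntegral (hW : IsWienerProcess R ℱ μ W) (hR : R.IsPositive)
    {t t' : ℝ≥0} {g g' : ℝ → H} {I I' : Ω → ℝ} (hI : IsWienerIntegral R μ W t g I)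
    (hI' : IsWienerIntegral R μ W t' g' I') :
    ∫ ω, I ω * I' ω ∂μ = ∫ s, ⟪cut t g s, R (cut t' g' s)⟫_ℝ := by
  obtain ⟨hg, hI, hz⟩ := hW.mem_graph_of_isWienerIntegral hR hI
  obtain ⟨hg', hI', hz'⟩ := hW.mem_graph_of_isWienerIntegral hR hI'
  have h := hW.inner_of_mem_graph hR hz hz'
  rw [L2.inner_def, L2.inner_def] at h
  have h1 : ∫ a, ⟪hI.toLp I a, hI'.toLp I' a⟫_ℝ ∂μ = ∫ ω, I ω * I' ω ∂μ := by
    refine integral_congr_ae ?_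
    filter_upwards [hI.coeFn_toLp, hI'.coeFn_toLp] with ω h1 h2
    rw [h1, h2]
    simp [mul_comm]
  have h2 : ∫ s, ⟪hg.toLp _ s, hg'.toLp _ s⟫_ℝ = ∫ s, ⟪cut t g s, R (cut t' g' s)⟫_ℝ := by
    refine integral_congr_ae ?_
    filter_upwards [hg.coeFn_toLp, hg'.coeFn_toLp] with s h1 h2
    rw [h1, h2, hW.inner_root]
  rw [← h1, ← h2, h]

omit [CompleteSpace H] [SecondCountableTopology H] in
theorem integral_mul_of_isWienerIntegral_same (hW : IsWienerProcess R ℱ μ W) (hR : R.IsPositive)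
    {t : ℝ≥0} {g g' : ℝ → H} {I I' : Ω → ℝ} (hI : IsWienerIntegral R μ W t g I)
    (hI' : IsWienerIntegral R μ W t g' I') :
    ∫ ω, I ω * I' ω ∂μ = ∫ s in (0 : ℝ)..t, ⟪g s, R (g' s)⟫_ℝ := by
  rw [hW.integral_mul_of_isWienerIntegral hR hI hI', intervalIntegral.integral_of_le (NNReal.coe_nonneg t),
    ← integral_Icc_eq_integral_Ioc, ← integral_indicator measurableSet_Icc]
  congr 1
  ext s
  by_cases hs : s ∈ Set.Icc (0 : ℝ) t <;> simp [cut, hs]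

theorem memLp_root_cut_convKer (hW : IsWienerProcess R ℱ μ W) (hR : R.IsPositive)
    (hU : IsC0Semigroup U) (e : HilbertBasis ι ℝ H) (t : ℝ≥0) (h : H) :
    MemLp (fun s => hW.root hR (cut t (convKer U t h) s)) 2 volume := by
  obtain ⟨M, hM0, hM⟩ := hU.exists_norm_le t
  have h1 : (fun s => hW.root hR (cut t (convKer U t h) s))
      = (Set.Icc (0 : ℝ) t).indicator fun s => hW.root hR (convKer U t h s) := by
    ext1 s
    by_cases hs : s ∈ Set.Icc (0 : ℝ) t <;> simp [cut, hs]
  rw [h1, memLp_indicator_iff_restrict measurableSet_Icc]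
  refine MemLp.of_bound ((hW.root hR).continuous.comp_aestronglyMeasurable
    (hU.aestronglyMeasurable_convKer e t h _)) (‖hW.root hR‖ * (M * ‖h‖)) (ae_of_all _ fun s => ?_)
  refine ((hW.root hR).le_opNorm _).trans (mul_le_mul_of_nonneg_left ?_ (norm_nonneg _))
  exact ContinuousLinearMap.le_of_opNorm_le _
    (by rw [LinearIsometryEquiv.norm_map]; exact hM _ tsub_le_self) _

variable {t : ℝ≥0} {Y : Ω → H}

theorem integral_inner_mul_inner (hW : IsWienerProcess R ℱ μ W) (hR : R.IsPositive)
    (hU : IsC0Semigroup U) (e : HilbertBasis ι ℝ H)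
    (hY : IsStochIntegral R μ W t (fun s => U (t - s.toNNReal)) Y) (h g : H) :
    ∫ ω, ⟪h, Y ω⟫_ℝ * ⟪g, Y ω⟫_ℝ ∂μ = ⟪h, covOp U R t g⟫_ℝ := by
  rw [hW.integral_mul_of_isWienerIntegral_same hR (hY.2 h) (hY.2 g), hU.inner_covOp_eq e]

theorem integral_inner_sq (hW : IsWienerProcess R ℱ μ W) (hR : R.IsPositive)
    (hU : IsC0Semigroup U) (e : HilbertBasis ι ℝ H)
    (hY : IsStochIntegral R μ W t (fun s => U (t - s.toNNReal)) Y) (h : H) :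
    ∫ ω, ⟪h, Y ω⟫_ℝ ^ 2 ∂μ = ⟪h, covOp U R t h⟫_ℝ := by
  simp only [sq]
  exact hW.integral_inner_mul_inner hR hU e hY h h

theorem lintegral_inner_sq (hW : IsWienerProcess R ℱ μ W) (hR : R.IsPositive)
    (hU : IsC0Semigroup U) (e : HilbertBasis ι ℝ H)
    (hY : IsStochIntegral R μ W t (fun s => U (t - s.toNNReal)) Y) (h : H) :
    ∫⁻ ω, ENNReal.ofReal (⟪h, Y ω⟫_ℝ ^ 2) ∂μ = ENNReal.ofReal ⟪h, covOp U R t h⟫_ℝ := by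
  rw [← hW.integral_inner_sq hR hU e hY h, ofReal_integral_eq_lintegral_ofReal
    (hW.memLp_of_isWienerIntegral hR (hY.2 h)).integrable_sq (ae_of_all _ fun _ => sq_nonneg _)]

/-- The second moment of the stochastic convolution. -/
theorem lintegral_norm_sq (hW : IsWienerProcess R ℱ μ W) (hR : R.IsPositive)
    (hU : IsC0Semigroup U) (e : HilbertBasis ι ℝ H)
    (hY : IsStochIntegral R μ W t (fun s => U (t - s.toNNReal)) Y) :
    ∫⁻ ω, ENNReal.ofReal (‖Y ω‖ ^ 2) ∂μ = trace e (covOp U R t) := by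
  borelize H
  rw [lintegral_norm_sq_eq_tsum e hY.1.aemeasurable]
  exact tsum_congr fun k => hW.lintegral_inner_sq hR hU e hY (e k)

/-- Taking `F` to be everything gives the law of `Y`; letting `F` range over the events of `X₀`
gives independence. -/
theorem cexp_inner [IsProbabilityMeasure μ] (hW : IsWienerProcess R ℱ μ W) (hR : R.IsPositive)
    (hU : IsC0Semigroup U) (e : HilbertBasis ι ℝ H)
    (hY : IsStochIntegral R μ W t (fun s => U (t - s.toNNReal)) Y) (h : H) {F : Set Ω}
    (hF : MeasurableSet[ℱ 0] F) :
    ∫ ω in F, Complex.exp ((⟪Y ω, h⟫_ℝ : ℝ) * Complex.I) ∂μ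
      = Complex.exp ((-(⟪h, covOp U R t h⟫_ℝ / 2) : ℝ)) * μ.real F := by
  obtain ⟨hg, hI, hz⟩ := hW.mem_graph_of_isWienerIntegral hR (hY.2 h)
  have h1 := hW.cexp_of_mem_graph hR hz hF
  have h2 : ‖hI.toLp _‖ ^ 2 = ⟪h, covOp U R t h⟫_ℝ := by
    rw [← hW.integral_inner_sq hR hU e hY h, ← real_inner_self_eq_norm_sq, L2.inner_def]
    refine integral_congr_ae ?_
    filter_upwards [hI.coeFn_toLp] with ω hω
    rw [hω, real_inner_self_eq_norm_sq, Real.norm_eq_abs, sq_abs]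
  rw [h2] at h1
  rw [← h1]
  refine integral_congr_ae (ae_restrict_of_ae ?_)
  filter_upwards [hI.coeFn_toLp] with ω hω
  rw [hω, real_inner_comm]

/-- The map sending `h` to the integrand `U(t - ·)† h` on `[0, t]`, seen in `L²`. -/
def convLp (hW : IsWienerProcess R ℱ μ W) (hR : R.IsPositive)
    (hU : IsC0Semigroup U) (e : HilbertBasis ι ℝ H) (t : ℝ≥0) :
    H →ₗ[ℝ] Lp (Lp ℝ 2 μ) 2 (volume : Measure ℝ) where
  toFun h := (hW.memLp_root_cut_convKer hR hU e t h).toLp _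
  map_add' h g := by
    rw [← MemLp.toLp_add]
    refine MemLp.toLp_congr _ _ (ae_of_all _ fun s => ?_)
    simp only [Pi.add_apply, ← map_add]
    by_cases hs : s ∈ Set.Icc (0 : ℝ) t <;> simp [cut, hs, convKer]
  map_smul' c h := by
    rw [RingHom.id_apply, ← MemLp.toLp_const_smul]
    refine MemLp.toLp_congr _ _ (ae_of_all _ fun s => ?_)
    simp only [Pi.smul_apply, ← map_smul]
    by_cases hs : s ∈ Set.Icc (0 : ℝ) t <;> simp [cut, hs, convKer]

theorem norm_convLp_sq (hW : IsWienerProcess R ℱ μ W) (hR : R.IsPositive)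
    (hU : IsC0Semigroup U) (e : HilbertBasis ι ℝ H) (t : ℝ≥0) (h : H) :
    ‖hW.convLp hR hU e t h‖ ^ 2 = ⟪h, covOp U R t h⟫_ℝ := by
  rw [hU.inner_covOp_eq e, ← real_inner_self_eq_norm_sq, L2.inner_def,
    intervalIntegral.integral_of_le (NNReal.coe_nonneg t), ← integral_Icc_eq_integral_Ioc,
    ← integral_indicator measurableSet_Icc]
  refine integral_congr_ae ?_
  filter_upwards [(hW.memLp_root_cut_convKer hR hU e t h).coeFn_toLp] with s hs
  change ⟪(hW.memLp_root_cut_convKer hR hU e t h).toLp _ s,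
    (hW.memLp_root_cut_convKer hR hU e t h).toLp _ s⟫_ℝ = _
  rw [hs, hW.inner_root]
  by_cases hs : s ∈ Set.Icc (0 : ℝ) t <;> simp [cut, hs, convKer]

theorem continuous_convLp (hW : IsWienerProcess R ℱ μ W) (hR : R.IsPositive)
    (hU : IsC0Semigroup U) (e : HilbertBasis ι ℝ H) (t : ℝ≥0) :
    Continuous (hW.convLp hR hU e t) := by
  obtain ⟨M, hM0, hM⟩ := hU.exists_norm_le t
  refine AddMonoidHomClass.continuous_of_bound (hW.convLp hR hU e t) (√(M * (‖R‖ * M) * t))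
    fun h => ?_
  refine le_of_sq_le_sq ?_ (by positivity)
  rw [hW.norm_convLp_sq hR hU e, hU.inner_covOp e, mul_pow, Real.sq_sqrt (by positivity)]
  refine (Real.le_norm_self _).trans ((intervalIntegral.norm_integral_le_of_norm_le_const
    (C := (M * ‖h‖) * (‖R‖ * (M * ‖h‖))) fun s hs => ?_).trans (le_of_eq ?_))
  · rw [Set.uIoc_of_le (NNReal.coe_nonneg t)] at hs
    exact abs_inner_adjoint_le R hM0 hM (Real.toNNReal_le_iff_le_coe.2 hs.2) h h
  · rw [sub_zero, NNReal.abs_eq]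
    ring

end IsWienerProcess

end StochasticConvolution

/-! ### The stochastic convolution as an `H`-valued vector. -/

section Existence

variable {H : Type*} [NormedAddCommGroup H] [InnerProductSpace ℝ H] {ι : Type*} [Countable ι]
  {Ω : Type*} {mΩ : MeasurableSpace Ω} [CompleteSpace H] [SecondCountableTopology H]

/-- A random vector with prescribed coordinates, wherever these are square summable. -/
theorem exists_measurable_inner_eq [MeasurableSpace H] [BorelSpace H] (e : HilbertBasis ι ℝ H)
    {I : ι → Ω → ℝ} (hI : ∀ k, Measurable (I k)) :
    ∃ Y : Ω → H, Measurable Y ∧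
      ∀ ω, ∑' k, ENNReal.ofReal (I k ω ^ 2) ≠ ∞ → ∀ j, ⟪e j, Y ω⟫_ℝ = I j ω := by
  classical
  have hmem : ∀ ω, ∑' k, ENNReal.ofReal (I k ω ^ 2) ≠ ∞ → Memℓp (fun k => I k ω) 2 := by
    intro ω hω
    refine memℓp_gen ?_
    refine (ENNReal.summable_toReal hω).congr fun k => ?_
    rw [ENNReal.toReal_ofReal (sq_nonneg _)]
    simp
  let Y : Ω → H := fun ω => if h : ∑' k, ENNReal.ofReal (I k ω ^ 2) ≠ ∞ then
    e.repr.symm ⟨fun k => I k ω, hmem ω h⟩ else 0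
  have hY : ∀ ω j, ⟪e j, Y ω⟫_ℝ
      = if ∑' k, ENNReal.ofReal (I k ω ^ 2) ≠ ∞ then I j ω else 0 := by
    intro ω j
    by_cases h : ∑' k, ENNReal.ofReal (I k ω ^ 2) ≠ ∞
    · simp only [Y, dif_pos h, if_pos h]
      rw [← e.repr_apply_apply, LinearIsometryEquiv.apply_symm_apply]
    · simp only [Y, dif_neg h, if_neg h, inner_zero_right]
  refine ⟨Y, measurable_of_forall_coord e fun j => ?_, fun ω hω j => by rw [hY, if_pos hω]⟩
  simp only [hY]
  refine Measurable.ite ?_ (hI j) measurable_const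
  exact (Measurable.tsum fun k => ((hI k).pow_const 2).ennreal_ofReal)
    (measurableSet_singleton ∞).compl

variable {μ : Measure Ω}
  {ℱ : Filtration ℝ≥0 mΩ} {R : H →L[ℝ] H} {W : ℝ≥0 → H → Ω → ℝ} {U : ℝ≥0 → H →L[ℝ] H}

/-- The map `h ↦ ⟪h, Y⟫` into `L²`. -/
def innerLp {Y : Ω → H} (hY : MemLp Y 2 μ) : H →L[ℝ] Lp ℝ 2 μ :=
  LinearMap.mkContinuous
    { toFun := fun h => (hY.const_inner (𝕜 := ℝ) h).toLp _
      map_add' := fun h g => by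
        rw [← MemLp.toLp_add]
        exact MemLp.toLp_congr _ _ (ae_of_all _ fun ω => inner_add_left _ _ _)
      map_smul' := fun c h => by
        rw [RingHom.id_apply, ← MemLp.toLp_const_smul]
        exact MemLp.toLp_congr _ _ (ae_of_all _ fun ω => real_inner_smul_left _ _ _) }
    ‖hY.toLp Y‖ fun h => by
      rw [mul_comm]
      refine Lp.norm_le_mul_norm_of_ae_le_mul ?_
      filter_upwards [(hY.const_inner (𝕜 := ℝ) h).coeFn_toLp, hY.coeFn_toLp] with ω h1 h2
      change ‖(hY.const_inner (𝕜 := ℝ) h).toLp _ ω‖ ≤ _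
      rw [h1, h2]
      exact norm_inner_le_norm _ _

/-- The stochastic convolution exists as soon as its covariance operator has finite trace. -/
theorem IsWienerProcess.exists_isStochIntegral [MeasurableSpace H] [BorelSpace H]
    (hW : IsWienerProcess R ℱ μ W) (hR : R.IsPositive)
    (hU : IsC0Semigroup U) (e : HilbertBasis ι ℝ H) {t : ℝ≥0} (htr : trace e (covOp U R t) < ∞) :
    ∃ Y : Ω → H, Measurable[ℱ t] Y ∧
      IsStochIntegral R μ W t (fun s => U (t - s.toNNReal)) Y := by
  choose I hI hIm hIg using fun k => hW.exists_mem_graph hR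
    (hW.memLp_root_cut_convKer hR hU e t (e k))
  obtain ⟨Y, hYm, hY⟩ := exists_measurable_inner_eq (mΩ := ℱ t) e hIm
  have hYm' : Measurable Y := hYm.mono (ℱ.le t) le_rfl
  -- The variances of the coordinate integrals add up to the trace, so the coordinates are almost
  -- surely square summable.
  have hsum : ∫⁻ ω, ∑' k, ENNReal.ofReal (I k ω ^ 2) ∂μ = trace e (covOp U R t) := by
    rw [lintegral_tsum fun k => ((hI k).1.aemeasurable.pow_const 2).ennreal_ofReal]
    refine tsum_congr fun k => ?_
    have h1 : IsWienerIntegral R μ W t (convKer U t (e k)) (I k) :=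
      hW.isWienerIntegral_of_mem_graph hR (hU.aestronglyMeasurable_convKer e t _ _) _ (hI k) (hIg k)
    rw [← ofReal_integral_eq_lintegral_ofReal (hI k).integrable_sq
      (ae_of_all _ fun _ => sq_nonneg _)]
    simp only [sq]
    rw [hW.integral_mul_of_isWienerIntegral_same hR h1 h1, hU.inner_covOp_eq e]
    rfl
  have hae : ∀ᵐ ω ∂μ, ∀ j, ⟪e j, Y ω⟫_ℝ = I j ω := by
    filter_upwards [ae_lt_top' (AEMeasurable.tsum fun k =>
      ((hI k).1.aemeasurable.pow_const 2).ennreal_ofReal) (hsum.trans_lt htr).ne] with ω hω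
    exact hY ω hω.ne
  have hY2 : MemLp Y 2 μ := by
    refine ⟨hYm'.aestronglyMeasurable, ?_⟩
    rw [eLpNorm_lt_top_iff_lintegral_rpow_enorm_lt_top two_ne_zero ENNReal.ofNat_ne_top]
    refine lt_of_eq_of_lt ?_ htr
    rw [← hsum]
    refine lintegral_congr_ae ?_
    filter_upwards [hae] with ω hω
    simp only [← hω]
    rw [e.tsum_enorm_sq, ENNReal.ofReal_pow (norm_nonneg _), ofReal_norm]
    simp
  refine ⟨Y, hYm, hYm'.aestronglyMeasurable, fun h => ?_⟩
  refine hW.isWienerIntegral_of_mem_graph hR (hU.aestronglyMeasurable_convKer e t h _)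
    (hW.memLp_root_cut_convKer hR hU e t h) (hY2.const_inner h) ?_
  -- So far the inner products with `Y` are Wiener integrals only for basis vectors. The `h` for
  -- which the pair lies in the graph form a closed subspace, so containing the basis it is all of
  -- `H`.
  have hcl : IsClosed ((hW.graph hR t).comap
      ((hW.convLp hR hU e t).prod (innerLp hY2 : H →ₗ[ℝ] Lp ℝ 2 μ)) : Set H) :=
    (Submodule.isClosed_topologicalClosure _).preimage
      ((hW.continuous_convLp hR hU e t).prodMk (innerLp hY2).continuous)
  have hle := Submodule.topologicalClosure_minimal _ 
    (Submodule.span_le.2 (?_ : Set.range e ⊆ _)) hcl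
  · rw [e.dense_span] at hle
    exact hle (Submodule.mem_top (x := h))
  · rintro _ ⟨k, rfl⟩
    change ((hW.memLp_root_cut_convKer hR hU e t (e k)).toLp _,
      (hY2.const_inner (𝕜 := ℝ) (e k)).toLp _) ∈ hW.graph hR t
    rw [MemLp.toLp_congr (hY2.const_inner (𝕜 := ℝ) (e k)) (hI k) (by
      filter_upwards [hae] with ω hω using hω k)]
    exact hIg k

end Existence

/-! ### Traces and mean square continuity. -/

section Trace

variable {H : Type*} [NormedAddCommGroup H] [InnerProductSpace ℝ H] [CompleteSpace H]
  {ι : Type*}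

/-- The Hilbert-Schmidt norm of `B V†` is at most the norm of `V` times that of `B`. -/
theorem tsum_norm_sq_comp_adjoint_le {K : Type*} [NormedAddCommGroup K] [InnerProductSpace ℝ K]
    [CompleteSpace K] (e : HilbertBasis ι ℝ H) (B : H →L[ℝ] K) (V : H →L[ℝ] H) :
    ∑' k, ENNReal.ofReal (‖B (V.adjoint (e k))‖ ^ 2)
      ≤ ENNReal.ofReal (‖V‖ ^ 2) * ∑' k, ENNReal.ofReal (‖B (e k)‖ ^ 2) := by
  obtain ⟨w, f, -⟩ := exists_hilbertBasis ℝ K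
  -- `B V†` and its adjoint `V B†` have the same Hilbert-Schmidt norm, by Parseval in both spaces
  -- and an exchange of sums. In the second form the operator norm of `V` factors out.
  have key : ∀ V : H →L[ℝ] H, ∑' k, ENNReal.ofReal (‖B (V.adjoint (e k))‖ ^ 2)
      = ∑' j, ENNReal.ofReal (‖V (B.adjoint (f j))‖ ^ 2) := fun V => by
    simp only [← f.tsum_enorm_sq, ← e.tsum_enorm_sq]
    rw [ENNReal.tsum_comm]
    refine tsum_congr fun j => tsum_congr fun k => ?_
    rw [← ContinuousLinearMap.adjoint_inner_left, ← ContinuousLinearMap.adjoint_inner_left,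
      ContinuousLinearMap.adjoint_adjoint, real_inner_comm,
      ← ContinuousLinearMap.adjoint_inner_left]
  have h1 := key (ContinuousLinearMap.id ℝ H)
  simp only [ContinuousLinearMap.adjoint_id, ContinuousLinearMap.id_apply] at h1
  rw [key V, h1, ← ENNReal.tsum_mul_left]
  refine ENNReal.tsum_le_tsum fun j => ?_
  rw [← ENNReal.ofReal_mul (sq_nonneg _), ← mul_pow]
  exact ENNReal.ofReal_le_ofReal (pow_le_pow_left₀ (norm_nonneg _) (V.le_opNorm _) 2)

variable [SecondCountableTopology H] [Countable ι] {Ω : Type*} {mΩ : MeasurableSpace Ω}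
  {μ : Measure Ω} {ℱ : Filtration ℝ≥0 mΩ} {R : H →L[ℝ] H} {W : ℝ≥0 → H → Ω → ℝ}
  {U : ℝ≥0 → H →L[ℝ] H}

theorem IsC0Semigroup.trace_covOp_mono (hU : IsC0Semigroup U) (e : HilbertBasis ι ℝ H)
    (hR : R.IsPositive) {s t : ℝ≥0} (hst : s ≤ t) :
    trace e (covOp U R s) ≤ trace e (covOp U R t) :=
  ENNReal.tsum_le_tsum fun k => ENNReal.ofReal_le_ofReal (hU.inner_covOp_mono e hR hst (e k))

/-- With `B` the factor of `R` and `M` a bound of `‖U s‖` on `[0, T]`, the trace is `∫₀ᵀ ‖B U(s)†‖²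
ds` in Hilbert-Schmidt norm, at most `T M² Tr R`. -/
theorem IsWienerProcess.trace_covOp_lt_top (hW : IsWienerProcess R ℱ μ W) (hR : R.IsPositive)
    (hU : IsC0Semigroup U) (e : HilbertBasis ι ℝ H) (T : ℝ≥0) (htr : trace e R < ∞) :
    trace e (covOp U R T) < ∞ := by
  borelize H
  obtain ⟨M, hM0, hM⟩ := hU.exists_norm_le T
  have hroot : ∀ x, ENNReal.ofReal (‖hW.root hR x‖ ^ 2) = ENNReal.ofReal ⟪x, R x⟫_ℝ := fun x => by
    rw [← real_inner_self_eq_norm_sq, hW.inner_root]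
  have h1 : ∀ k, ENNReal.ofReal ⟪e k, covOp U R T (e k)⟫_ℝ = ∫⁻ s in Set.Ioc (0 : ℝ) T,
      ENNReal.ofReal ⟪(U s.toNNReal).adjoint (e k), R ((U s.toNNReal).adjoint (e k))⟫_ℝ :=
    fun k => by
      rw [hU.inner_covOp e, intervalIntegral.integral_of_le (NNReal.coe_nonneg T),
        ofReal_integral_eq_lintegral_ofReal
          (hU.intervalIntegrable_inner_adjoint e R _ _ (NNReal.coe_nonneg T)).1
          (ae_of_all _ fun s => hR.inner_nonneg_right _)]
  have hm : ∀ k, Measurable fun s : ℝ => (U s.toNNReal).adjoint (e k) := fun k =>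
    hU.measurable_adjoint_apply e measurable_real_toNNReal measurable_const
  have hm' : ∀ k, Measurable fun s : ℝ =>
      ENNReal.ofReal ⟪(U s.toNNReal).adjoint (e k), R ((U s.toNNReal).adjoint (e k))⟫_ℝ :=
    fun k => ((hm k).inner (R.continuous.measurable.comp (hm k))).ennreal_ofReal
  rw [trace, tsum_congr h1, ← lintegral_tsum fun k => (hm' k).aemeasurable]
  refine (setLIntegral_mono measurable_const (g := fun _ => ENNReal.ofReal (M ^ 2) * trace e R)
    fun s hs => ?_).trans_lt ?_
  · have h2 := tsum_norm_sq_comp_adjoint_le e (hW.root hR) (U s.toNNReal)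
    simp only [hroot] at h2
    refine h2.trans (mul_le_mul_left (ENNReal.ofReal_le_ofReal ?_) _)
    exact pow_le_pow_left₀ (norm_nonneg _) (hM _ (Real.toNNReal_le_iff_le_coe.2 hs.2)) 2
  · rw [setLIntegral_const]
    exact ENNReal.mul_lt_top (ENNReal.mul_lt_top ENNReal.ofReal_lt_top htr) measure_Ioc_lt_top

/-- Dominated convergence for series: each diagonal entry tends to zero and is dominated by the
entry at time `T`. -/
theorem IsC0Semigroup.tendsto_trace_covOp_zero (hU : IsC0Semigroup U) (e : HilbertBasis ι ℝ H)
    (hR : R.IsPositive) {T : ℝ≥0} (htr : trace e (covOp U R T) < ∞) :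
    Tendsto (fun t => trace e (covOp U R (min t T))) (𝓝 0) (𝓝 0) := by
  have hmin : Tendsto (fun t => min t T) (𝓝 0) (𝓝 0) :=
    Continuous.tendsto' (by fun_prop) _ _ (by simp)
  have h0 : ∀ k, Tendsto (fun t => ⟪e k, covOp U R (min t T) (e k)⟫_ℝ) (𝓝 0) (𝓝 0) := fun k =>
    (hU.tendsto_inner_covOp_zero e R (e k)).comp hmin
  have hbd : Summable fun k => ⟪e k, covOp U R T (e k)⟫_ℝ :=
    (ENNReal.summable_toReal htr.ne).congr fun k =>
      ENNReal.toReal_ofReal (hU.inner_covOp_nonneg e hR T _)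
  have hle : ∀ t k, ⟪e k, covOp U R (min t T) (e k)⟫_ℝ ≤ ⟪e k, covOp U R T (e k)⟫_ℝ :=
    fun t k => hU.inner_covOp_mono e hR (min_le_right _ _) _
  have h1 := tendsto_tsum_of_dominated_convergence hbd h0 (Eventually.of_forall fun t k => by
    rw [Real.norm_of_nonneg (hU.inner_covOp_nonneg e hR _ _)]
    exact hle t k)
  rw [tsum_zero] at h1
  have h2 := ENNReal.tendsto_ofReal h1
  rw [ENNReal.ofReal_zero] at h2
  refine h2.congr fun t => ?_
  rw [trace, ENNReal.ofReal_tsum_of_nonneg (fun k => hU.inner_covOp_nonneg e hR _ _)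
    (hbd.of_nonneg_of_le (fun k => hU.inner_covOp_nonneg e hR _ _) (hle t))]

omit [SecondCountableTopology H] in
theorem IsC0Semigroup.adjoint_add_apply (hU : IsC0Semigroup U) (s t : ℝ≥0) (x : H) :
    (U (s + t)).adjoint x = (U t).adjoint ((U s).adjoint x) := by
  rw [hU.map_add, ContinuousLinearMap.adjoint_comp, ContinuousLinearMap.comp_apply]

/-- Splitting the time integral at `δ` gives `S(s + δ) = S(δ) + U(δ) S(s) U(δ)†`. -/
theorem IsC0Semigroup.inner_covOp_add (hU : IsC0Semigroup U) (e : HilbertBasis ι ℝ H)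
    (R : H →L[ℝ] H) (s δ : ℝ≥0) (x : H) :
    ⟪x, covOp U R (s + δ) x⟫_ℝ
      = ⟪x, covOp U R δ x⟫_ℝ + ⟪(U δ).adjoint x, covOp U R s ((U δ).adjoint x)⟫_ℝ := by
  rw [hU.inner_covOp e, hU.inner_covOp e, hU.inner_covOp e,
    ← intervalIntegral.integral_add_adjacent_intervals (b := (δ : ℝ))
      (hU.intervalIntegrable_inner_adjoint e R _ _ (NNReal.coe_nonneg δ))
      (hU.intervalIntegrable_inner_adjoint e R _ _ (by simp))]
  congr 1
  have := intervalIntegral.integral_comp_add_right (a := 0) (b := s)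
    (fun r : ℝ => ⟪(U r.toNNReal).adjoint x, R ((U r.toNNReal).adjoint x)⟫_ℝ) δ
  rw [zero_add, ← NNReal.coe_add] at this
  rw [← this]
  refine intervalIntegral.integral_congr fun r hr => ?_
  rw [Set.uIcc_of_le (NNReal.coe_nonneg s)] at hr
  have h1 : (r + δ).toNNReal = δ + r.toNNReal := by
    rw [Real.toNNReal_add hr.1 (NNReal.coe_nonneg δ), Real.toNNReal_coe, add_comm]
  simp only [h1, hU.adjoint_add_apply]

namespace IsWienerProcess

variable {s t : ℝ≥0} {Y Z : Ω → H}

/-- The covariance of the stochastic convolution at two times. -/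
theorem integral_inner_mul_inner_add (hW : IsWienerProcess R ℱ μ W) (hR : R.IsPositive)
    (hU : IsC0Semigroup U) (e : HilbertBasis ι ℝ H) {δ : ℝ≥0}
    (hZ : IsStochIntegral R μ W (s + δ) (fun r => U (s + δ - r.toNNReal)) Z)
    (hY : IsStochIntegral R μ W s (fun r => U (s - r.toNNReal)) Y) (h g : H) :
    ∫ ω, ⟪h, Z ω⟫_ℝ * ⟪g, Y ω⟫_ℝ ∂μ = ⟪(U δ).adjoint h, covOp U R s g⟫_ℝ := by
  rw [hW.integral_mul_of_isWienerIntegral hR (hZ.2 h) (hY.2 g), hU.inner_covOp_eq e,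
    intervalIntegral.integral_of_le (NNReal.coe_nonneg s), ← integral_Icc_eq_integral_Ioc,
    ← integral_indicator measurableSet_Icc]
  congr 1
  ext r
  by_cases hr : r ∈ Set.Icc (0 : ℝ) s
  · have hr' : r ∈ Set.Icc (0 : ℝ) (s + δ : ℝ≥0) := ⟨hr.1, hr.2.trans (by simp)⟩
    have hrs : r.toNNReal ≤ s := Real.toNNReal_le_iff_le_coe.2 hr.2
    simp only [cut, Set.indicator_of_mem hr, Set.indicator_of_mem hr']
    rw [← hU.adjoint_add_apply, ← add_tsub_assoc_of_le hrs, add_comm δ s]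
  · simp [cut, hr]

/-- Heuristically, `Z - Y` is `(U δ - 1) Y` plus independent noise accumulated over a time `δ`; the
two terms are their variances. The computation itself uses only covariances. -/
theorem integral_inner_sub_sq (hW : IsWienerProcess R ℱ μ W) (hR : R.IsPositive)
    (hU : IsC0Semigroup U) (e : HilbertBasis ι ℝ H) {δ : ℝ≥0}
    (hZ : IsStochIntegral R μ W (s + δ) (fun r => U (s + δ - r.toNNReal)) Z)
    (hY : IsStochIntegral R μ W s (fun r => U (s - r.toNNReal)) Y) (h : H) :
    ∫ ω, ⟪h, Z ω - Y ω⟫_ℝ ^ 2 ∂μ = ⟪(U δ).adjoint h - h, covOp U R s ((U δ).adjoint h - h)⟫_ℝ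
      + ⟪h, covOp U R δ h⟫_ℝ := by
  have hZ2 := hW.memLp_of_isWienerIntegral hR (hZ.2 h)
  have hY2 := hW.memLp_of_isWienerIntegral hR (hY.2 h)
  have h1 : ∀ ω, ⟪h, Z ω - Y ω⟫_ℝ ^ 2
      = ⟪h, Z ω⟫_ℝ ^ 2 - 2 * (⟪h, Z ω⟫_ℝ * ⟪h, Y ω⟫_ℝ) + ⟪h, Y ω⟫_ℝ ^ 2 := fun ω => by
    rw [inner_sub_right]
    ring
  simp only [h1]
  have hZY : Integrable (fun ω => 2 * (⟪h, Z ω⟫_ℝ * ⟪h, Y ω⟫_ℝ)) μ :=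
    (hZ2.integrable_mul hY2).const_mul 2
  have hsub : Integrable (fun ω => ⟪h, Z ω⟫_ℝ ^ 2 - 2 * (⟪h, Z ω⟫_ℝ * ⟪h, Y ω⟫_ℝ)) μ :=
    hZ2.integrable_sq.sub hZY
  rw [integral_add hsub hY2.integrable_sq, integral_sub hZ2.integrable_sq hZY, integral_const_mul,
    hW.integral_inner_sq hR hU e hZ, hW.integral_inner_sq hR hU e hY,
    hW.integral_inner_mul_inner_add hR hU e hZ hY, hU.inner_covOp_add e]
  have h2 : covOp U R s ((U δ).adjoint h - h) = covOp U R s ((U δ).adjoint h) - covOp U R s h :=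
    map_sub (hU.covLin e R s) _ _
  rw [h2, inner_sub_left, inner_sub_right, inner_sub_right,
    ← hU.inner_covOp_comm e hR s h ((U δ).adjoint h), real_inner_comm (covOp U R s h)]
  ring

/-- Mean square modulus of continuity of the stochastic convolution. -/
theorem lintegral_norm_sub_sq_le (hW : IsWienerProcess R ℱ μ W) (hR : R.IsPositive)
    (hU : IsC0Semigroup U) (e : HilbertBasis ι ℝ H) {δ T : ℝ≥0} {X : Ω → H}
    (hX : IsStochIntegral R μ W T (fun r => U (T - r.toNNReal)) X)
    (hZ : IsStochIntegral R μ W (s + δ) (fun r => U (s + δ - r.toNNReal)) Z)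
    (hY : IsStochIntegral R μ W s (fun r => U (s - r.toNNReal)) Y) (hsT : s ≤ T) :
    ∫⁻ ω, ENNReal.ofReal (‖Z ω - Y ω‖ ^ 2) ∂μ
      ≤ ∫⁻ ω, ENNReal.ofReal (‖U δ (X ω) - X ω‖ ^ 2) ∂μ + trace e (covOp U R δ) := by
  borelize H
  have hm : AEMeasurable (fun ω => Z ω - Y ω) μ := (hZ.1.sub hY.1).aemeasurable
  have hm' : AEMeasurable (fun ω => U δ (X ω) - X ω) μ :=
    (((U δ).continuous.comp_aestronglyMeasurable hX.1).sub hX.1).aemeasurable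
  rw [lintegral_norm_sq_eq_tsum e hm, lintegral_norm_sq_eq_tsum e hm', trace, ← ENNReal.tsum_add]
  refine ENNReal.tsum_le_tsum fun k => ?_
  have h1 : ∀ ω, ⟪e k, U δ (X ω) - X ω⟫_ℝ = ⟪(U δ).adjoint (e k) - e k, X ω⟫_ℝ := fun ω => by
    rw [inner_sub_right, inner_sub_left, ContinuousLinearMap.adjoint_inner_left]
  simp only [h1]
  rw [hW.lintegral_inner_sq hR hU e hX, ← ENNReal.ofReal_add (hU.inner_covOp_nonneg e hR _ _)
    (hU.inner_covOp_nonneg e hR _ _), ← ofReal_integral_eq_lintegral_ofReal ?_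
    (ae_of_all _ fun _ => sq_nonneg _), hW.integral_inner_sub_sq hR hU e hZ hY]
  · refine ENNReal.ofReal_le_ofReal ?_
    gcongr
    -- Replacing time `s` by `T` in the covariance lets the single vector `X` serve all `s`, so the
    -- bound depends on `δ` alone.
    exact hU.inner_covOp_mono e hR hsT _
  · simp only [inner_sub_right]
    exact ((hW.memLp_of_isWienerIntegral hR (hZ.2 _)).sub
      (hW.memLp_of_isWienerIntegral hR (hY.2 _))).integrable_sq

end IsWienerProcess

end Trace

/-! ### A predictable version of the mild formula. -/

section PredictableVersion

/-- The last point of the grid `d ℕ` strictly before `t`, or `0`. -/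
def gridBefore (d t : ℝ≥0) : ℝ≥0 := d * (⌈t / d⌉₊ - 1 : ℕ)

theorem gridBefore_zero (d : ℝ≥0) : gridBefore d 0 = 0 := by simp [gridBefore]

theorem gridBefore_of_mem {d t : ℝ≥0} (hd : 0 < d) {k : ℕ}
    (ht : t ∈ Set.Ioc (d * k) (d * (k + 1))) : gridBefore d t = d * k := by
  have : ⌈t / d⌉₊ = k + 1 := by
    rw [Nat.ceil_eq_iff k.succ_ne_zero, Nat.succ_sub_one, lt_div_iff₀' hd, div_le_iff₀' hd]
    exact_mod_cast ht
  rw [gridBefore, this, Nat.add_sub_cancel]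

theorem exists_mem_Ioc_grid {d t : ℝ≥0} (hd : 0 < d) (ht : 0 < t) :
    ∃ k : ℕ, t ∈ Set.Ioc (d * k) (d * (k + 1)) := by
  have hpos : 0 < ⌈t / d⌉₊ := Nat.ceil_pos.2 (div_pos ht hd)
  obtain ⟨k, hk⟩ := Nat.exists_eq_succ_of_ne_zero hpos.ne'
  refine ⟨k, ?_⟩
  rw [Nat.ceil_eq_iff k.succ_ne_zero, Nat.succ_sub_one, lt_div_iff₀' hd, div_le_iff₀' hd] at hk
  exact_mod_cast hk

theorem exists_add_gridBefore {d : ℝ≥0} (hd : 0 < d) (t : ℝ≥0) :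
    ∃ δ ≤ d, t = gridBefore d t + δ := by
  rcases eq_or_lt_of_le (zero_le (a := t)) with rfl | ht
  · exact ⟨0, zero_le, by simp [gridBefore_zero]⟩
  · obtain ⟨k, hk⟩ := exists_mem_Ioc_grid hd ht
    rw [gridBefore_of_mem hd hk]
    exact ⟨t - d * k, tsub_le_iff_left.2 (hk.2.trans_eq (by ring)),
      (add_tsub_cancel_of_le hk.1.le).symm⟩

variable {H : Type*} [NormedAddCommGroup H] [MeasurableSpace H] [BorelSpace H]
  [SecondCountableTopology H] {Ω : Type*} {mΩ : MeasurableSpace Ω} {ℱ : Filtration ℝ≥0 mΩ}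

/-- On each `(a, b]` of the grid the process is frozen at its value at `a`, so preimages are
countable unions of rectangles `(a, b] × F` with `F ∈ ℱ a`, together with a piece over time `0`. -/
theorem isStronglyPredictable_gridBefore {d : ℝ≥0} (hd : 0 < d) {V : ℝ≥0 → Ω → H}
    (hV : ∀ t, Measurable[ℱ t] (V t)) :
    IsStronglyPredictable ℱ fun t ω => V (gridBefore d t) ω := by
  refine Measurable.stronglyMeasurable fun B hB => ?_
  have h1 : Function.uncurry (fun t ω => V (gridBefore d t) ω) ⁻¹' B
      = ({⊥} ×ˢ (V 0 ⁻¹' B)) ∪ ⋃ k : ℕ, Set.Ioc (d * k) (d * (k + 1)) ×ˢ (V (d * k) ⁻¹' B) := by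
    ext ⟨t, ω⟩
    simp only [Set.mem_preimage, Function.uncurry_apply_pair, Set.mem_union, Set.mem_prod,
      Set.mem_iUnion, Set.mem_singleton_iff]
    constructor
    · intro h
      rcases eq_or_lt_of_le (zero_le (a := t)) with rfl | ht
      · rw [gridBefore_zero] at h
        exact Or.inl ⟨rfl, h⟩
      · obtain ⟨k, hk⟩ := exists_mem_Ioc_grid hd ht
        rw [gridBefore_of_mem hd hk] at h
        exact Or.inr ⟨k, hk, h⟩
    · rintro (⟨rfl, h⟩ | ⟨k, hk, h⟩)
      · change V (gridBefore d 0) ω ∈ B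
        rwa [gridBefore_zero]
      · rwa [gridBefore_of_mem hd hk]
  rw [h1]
  exact (measurableSet_predictable_singleton_bot_prod (hV 0 hB)).union
    (MeasurableSet.iUnion fun k => measurableSet_predictable_Ioc_prod _ _ (hV _ hB))

variable [InnerProductSpace ℝ H] [CompleteSpace H] {ι : Type*} [Countable ι]
  {μ : Measure Ω} {R : H →L[ℝ] H} {W : ℝ≥0 → H → Ω → ℝ} {U : ℝ≥0 → H →L[ℝ] H}

omit [BorelSpace H] [SecondCountableTopology H] [MeasurableSpace H] in
theorem IsC0Semigroup.tendsto_lintegral_norm_sub_sq (hU : IsC0Semigroup U) {Y : Ω → H}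
    (hY : AEStronglyMeasurable Y μ) (hfin : ∫⁻ ω, ENNReal.ofReal (‖Y ω‖ ^ 2) ∂μ ≠ ∞) :
    Tendsto (fun δ => ∫⁻ ω, ENNReal.ofReal (‖U δ (Y ω) - Y ω‖ ^ 2) ∂μ) (𝓝 0) (𝓝 0) := by
  obtain ⟨M, hM0, hM⟩ := hU.exists_norm_le 1
  have h0 : (∫⁻ ω, ENNReal.ofReal (‖U 0 (Y ω) - Y ω‖ ^ 2) ∂μ) = 0 := by
    simp [hU.map_zero]
  rw [← h0]
  refine tendsto_lintegral_filter_of_dominated_convergence'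
    (fun ω => ENNReal.ofReal ((M + 1) ^ 2) * ENNReal.ofReal (‖Y ω‖ ^ 2)) ?_ ?_ ?_ ?_
  · exact Eventually.of_forall fun δ => ((((U δ).continuous.comp_aestronglyMeasurable hY).sub
      hY).norm.pow 2).aemeasurable.ennreal_ofReal
  · filter_upwards [eventually_le_nhds (zero_lt_one : (0 : ℝ≥0) < 1)] with δ hδ
    refine ae_of_all _ fun ω => ?_
    rw [← ENNReal.ofReal_mul (sq_nonneg _), ← mul_pow]
    refine ENNReal.ofReal_le_ofReal (pow_le_pow_left₀ (norm_nonneg _) ?_ 2)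
    refine (norm_sub_le _ _).trans ?_
    rw [add_mul, one_mul]
    gcongr
    exact (U δ).le_of_opNorm_le (hM δ hδ) _
  · rw [lintegral_const_mul' _ _ ENNReal.ofReal_ne_top]
    exact ENNReal.mul_ne_top ENNReal.ofReal_ne_top hfin
  · refine ae_of_all _ fun ω => ?_
    have hc : Continuous fun δ => ENNReal.ofReal (‖U δ (Y ω) - Y ω‖ ^ 2) :=
      ENNReal.continuous_ofReal.comp (((hU.strong_cont _).sub continuous_const).norm.pow 2)
    exact hc.tendsto 0

/-- The mild formula has a predictable version. -/
theorem IsWienerProcess.exists_isMildSolution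
    (hW : IsWienerProcess R ℱ μ W) (hR : R.IsPositive)
    (hU : IsC0Semigroup U) (e : HilbertBasis ι ℝ H) {X₀ : Ω → H} (hX₀ : Measurable[ℱ 0] X₀)
    {T : ℝ≥0} (htr : trace e (covOp U R T) < ∞) :
    ∃ X : ℝ≥0 → Ω → H, IsMildSolution R ℱ μ W U X₀ T X := by
  have hex : ∀ t, ∃ Y : Ω → H, Measurable[ℱ t] Y ∧ (t ≤ T →
      IsStochIntegral R μ W t (fun s => U (t - s.toNNReal)) Y) := fun t => by
    by_cases ht : t ≤ T
    · obtain ⟨Y, hY1, hY2⟩ := hW.exists_isStochIntegral hR hU e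
        ((hU.trace_covOp_mono e hR ht).trans_lt htr)
      exact ⟨Y, hY1, fun _ => hY2⟩
    · exact ⟨fun _ => 0, measurable_const, fun h => absurd h ht⟩
  choose Y hYm hY using hex
  have hYT := hY T le_rfl
  have hψ : Tendsto (fun δ => ∫⁻ ω, ENNReal.ofReal (‖U δ (Y T ω) - Y T ω‖ ^ 2) ∂μ
      + trace e (covOp U R (min δ T))) (𝓝 0) (𝓝 (0 + 0)) :=
    (hU.tendsto_lintegral_norm_sub_sq hYT.1
      (by rw [hW.lintegral_norm_sq hR hU e hYT]; exact htr.ne)).add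
      (hU.tendsto_trace_covOp_zero e hR htr)
  rw [add_zero] at hψ
  -- The mesh is chosen so that the mean square error is at most `2⁻ⁿ` at all times in `[0, T]`.
  -- Summability then gives almost sure convergence at each fixed time along one sequence of grids.
  have hd : ∀ n : ℕ, ∃ d : ℝ≥0, 0 < d ∧ d ≤ 1 / (n + 1) ∧ ∀ δ ≤ d,
      ∫⁻ ω, ENNReal.ofReal (‖U δ (Y T ω) - Y T ω‖ ^ 2) ∂μ
      + trace e (covOp U R (min δ T)) ≤ (2⁻¹ : ℝ≥0∞) ^ n := fun n => by
    have h1 := hψ.eventually (eventually_le_nhds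
      (ENNReal.pow_pos (ENNReal.inv_pos.2 ENNReal.ofNat_ne_top) n : (0 : ℝ≥0∞) < 2⁻¹ ^ n))
    rw [← NNReal.bot_eq_zero, nhds_bot_basis_Iic.eventually_iff] at h1
    obtain ⟨d, hd0, hd⟩ := h1
    exact ⟨min d (1 / (n + 1)), lt_min hd0 (by positivity), min_le_right _ _,
      fun δ hδ => hd (Set.mem_Iic.2 (hδ.trans (min_le_left _ _)))⟩
  choose d hd0 hd1 hdψ using hd
  let V : ℝ≥0 → Ω → H := fun t ω => U t (X₀ ω) + Y t ω
  have hV : ∀ t, Measurable[ℱ t] (V t) := fun t =>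
    (((U t).continuous.measurable).comp (hX₀.mono (ℱ.mono zero_le) le_rfl)).add (hYm t)
  -- `limUnder` preserves measurability even where the limit fails to exist, so the process is
  -- predictable on the whole product space; convergence is needed only almost surely at each fixed
  -- `t`.
  refine ⟨fun t ω => limUnder atTop fun n => V (gridBefore (d n) t) ω, ?_, fun t ht => ?_⟩
  · have hp : ∀ n, StronglyMeasurable[ℱ.predictable]
        fun p : ℝ≥0 × Ω => V (gridBefore (d n) p.1) p.2 := fun n =>
      isStronglyPredictable_gridBefore (hd0 n) hV
    let : MeasurableSpace (ℝ≥0 × Ω) := ℱ.predictable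
    exact StronglyMeasurable.limUnder (l := atTop) hp
  · refine ⟨Y t, hY t ht, ?_⟩
    choose δ hδd hδ using fun n => exists_add_gridBefore (hd0 n) t
    have hgrid : Tendsto (fun n => gridBefore (d n) t) atTop (𝓝 t) := by
      have h1 : Tendsto δ atTop (𝓝 0) := by
        refine tendsto_of_tendsto_of_tendsto_of_le_of_le tendsto_const_nhds
          (h := fun n : ℕ => (1 : ℝ≥0) / (n + 1)) ?_ (fun n => zero_le)
          fun n => (hδd n).trans (hd1 n)
        rw [← NNReal.tendsto_coe]
        simpa using tendsto_one_div_add_atTop_nhds_zero_nat (𝕜 := ℝ)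
      have h2 := (tendsto_const_nhds (x := t)).sub h1
      rw [tsub_zero] at h2
      exact h2.congr fun n => tsub_eq_of_eq_add (hδ n)
    have hm : ∀ n, AEMeasurable (fun ω => ENNReal.ofReal (‖Y t ω - Y (gridBefore (d n) t) ω‖ ^ 2)) μ :=
      fun n => ((((hYm t).mono (ℱ.le t) le_rfl).sub
        ((hYm (gridBefore (d n) t)).mono (ℱ.le _) le_rfl)).norm.pow_const
          2).ennreal_ofReal.aemeasurable
    have key : ∀ g δ, g + δ ≤ T → ∫⁻ ω, ENNReal.ofReal (‖Y (g + δ) ω - Y g ω‖ ^ 2) ∂μ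
        ≤ ∫⁻ ω, ENNReal.ofReal (‖U δ (Y T ω) - Y T ω‖ ^ 2) ∂μ + trace e (covOp U R (min δ T)) :=
      fun g δ hg => by
        rw [min_eq_left (le_add_self.trans hg)]
        have hgT := le_self_add.trans hg
        exact hW.lintegral_norm_sub_sq_le hR hU e hYT (hY _ hg) (hY _ hgT) hgT
    have hbound : ∀ n, ∫⁻ ω, ENNReal.ofReal (‖Y t ω - Y (gridBefore (d n) t) ω‖ ^ 2) ∂μ
        ≤ (2⁻¹ : ℝ≥0∞) ^ n := fun n => by
      have h1 := key (gridBefore (d n) t) (δ n) ((hδ n).symm.trans_le ht)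
      rw [← hδ n] at h1
      exact h1.trans (hdψ n _ (hδd n))
    have hsum : ∫⁻ ω, ∑' n, ENNReal.ofReal (‖Y t ω - Y (gridBefore (d n) t) ω‖ ^ 2) ∂μ ≠ ∞ := by
      rw [lintegral_tsum hm]
      refine ((ENNReal.tsum_le_tsum hbound).trans_lt ?_).ne
      rw [ENNReal.tsum_geometric_two]
      exact ENNReal.ofNat_lt_top
    filter_upwards [ae_lt_top' (AEMeasurable.tsum hm) hsum] with ω hω
    refine Tendsto.limUnder_eq ?_
    refine (((hU.strong_cont (X₀ ω)).tendsto t).comp hgrid).add ?_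
    have h1 := ENNReal.tendsto_atTop_zero_of_tsum_ne_top hω.ne
    have h2 := (ENNReal.tendsto_toReal ENNReal.zero_ne_top).comp h1
    have h3 : Tendsto (fun n => ‖Y t ω - Y (gridBefore (d n) t) ω‖ ^ 2) atTop (𝓝 0) := by
      exact h2.congr fun n => ENNReal.toReal_ofReal (sq_nonneg _)
    have h4 := h3.sqrt
    simp only [Real.sqrt_sq (norm_nonneg _), Real.sqrt_zero] at h4
    rw [tendsto_iff_norm_sub_tendsto_zero]
    exact h4.congr fun n => norm_sub_rev _ _

end PredictableVersion

/-! ### Tools for the weak equation. -/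

section WeakEquation

variable {H : Type*} [NormedAddCommGroup H] [InnerProductSpace ℝ H]
  {Ω : Type*} {mΩ : MeasurableSpace Ω} {μ : Measure Ω}
  {ℱ : Filtration ℝ≥0 mΩ} {R : H →L[ℝ] H} {W : ℝ≥0 → H → Ω → ℝ}

theorem memLp_two_of_lintegral_ne_top {α E : Type*} [MeasurableSpace α] [NormedAddCommGroup E]
    {ν : Measure α} {f : α → E} (hf : AEStronglyMeasurable f ν)
    (h : ∫⁻ a, ENNReal.ofReal (‖f a‖ ^ 2) ∂ν ≠ ∞) : MemLp f 2 ν := by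
  refine ⟨hf, ?_⟩
  rw [eLpNorm_lt_top_iff_lintegral_rpow_enorm_lt_top two_ne_zero ENNReal.ofNat_ne_top]
  refine lt_of_eq_of_lt (lintegral_congr fun a => ?_) h.lt_top
  rw [ENNReal.ofReal_pow (norm_nonneg _), ofReal_norm]
  simp

section Marginal

variable {α : Type*} [MeasurableSpace α] {ν : Measure α} [IsFiniteMeasure ν] [SFinite μ]
  {f : α × Ω → ℝ}

/-- The marginal integral of a square integrable function is square integrable. -/
theorem memLp_integral_fst (hf : MemLp f 2 (ν.prod μ)) :
    MemLp (fun ω => ∫ a, f (a, ω) ∂ν) 2 μ := by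
  have hm : AEStronglyMeasurable (fun ω => ∫ a, f (a, ω) ∂ν) μ :=
    hf.1.prod_swap.integral_prod_right'
  refine ⟨hm, ?_⟩
  rw [eLpNorm_lt_top_iff_lintegral_rpow_enorm_lt_top two_ne_zero ENNReal.ofNat_ne_top]
  have hfin : ∫⁻ p, ‖f p‖ₑ ^ (2 : ℝ≥0∞).toReal ∂(ν.prod μ) < ∞ :=
    (eLpNorm_lt_top_iff_lintegral_rpow_enorm_lt_top two_ne_zero ENNReal.ofNat_ne_top).1 hf.2
  rw [lintegral_prod_symm _ (hf.1.enorm.pow_const _)] at hfin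
  -- The square of the constant in Hölder's inequality between `L¹` and `L²`, that is, the total
  -- mass of `ν`.
  set c := (ν Set.univ ^ (1 / (1 : ℝ≥0∞).toReal - 1 / (2 : ℝ≥0∞).toReal)) ^ (2 : ℝ≥0∞).toReal
    with hc
  have hctop : c ≠ ∞ := by
    refine ENNReal.rpow_ne_top_of_nonneg (by simp) (ENNReal.rpow_ne_top_of_nonneg ?_ ?_)
    · norm_num
    · exact measure_ne_top _ _
  refine lt_of_le_of_lt ?_ (ENNReal.mul_lt_top hfin hctop.lt_top)
  rw [← lintegral_mul_const' _ _ hctop]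
  refine lintegral_mono_ae ?_
  filter_upwards [hf.1.prod_swap.prodMk_left] with ω hω
  have h1 : ‖∫ a, f (a, ω) ∂ν‖ₑ ≤ eLpNorm (fun a => f (a, ω)) 2 ν
      * ν Set.univ ^ (1 / (1 : ℝ≥0∞).toReal - 1 / (2 : ℝ≥0∞).toReal) := by
    refine (enorm_integral_le_lintegral_enorm _).trans ?_
    rw [← eLpNorm_one_eq_lintegral_enorm]
    exact eLpNorm_le_eLpNorm_mul_rpow_measure_univ (by norm_num) hω
  refine (ENNReal.rpow_le_rpow h1 (by simp)).trans_eq ?_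
  rw [ENNReal.mul_rpow_of_nonneg _ _ (by simp), ← hc,
    eLpNorm_eq_lintegral_rpow_enorm_toReal two_ne_zero ENNReal.ofNat_ne_top, ← ENNReal.rpow_mul]
  simp

theorem integral_integral_fst_mul (hf : MemLp f 2 (ν.prod μ)) {Z : Ω → ℝ} (hZ : MemLp Z 2 μ) :
    ∫ ω, (∫ a, f (a, ω) ∂ν) * Z ω ∂μ = ∫ a, ∫ ω, f (a, ω) * Z ω ∂μ ∂ν := by
  have h1 : Integrable (fun p : α × Ω => f p * Z p.2) (ν.prod μ) :=
    hf.integrable_mul (hZ.comp_snd ν)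
  rw [integral_integral_swap h1]
  exact integral_congr_ae (ae_of_all _ fun ω => (integral_mul_const _ _).symm)

end Marginal

namespace IsWienerProcess

theorem isWienerIntegral_const (hW : IsWienerProcess R ℱ μ W) (p : ℝ≥0) (h : H) :
    IsWienerIntegral R μ W p (fun _ => h) (W p h) := by
  refine ⟨aestronglyMeasurable_const, (hW.measurable p h).aestronglyMeasurable,
    fun _ => ⟨1, fun _ => 0, fun _ => p, fun _ => h, fun _ => zero_le, fun _ => le_rfl⟩, ?_, ?_⟩
  · refine tendsto_const_nhds.congr fun n => ?_
    rw [restrict_Ioc_eq_restrict_Icc.symm, setLIntegral_eq_zero measurableSet_Ioc]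
    intro s hs
    simp [StepFun.toFun, Set.indicator_of_mem hs]
  · refine tendsto_const_nhds.congr fun n => ?_
    rw [eLpNorm_congr_ae (g := 0), eLpNorm_zero]
    filter_upwards [hW.start h] with ω hω
    simp [StepFun.integral, hω]

/-- Orthogonality to `D` is a closed linear condition on the second component, so it passes from the
generators to the whole graph. -/
theorem integral_mul_eq_zero_of_orthogonal (hW : IsWienerProcess R ℱ μ W) (hR : R.IsPositive)
    {t : ℝ≥0} {D : Ω → ℝ} (hD : MemLp D 2 μ) (horth : ∀ p ≤ t, ∀ h, ∫ ω, D ω * W p h ω ∂μ = 0)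
    {s : ℝ≥0} (hst : s ≤ t) {g : ℝ → H} {I : Ω → ℝ} (hI : IsWienerIntegral R μ W s g I) :
    ∫ ω, D ω * I ω ∂μ = 0 := by
  obtain ⟨hg, hI, hz⟩ := hW.mem_graph_of_isWienerIntegral hR hI
  have hin : ∀ {J : Ω → ℝ} (hJ : MemLp J 2 μ),
      ⟪hD.toLp D, hJ.toLp J⟫_ℝ = ∫ ω, D ω * J ω ∂μ := fun {J} hJ => by
    rw [L2.inner_def]
    refine integral_congr_ae ?_
    filter_upwards [hD.coeFn_toLp, hJ.coeFn_toLp] with ω h1 h2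
    rw [h1, h2]
    simp [mul_comm]
  let L : Lp (Lp ℝ 2 μ) 2 (volume : Measure ℝ) × Lp ℝ 2 μ →L[ℝ] ℝ :=
    (innerSL ℝ (hD.toLp D)).comp (ContinuousLinearMap.snd ℝ _ _)
  have h1 := hW.graph_le hR (S := LinearMap.ker (L : _ →ₗ[ℝ] ℝ))
    (ContinuousLinearMap.isClosed_ker L) (fun p hp v => ?_) (hW.graph_mono hR hst hz)
  · rw [← hin hI]
    exact h1
  · change ⟪hD.toLp D, (hW.memLp p v).toLp (W p v)⟫_ℝ = 0
    rw [hin, horth p hp]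

variable [CompleteSpace H] {U : ℝ≥0 → H →L[ℝ] H}

theorem integral_inner_mul (hW : IsWienerProcess R ℱ μ W) (hR : R.IsPositive) {s : ℝ≥0}
    {Y : Ω → H} (hY : IsStochIntegral R μ W s (fun r => U (s - r.toNNReal)) Y)
    (v : H) (p : ℝ≥0) (h : H) :
    ∫ ω, ⟪v, Y ω⟫_ℝ * W p h ω ∂μ
      = ∫ r in (0 : ℝ)..(min p s : ℝ≥0), ⟪U ((s : ℝ) - r).toNNReal (R h), v⟫_ℝ := by
  rw [hW.integral_mul_of_isWienerIntegral hR (hY.2 v) (hW.isWienerIntegral_const p h),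
    intervalIntegral.integral_of_le (NNReal.coe_nonneg _), ← integral_Icc_eq_integral_Ioc,
    ← integral_indicator measurableSet_Icc]
  congr 1
  ext r
  by_cases h1 : r ∈ Set.Icc (0 : ℝ) p
  · by_cases h2 : r ∈ Set.Icc (0 : ℝ) s
    · have h3 : r ∈ Set.Icc (0 : ℝ) (min p s : ℝ≥0) := ⟨h1.1, by
        rw [NNReal.coe_min]; exact le_min h1.2 h2.2⟩
      have h4 : s - r.toNNReal = ((s : ℝ) - r).toNNReal := by
        rw [NNReal.sub_def, Real.coe_toNNReal r h1.1]
      simp only [cut, Set.indicator_of_mem h1, Set.indicator_of_mem h2, Set.indicator_of_mem h3]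
      rw [ContinuousLinearMap.adjoint_inner_left, real_inner_comm, h4]
    · have h3 : r ∉ Set.Icc (0 : ℝ) (min p s : ℝ≥0) := fun h3 =>
        h2 ⟨h3.1, h3.2.trans (by simp)⟩
      rw [Set.indicator_of_notMem h3]
      simp [cut, h2]
  · have h3 : r ∉ Set.Icc (0 : ℝ) (min p s : ℝ≥0) := fun h3 =>
      h1 ⟨h3.1, h3.2.trans (by simp)⟩
    rw [Set.indicator_of_notMem h3]
    simp [cut, h1]

end IsWienerProcess

/-- The integral over a square of a convolution kernel, by primitives. -/
theorem integral_integral_sub {φ : ℝ → ℝ} (hφ : Continuous φ) {p t : ℝ} (hp : 0 ≤ p)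
    (hpt : p ≤ t) :
    ∫ s in (0 : ℝ)..t, ∫ r in (0 : ℝ)..(min p s), φ (s - r)
      = ∫ r in (0 : ℝ)..p, ∫ s in (0 : ℝ)..(t - r), φ s := by
  set Φ : ℝ → ℝ := fun u => ∫ s in (0 : ℝ)..u, φ s with hΦ
  have hΦc : Continuous Φ := intervalIntegral.continuous_primitive
    (fun a b => hφ.intervalIntegrable a b) 0
  -- In terms of the primitive `Φ` both sides are the integral of `Φ` over `[t - p, t]`. The `max`
  -- accounts for `s < p`, where the inner integral stops at `s`.
  have h1 : ∀ s ∈ Set.uIcc 0 t, ∫ r in (0 : ℝ)..(min p s), φ (s - r)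
      = Φ s - Φ (max (s - p) 0) := fun s _ => by
    have h4 : s - min p s = max (s - p) 0 := by
      rcases le_total p s with h | h
      · rw [min_eq_left h, max_eq_left (sub_nonneg.2 h)]
      · rw [min_eq_right h, max_eq_right (sub_nonpos.2 h), sub_self]
    rw [intervalIntegral.integral_comp_sub_left, sub_zero, h4,
      intervalIntegral.integral_interval_sub_left (hφ.intervalIntegrable _ _)
        (hφ.intervalIntegrable _ _)]
  have h2 : ∫ s in (0 : ℝ)..t, Φ (max (s - p) 0) = ∫ s in (0 : ℝ)..(t - p), Φ s := by
    have hc : Continuous fun u => Φ (max u 0) := by fun_prop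
    rw [intervalIntegral.integral_comp_sub_right (fun u => Φ (max u 0)) p, zero_sub,
      ← intervalIntegral.integral_add_adjacent_intervals (b := 0) (hc.intervalIntegrable _ _)
        (hc.intervalIntegrable _ _)]
    have h3 : ∫ u in (-p)..0, Φ (max u 0) = 0 := by
      rw [intervalIntegral.integral_congr (g := fun _ => 0), intervalIntegral.integral_zero]
      intro u hu
      rw [Set.uIcc_of_le (by linarith)] at hu
      simp [max_eq_right hu.2, hΦ]
    rw [h3, zero_add]
    refine intervalIntegral.integral_congr fun u hu => ?_
    rw [Set.uIcc_of_le (by linarith)] at hu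
    simp [max_eq_left hu.1]
  rw [intervalIntegral.integral_congr h1, intervalIntegral.integral_sub
    (hΦc.intervalIntegrable _ _) (Continuous.intervalIntegrable (by fun_prop) _ _), h2,
    intervalIntegral.integral_interval_sub_left (hΦc.intervalIntegrable _ _)
      (hΦc.intervalIntegrable _ _)]
  change _ = ∫ r in (0 : ℝ)..p, Φ (t - r)
  rw [intervalIntegral.integral_comp_sub_left, sub_zero]

end WeakEquation

/-! ### Mild solutions are weak solutions. -/

section WeakSolution

variable {H : Type*} [NormedAddCommGroup H] [InnerProductSpace ℝ H]
  {Ω : Type*} {mΩ : MeasurableSpace Ω} {μ : Measure Ω}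
  {ℱ : Filtration ℝ≥0 mΩ} {R : H →L[ℝ] H} {W : ℝ≥0 → H → Ω → ℝ}

theorem predictable_le_prod : ℱ.predictable ≤ Prod.instMeasurableSpace :=
  measurableSpace_le_predictable_of_measurableSet
    (fun _ hA => (measurableSet_singleton _).prod (ℱ.le _ _ hA))
    (fun _ _ hA => measurableSet_Ioi.prod (ℱ.le _ _ hA))

theorem IsWienerIntegral.congr {t : ℝ≥0} {g : ℝ → H} {I J : Ω → ℝ}
    (hI : IsWienerIntegral R μ W t g I) (hIJ : I =ᵐ[μ] J) : IsWienerIntegral R μ W t g J := by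
  obtain ⟨hg, hm, G, h1, h2⟩ := hI
  refine ⟨hg, hm.congr hIJ, G, h1, h2.congr fun n => eLpNorm_congr_ae ?_⟩
  filter_upwards [hIJ] with ω hω
  rw [hω]

variable [CompleteSpace H]

theorem IsStochIntegral.congr {t : ℝ≥0} {Φ : ℝ → H →L[ℝ] H} {Y Z : Ω → H}
    (hY : IsStochIntegral R μ W t Φ Y) (hYZ : Y =ᵐ[μ] Z) : IsStochIntegral R μ W t Φ Z :=
  ⟨hY.1.congr hYZ, fun h => (hY.2 h).congr (hYZ.mono fun ω hω => by simp only [hω])⟩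

namespace IsMildSolution

variable {U : ℝ≥0 → H →L[ℝ] H} {X₀ : Ω → H} {T : ℝ≥0} {X : ℝ≥0 → Ω → H}

theorem isStochIntegral (hX : IsMildSolution R ℱ μ W U X₀ T X) {t : ℝ≥0} (ht : t ≤ T) :
    IsStochIntegral R μ W t (fun s => U (t - s.toNNReal)) (fun ω => X t ω - U t (X₀ ω)) := by
  obtain ⟨Y, hY, h⟩ := hX.formula t ht
  exact hY.congr (h.mono fun ω hω => by simp only [hω, add_sub_cancel_left])

variable [SecondCountableTopology H] {ι : Type*} [Countable ι] [MeasurableSpace H] [BorelSpace H]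

omit [SecondCountableTopology H] in
theorem measurable (hX : IsMildSolution R ℱ μ W U X₀ T X) : Measurable (Function.uncurry X) :=
  (hX.predictable.mono predictable_le_prod).measurable

theorem measurable_noise (hX : IsMildSolution R ℱ μ W U X₀ T X) (hU : IsC0Semigroup U)
    (e : HilbertBasis ι ℝ H) (hX₀ : Measurable X₀) :
    Measurable fun p : ℝ × Ω => X p.1.toNNReal p.2 - U p.1.toNNReal (X₀ p.2) :=
  (hX.measurable.comp ((measurable_real_toNNReal.comp measurable_fst).prodMk measurable_snd)).sub
    (hU.measurable_apply e (measurable_real_toNNReal.comp measurable_fst)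
      (hX₀.comp measurable_snd))

variable (hX : IsMildSolution R ℱ μ W U X₀ T X) (hW : IsWienerProcess R ℱ μ W)
  (hR : R.IsPositive) (hU : IsC0Semigroup U) (e : HilbertBasis ι ℝ H) (hX₀ : Measurable X₀)
  (htr : trace e (covOp U R T) < ∞)

include hX hW hR hU e

omit [BorelSpace H] [MeasurableSpace H] in
theorem initial : X 0 =ᵐ[μ] X₀ := by
  have h1 := hX.isStochIntegral (zero_le (a := T))
  have h2 := hW.lintegral_norm_sq hR hU e h1
  have h3 : trace e (covOp U R 0) = 0 := by simp [trace, covOp]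
  have h5 : AEMeasurable (fun ω => ENNReal.ofReal (‖X 0 ω - U 0 (X₀ ω)‖ ^ 2)) μ :=
    (h1.1.norm.pow 2).aemeasurable.ennreal_ofReal
  rw [h3, lintegral_eq_zero_iff' h5] at h2
  filter_upwards [h2] with ω hω
  simp only [Pi.zero_apply, ENNReal.ofReal_eq_zero] at hω
  have h4 : ‖X 0 ω - U 0 (X₀ ω)‖ = 0 := by
    have := sq_nonneg ‖X 0 ω - U 0 (X₀ ω)‖
    exact pow_eq_zero_iff two_ne_zero |>.1 (le_antisymm hω this)
  rw [norm_eq_zero, sub_eq_zero, hU.map_zero] at h4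
  exact h4

variable [IsProbabilityMeasure μ]

include hX₀ htr

theorem memLp_noise {t : ℝ≥0} (ht : t ≤ T) :
    MemLp (fun p : ℝ × Ω => X p.1.toNNReal p.2 - U p.1.toNNReal (X₀ p.2)) 2
      ((volume.restrict (Set.Ioc (0 : ℝ) t)).prod μ) := by
  have hm := hX.measurable_noise hU e hX₀
  refine memLp_two_of_lintegral_ne_top hm.aestronglyMeasurable (ne_of_lt ?_)
  rw [lintegral_prod _ (hm.norm.pow_const 2).ennreal_ofReal.aemeasurable]
  refine (setLIntegral_mono measurable_const (g := fun _ => trace e (covOp U R T))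
    fun s hs => ?_).trans_lt ?_
  · have hsT : s.toNNReal ≤ T := (Real.toNNReal_le_iff_le_coe.2 hs.2).trans ht
    change ∫⁻ ω, ENNReal.ofReal (‖X s.toNNReal ω - U s.toNNReal (X₀ ω)‖ ^ 2) ∂μ ≤ _
    rw [hW.lintegral_norm_sq hR hU e (hX.isStochIntegral hsT)]
    exact hU.trace_covOp_mono e hR hsT
  · rw [setLIntegral_const]
    exact ENNReal.mul_lt_top htr measure_Ioc_lt_top

theorem integrableOn_noise {t : ℝ≥0} (ht : t ≤ T) : ∀ᵐ ω ∂μ, IntegrableOn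
    (fun s : ℝ => X s.toNNReal ω - U s.toNNReal (X₀ ω)) (Set.Ioc 0 t) :=
  ((hX.memLp_noise hW hR hU e hX₀ htr ht).integrable one_le_two).prod_left_ae

/-- The weak equation satisfied by the stochastic convolution. -/
theorem noise_equation {A : H →ₗ.[ℝ] H} (hA : IsGenerator A U) (ζ : A.adjoint.domain) {t : ℝ≥0}
    (ht : t ≤ T) : ∀ᵐ ω ∂μ, ⟪(ζ : H), X t ω - U t (X₀ ω)⟫_ℝ
      = W t ζ ω + ∫ s in Set.Ioc (0 : ℝ) t,
          ⟪A.adjoint ζ, X s.toNNReal ω - U s.toNNReal (X₀ ω)⟫_ℝ := by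
  set ν : Measure ℝ := volume.restrict (Set.Ioc (0 : ℝ) t) with hν
  set Y : ℝ≥0 → Ω → H := fun s ω => X s ω - U s (X₀ ω) with hYdef
  have hY : ∀ s ≤ t, IsStochIntegral R μ W s (fun r => U (s - r.toNNReal)) (Y s) :=
    fun s hs => hX.isStochIntegral (hs.trans ht)
  set f : ℝ × Ω → ℝ := fun p => ⟪A.adjoint ζ, Y p.1.toNNReal p.2⟫_ℝ with hf
  have hf2 : MemLp f 2 (ν.prod μ) :=
    (hX.memLp_noise hW hR hU e hX₀ htr ht).const_inner (A.adjoint ζ)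
  have hJ : MemLp (fun ω => ∫ s, f (s, ω) ∂ν) 2 μ := memLp_integral_fst hf2
  have hYζ := hW.memLp_of_isWienerIntegral hR ((hY t le_rfl).2 ζ)
  -- `D` is the defect of the equation. Once it is orthogonal to every `W p h` with `p ≤ t`, it is
  -- orthogonal to every Wiener integral up to time `t`. It consists of two such integrals and a
  -- time average of others, so `∫ D² = 0`.
  set D : Ω → ℝ := fun ω => ⟪(ζ : H), Y t ω⟫_ℝ - W t ζ ω - ∫ s, f (s, ω) ∂ν with hDdef
  have hD : MemLp D 2 μ := (hYζ.sub (hW.memLp t ζ)).sub hJ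
  have hDmul : ∀ {Z : Ω → ℝ}, MemLp Z 2 μ → ∫ ω, D ω * Z ω ∂μ
      = ∫ ω, ⟪(ζ : H), Y t ω⟫_ℝ * Z ω ∂μ - ∫ ω, W t ζ ω * Z ω ∂μ
        - ∫ s, ∫ ω, f (s, ω) * Z ω ∂μ ∂ν := fun {Z} hZ => by
    have h1 : Integrable (fun ω => ⟪(ζ : H), Y t ω⟫_ℝ * Z ω) μ := hYζ.integrable_mul hZ
    have h2 : Integrable (fun ω => W t ζ ω * Z ω) μ := (hW.memLp t ζ).integrable_mul hZ
    have h3 : Integrable (fun ω => (∫ s, f (s, ω) ∂ν) * Z ω) μ := hJ.integrable_mul hZ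
    simp only [hDdef, sub_mul]
    have h4 : Integrable (fun ω => ⟪(ζ : H), Y t ω⟫_ℝ * Z ω - W t ζ ω * Z ω) μ := h1.sub h2
    rw [integral_sub h4 h3, integral_sub h1 h2, integral_integral_fst_mul hf2 hZ]
  -- All three covariances with `W p h` are deterministic time integrals; they cancel by the weak
  -- semigroup identity for the vector `R h` at time `t - r`.
  have horth : ∀ p ≤ t, ∀ h, ∫ ω, D ω * W p h ω ∂μ = 0 := fun p hp h => by
    set φ : ℝ → ℝ := fun s => ⟪U s.toNNReal (R h), A.adjoint ζ⟫_ℝ with hφ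
    have hφc : Continuous φ := (hU.continuous_toNNReal (R h)).inner continuous_const
    have hW2 : ∫ ω, W t ζ ω * W p h ω ∂μ = p * ⟪R h, (ζ : H)⟫_ℝ := by
      have h1 := hW.inner_toLp hR t p ζ h
      rw [L2.inner_def, min_eq_right hp, real_inner_comm] at h1
      rw [← h1]
      refine integral_congr_ae ?_
      filter_upwards [hW.coeFn_toLp t ζ, hW.coeFn_toLp p h] with ω h1 h2
      rw [h1, h2]
      simp [mul_comm]
    have hfW : ∀ s ∈ Set.Ioc (0 : ℝ) t, ∫ ω, f (s, ω) * W p h ω ∂μ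
        = ∫ r in (0 : ℝ)..(min (p : ℝ) s), φ (s - r) := fun s hs => by
      have h1 := hW.integral_inner_mul hR (hY s.toNNReal (Real.toNNReal_le_iff_le_coe.2 hs.2))
        (A.adjoint ζ) p h
      rwa [NNReal.coe_min, Real.coe_toNNReal s hs.1.le] at h1
    have h0t := NNReal.coe_nonneg t
    rw [hDmul (hW.memLp p h), hW.integral_inner_mul hR (hY t le_rfl), hW2, min_eq_left hp, hν,
      setIntegral_congr_fun measurableSet_Ioc hfW, ← intervalIntegral.integral_of_le h0t,
      integral_integral_sub hφc (NNReal.coe_nonneg p) (NNReal.coe_le_coe.2 hp)]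
    have h2 : ∀ r ∈ Set.uIcc (0 : ℝ) p, ∫ s in (0 : ℝ)..(t - r), φ s
        = ⟪U ((t : ℝ) - r).toNNReal (R h), (ζ : H)⟫_ℝ - ⟪R h, (ζ : H)⟫_ℝ := fun r hr => by
      rw [Set.uIcc_of_le (NNReal.coe_nonneg p)] at hr
      have : 0 ≤ (t : ℝ) - r := sub_nonneg.2 (hr.2.trans (NNReal.coe_le_coe.2 hp))
      rw [hU.inner_sub_eq_intervalIntegral hA ζ, Real.coe_toNNReal _ this]
    have hc : Continuous fun r : ℝ => ⟪U ((t : ℝ) - r).toNNReal (R h), (ζ : H)⟫_ℝ :=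
      ((hU.continuous_toNNReal (R h)).comp (continuous_const.sub continuous_id)).inner
        continuous_const
    rw [intervalIntegral.integral_congr h2, intervalIntegral.integral_sub
      (hc.intervalIntegrable _ _) intervalIntegrable_const, intervalIntegral.integral_const]
    simp
  have hzero : ∀ {s g I}, s ≤ t → IsWienerIntegral R μ W s g I → ∫ ω, D ω * I ω ∂μ = 0 :=
    fun hs hI => hW.integral_mul_eq_zero_of_orthogonal hR hD horth hs hI
  have hDD : ∫ ω, D ω * D ω ∂μ = 0 := by
    rw [hDmul hD]
    have h1 : ∫ ω, ⟪(ζ : H), Y t ω⟫_ℝ * D ω ∂μ = 0 := by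
      simp only [mul_comm _ (D _)]
      exact hzero le_rfl ((hY t le_rfl).2 ζ)
    have h2 : ∫ ω, W t ζ ω * D ω ∂μ = 0 := by
      simp only [mul_comm _ (D _)]
      exact horth t le_rfl ζ
    have h3 : ∫ s, ∫ ω, f (s, ω) * D ω ∂μ ∂ν = 0 := by
      rw [hν, setIntegral_congr_fun (g := fun _ => 0) measurableSet_Ioc fun s hs => ?_,
        integral_zero]
      simp only [mul_comm _ (D _)]
      have hs' := Real.toNNReal_le_iff_le_coe.2 hs.2
      exact hzero hs' ((hY _ hs').2 _)
    rw [h1, h2, h3]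
    simp
  rw [integral_eq_zero_iff_of_nonneg (fun ω => mul_self_nonneg _) (hD.integrable_mul hD)] at hDD
  filter_upwards [hDD] with ω hω
  have h1 : D ω = 0 := mul_self_eq_zero.1 hω
  simp only [hDdef, hf] at h1
  linarith

/-- A mild solution is a weak solution. -/
theorem isWeakSolution {A : H →ₗ.[ℝ] H} (hA : IsGenerator A U) :
    IsWeakSolution ℱ μ W A X₀ T X where
  predictable := hX.predictable
  initial := hX.initial hW hR hU e
  integrable := by
    filter_upwards [hX.integrableOn_noise hW hR hU e hX₀ htr le_rfl] with ω hω
    rw [integrableOn_Icc_iff_integrableOn_Ioc]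
    have h1 : IntegrableOn (fun s : ℝ => U s.toNNReal (X₀ ω)) (Set.Ioc 0 T) :=
      (hU.continuous_toNNReal (X₀ ω)).integrableOn_Ioc
    exact (hω.add h1).congr (ae_of_all _ fun s => sub_add_cancel _ _)
  equation ζ t ht := by
    filter_upwards [hX.noise_equation hW hR hU e hX₀ htr hA ζ ht,
      hX.integrableOn_noise hW hR hU e hX₀ htr ht] with ω hω hint
    have h1 := hU.inner_sub_eq_intervalIntegral hA ζ t (X₀ ω)
    have h2 : ∀ s : ℝ, ⟪X s.toNNReal ω, A.adjoint ζ⟫_ℝ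
        = ⟪A.adjoint ζ, X s.toNNReal ω - U s.toNNReal (X₀ ω)⟫_ℝ
          + ⟪U s.toNNReal (X₀ ω), A.adjoint ζ⟫_ℝ := fun s => by
      rw [real_inner_comm, ← real_inner_comm _ (A.adjoint ζ), ← inner_add_right, sub_add_cancel]
    rw [intervalIntegral.integral_of_le (NNReal.coe_nonneg t)] at h1 ⊢
    simp only [h2]
    rw [integral_add (hint.const_inner (A.adjoint ζ))
      ((hU.continuous_toNNReal (X₀ ω)).inner continuous_const).integrableOn_Ioc, ← h1]
    rw [inner_sub_right, real_inner_comm, real_inner_comm (U t (X₀ ω))] at hω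
    linarith

end IsMildSolution

end WeakSolution

/-! ### Scores of the law and of the conditional law. -/

section MainProof

variable {H : Type*} [NormedAddCommGroup H] [InnerProductSpace ℝ H] [CompleteSpace H]
  [SecondCountableTopology H] [MeasurableSpace H] [BorelSpace H] {ι : Type*} [Countable ι]
  {Ω : Type*} {mΩ : MeasurableSpace Ω} {μ : Measure Ω} [IsProbabilityMeasure μ]
  {ℱ : Filtration ℝ≥0 mΩ} {R : H →L[ℝ] H} {W : ℝ≥0 → H → Ω → ℝ} {U : ℝ≥0 → H →L[ℝ] H}

omit [IsProbabilityMeasure μ] in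
/-- A vector whose characteristic function is not changed by conditioning on the events of a
variable is independent of it. -/
theorem indepFun_of_setIntegral_cexp [IsFiniteMeasure μ] {E : Type*} [MeasurableSpace E]
    {X₀ : Ω → E} {Y : Ω → H} (hY : Measurable Y) (c : H → ℂ)
    (h : ∀ s, MeasurableSet s → ∀ x, ∫ ω in X₀ ⁻¹' s,
      Complex.exp ((⟪Y ω, x⟫_ℝ : ℝ) * Complex.I) ∂μ = c x * μ.real (X₀ ⁻¹' s))
    (hc : ∀ x, charFun (μ.map Y) x = c x) : IndepFun X₀ Y μ := by
  rw [indepFun_iff_measure_inter_preimage_eq_mul]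
  intro s t hs ht
  have h1 : (μ.restrict (X₀ ⁻¹' s)).map Y = μ (X₀ ⁻¹' s) • μ.map Y := by
    have : IsFiniteMeasure (μ (X₀ ⁻¹' s) • μ.map Y) :=
      (μ.map Y).smul_finite (measure_ne_top _ _)
    refine Measure.ext_of_charFun ?_
    ext x
    rw [charFun_map_apply hY, h s hs, charFun_apply, integral_smul_measure, ← charFun_apply, hc,
      mul_comm]
    simp [Measure.real]
  have h2 := congrArg (fun ν => ν t) h1
  simp only [Measure.map_apply hY ht, Measure.smul_apply, smul_eq_mul] at h2
  rwa [Measure.restrict_apply (hY ht), Set.inter_comm] at h2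

theorem IsStochIntegral.charFun_map (hW : IsWienerProcess R ℱ μ W) (hR : R.IsPositive)
    (hU : IsC0Semigroup U) (e : HilbertBasis ι ℝ H) {t : ℝ≥0} {Y : Ω → H}
    (hY : IsStochIntegral R μ W t (fun s => U (t - s.toNNReal)) Y) (hYm : Measurable Y) (h : H) :
    charFun (μ.map Y) h = Complex.exp ((-(⟪h, covOp U R t h⟫_ℝ / 2) : ℝ)) := by
  have h1 := hW.cexp_inner hR hU e hY h (F := Set.univ) MeasurableSet.univ
  rw [setIntegral_univ, probReal_univ, Complex.ofReal_one, mul_one] at h1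
  rw [charFun_map_apply hYm, h1]

theorem IsStochIntegral.indepFun (hW : IsWienerProcess R ℱ μ W) (hR : R.IsPositive)
    (hU : IsC0Semigroup U) (e : HilbertBasis ι ℝ H) {t : ℝ≥0} {X₀ Y : Ω → H}
    (hY : IsStochIntegral R μ W t (fun s => U (t - s.toNNReal)) Y) (hYm : Measurable Y)
    (hX₀ : Measurable[ℱ 0] X₀) : IndepFun X₀ Y μ :=
  indepFun_of_setIntegral_cexp hYm _
    (fun _ hs x => hW.cexp_inner hR hU e hY x (hX₀ hs)) (hY.charFun_map hW hR hU e hYm)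

/-- The regular conditional law of `L X₀ + Y` given `X₀`, for independent `X₀` and `Y`. -/
theorem condDistrib_add_of_indepFun {X₀ Y : Ω → H} (hX₀ : Measurable X₀) (hY : Measurable Y)
    (hind : IndepFun X₀ Y μ) (L : H →L[ℝ] H) :
    ∀ᵐ x ∂(μ.map X₀), condDistrib (fun ω => L (X₀ ω) + Y ω) X₀ μ x
      = μ.map fun ω => L x + Y ω := by
  have hf : Measurable fun p : H × H => L p.1 + p.2 :=
    (L.continuous.measurable.comp measurable_fst).add measurable_snd
  set κ : Kernel H H := (Kernel.id ×ₖ Kernel.const H (μ.map Y)).map fun p => L p.1 + p.2 with hκ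
  have : IsProbabilityMeasure (μ.map Y) := Measure.isProbabilityMeasure_map hY.aemeasurable
  have hκx : ∀ x, κ x = μ.map fun ω => L x + Y ω := fun x => by
    rw [hκ, Kernel.map_apply _ hf, Kernel.prod_apply, Kernel.id_apply, Kernel.const_apply,
      Measure.dirac_prod, Measure.map_map hf measurable_prodMk_left,
      Measure.map_map (hf.comp measurable_prodMk_left) hY]
    rfl
  have hfin : IsFiniteKernel κ := by rw [hκ]; infer_instance
  have h1 : μ.map (fun ω => (X₀ ω, L (X₀ ω) + Y ω)) = μ.map X₀ ⊗ₘ κ := by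
    have hg : Measurable fun p : H × H => (p.1, L p.1 + p.2) := measurable_fst.prodMk hf
    have h2 := (indepFun_iff_map_prod_eq_prod_map_map hX₀.aemeasurable hY.aemeasurable).1 hind
    refine Measure.ext_of_lintegral _ fun F hF => ?_
    rw [Measure.lintegral_compProd hF]
    have h3 : μ.map (fun ω => (X₀ ω, L (X₀ ω) + Y ω))
        = ((μ.map X₀).prod (μ.map Y)).map fun p => (p.1, L p.1 + p.2) := by
      rw [← h2, Measure.map_map hg (hX₀.prodMk hY)]
      rfl
    have h4 : Measurable fun p : H × H => F (p.1, L p.1 + p.2) := hF.comp hg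
    rw [h3, lintegral_map hF hg, lintegral_prod _ h4.aemeasurable]
    refine lintegral_congr fun x => ?_
    have h5 : Measurable fun ω => L x + Y ω := measurable_const.add hY
    have h6 : Measurable fun y => F (x, y) := hF.comp measurable_prodMk_left
    have h7 : Measurable fun y => F (x, L x + y) := h4.comp measurable_prodMk_left
    rw [hκx, lintegral_map h6 h5]
    exact lintegral_map h7 hY
  filter_upwards [condDistrib_ae_eq_of_measure_eq_compProd X₀
    ((L.continuous.measurable.comp hX₀).add hY).aemeasurable h1] with x hx
  exact hx.trans (hκx x)

variable {X₀ : Ω → H} {T : ℝ≥0} {X : ℝ≥0 → Ω → H}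

namespace IsMildSolution

/-- The score of the law of a mild solution. -/
theorem isScore_map (hX : IsMildSolution R ℱ μ W U X₀ T X) (hW : IsWienerProcess R ℱ μ W)
    (hR : R.IsPositive) (hU : IsC0Semigroup U) (e : HilbertBasis ι ℝ H)
    (hX₀ : Measurable[ℱ 0] X₀) {t : ℝ≥0} (ht : t ≤ T)
    (hrange : ∀ k, e k ∈ Set.range (covOp U R t))
    (hint : ∀ᵐ x ∂(μ.map (X t)), Integrable (fun x₀ => x₀) (condDistrib X₀ (X t) μ x)) :
    IsScore e (μ.map (X t)) fun x k => -invCoord (covOp U R t) (e k)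
      (x - U t (∫ x₀, x₀ ∂(condDistrib X₀ (X t) μ x))) := by
  intro k
  have hX₀m : Measurable X₀ := hX₀.mono (ℱ.le 0) le_rfl
  have hXm : Measurable (X t) := hX.measurable.comp measurable_prodMk_left
  set Y : Ω → H := fun ω => X t ω - U t (X₀ ω) with hYdef
  have hY := hX.isStochIntegral ht
  have hYm : Measurable Y := hXm.sub ((U t).continuous.measurable.comp hX₀m)
  have hsum : (fun ω => U t (X₀ ω) + Y ω) = X t := by
    ext1 ω
    simp only [hYdef]
    abel
  set q := Function.invFun (covOp U R t) (e k) with hqdef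
  have hq : hU.covLin e R t q = e k := Function.invFun_eq (hrange k)
  -- At `(X t, X₀)` this function is `-⟪q, Y⟫`, a square integrable Wiener integral, so no moment of
  -- `X₀` is involved.
  have hf : Integrable (fun p : H × H => -⟪q, p.1 - U t p.2⟫_ℝ)
      (μ.map fun ω => (X t ω, X₀ ω)) := by
    rw [integrable_map_measure (Continuous.aestronglyMeasurable (by fun_prop))
      (hXm.prodMk hX₀m).aemeasurable]
    exact ((hW.memLp_of_isWienerIntegral hR (hY.2 q)).integrable one_le_two).neg
  -- The existence of a conditional mean enters only here, to move the integral over `x₀` inside `U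
  -- t` and the inner product.
  have hG : (fun x => -invCoord (covOp U R t) (e k)
      (x - U t (∫ x₀, x₀ ∂(condDistrib X₀ (X t) μ x))))
      =ᵐ[μ.map (X t)] fun x => ∫ x₀, -⟪q, x - U t x₀⟫_ℝ ∂(condDistrib X₀ (X t) μ x) := by
    filter_upwards [hint] with x hx
    have h1 : Integrable (fun x₀ => U t x₀) (condDistrib X₀ (X t) μ x) := (U t).integrable_comp hx
    have h2 : Integrable (fun x₀ => x - U t x₀) (condDistrib X₀ (X t) μ x) :=
      (integrable_const x).sub h1
    rw [integral_neg, integral_inner h2, integral_sub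
      (integrable_const x) h1, integral_const, probReal_univ, one_smul,
      (U t).integral_comp_comm hx]
    rfl
  refine score_coord_gaussian_shift e k hX₀m hYm (hY.indepFun hW hR hU e hYm hX₀) (U t)
    (hU.covLin e R t) (hU.inner_covOp_comm e hR t) (hU.inner_covOp_nonneg e hR t)
    (hY.charFun_map hW hR hU e hYm) hq _ (by rw [hsum])
    ((hf.integral_condDistrib_map hX₀m.aemeasurable).congr hG.symm) fun B hB => ?_
  rw [hsum, setIntegral_congr_ae hB (hG.mono fun x hx _ => hx)]
  have h1 : μ.map (X t) ⊗ₘ condDistrib X₀ (X t) μ = μ.map fun ω => (X t ω, X₀ ω) :=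
    compProd_map_condDistrib hX₀m.aemeasurable
  have h2 := Measure.setIntegral_compProd hB MeasurableSet.univ (h1 ▸ hf.integrableOn)
  simp only [setIntegral_univ] at h2
  rw [← h2, h1, setIntegral_map (hB.prod MeasurableSet.univ) hf.1 (hXm.prodMk hX₀m).aemeasurable]
  have h3 : (fun ω => (X t ω, X₀ ω)) ⁻¹' (B ×ˢ Set.univ) = X t ⁻¹' B := by
    ext ω
    simp
  rw [h3]

/-- The score of the conditional law of a mild solution given its initial value. -/
theorem isScore_condDistrib (hX : IsMildSolution R ℱ μ W U X₀ T X) (hW : IsWienerProcess R ℱ μ W)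
    (hR : R.IsPositive) (hU : IsC0Semigroup U) (e : HilbertBasis ι ℝ H)
    (hX₀ : Measurable[ℱ 0] X₀) {t : ℝ≥0} (ht : t ≤ T)
    (hrange : ∀ k, e k ∈ Set.range (covOp U R t)) :
    ∀ᵐ x₀ ∂(μ.map X₀), IsScore e (condDistrib (X t) X₀ μ x₀) fun x k =>
      -invCoord (covOp U R t) (e k) (x - U t x₀) := by
  have hX₀m : Measurable X₀ := hX₀.mono (ℱ.le 0) le_rfl
  have hXm : Measurable (X t) := hX.measurable.comp measurable_prodMk_left
  set Y : Ω → H := fun ω => X t ω - U t (X₀ ω) with hYdef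
  have hY := hX.isStochIntegral ht
  have hYm : Measurable Y := hXm.sub ((U t).continuous.measurable.comp hX₀m)
  have hsum : (fun ω => U t (X₀ ω) + Y ω) = X t := by
    ext1 ω
    simp only [hYdef]
    abel
  have hcond := condDistrib_add_of_indepFun hX₀m hYm (hY.indepFun hW hR hU e hYm hX₀) (U t)
  rw [hsum] at hcond
  filter_upwards [hcond] with x₀ hx₀
  intro k
  set q := Function.invFun (covOp U R t) (e k) with hqdef
  have hq : hU.covLin e R t q = e k := Function.invFun_eq (hrange k)
  have hZm : Measurable fun ω => U t x₀ + Y ω := measurable_const.add hYm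
  have hGc : Continuous fun x : H => -⟪q, x - U t x₀⟫_ℝ := by fun_prop
  have hG : Integrable (fun x : H => -⟪q, x - U t x₀⟫_ℝ) (condDistrib (X t) X₀ μ x₀) := by
    rw [hx₀, integrable_map_measure hGc.aestronglyMeasurable hZm.aemeasurable]
    refine ((hW.memLp_of_isWienerIntegral hR (hY.2 q)).integrable one_le_two).neg.congr
      (ae_of_all _ fun ω => ?_)
    simp [hYdef]
  -- For almost every `x₀` the conditional law is that of `U t x₀ + Y`, and a constant initial
  -- vector is trivially independent of `Y`.
  refine score_coord_gaussian_shift e k (X₀ := fun _ => x₀) measurable_const hYm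
    (indepFun_const_left x₀ Y) (U t)
    (hU.covLin e R t) (hU.inner_covOp_comm e hR t) (hU.inner_covOp_nonneg e hR t)
    (hY.charFun_map hW hR hU e hYm) hq _ hx₀ hG fun B hB => ?_
  change ∫ x in B, -⟪q, x - U t x₀⟫_ℝ ∂_ = _
  rw [hx₀, setIntegral_map hB hGc.aestronglyMeasurable hZm.aemeasurable]
  simp only [add_sub_cancel_left]

end IsMildSolution

end MainProof

end FDP

end

theorem mainTheorem6
    {H : Type*} [NormedAddCommGroup H] [InnerProductSpace ℝ H] [CompleteSpace H]
    [SecondCountableTopology H] [MeasurableSpace H] [BorelSpace H]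
    {ι : Type*} [Countable ι] (e : HilbertBasis ι ℝ H)
    {Ω : Type*} {mΩ : MeasurableSpace Ω} (μ : Measure Ω) [IsProbabilityMeasure μ]
    (ℱ : Filtration ℝ≥0 mΩ)
    (A : H →ₗ.[ℝ] H) (U : ℝ≥0 → H →L[ℝ] H)
    (hU : FDP.IsC0Semigroup U) (hA : FDP.IsGenerator A U)
    (R : H →L[ℝ] H) (hR : R.IsPositive)
    (W : ℝ≥0 → H → Ω → ℝ) (hW : FDP.IsWienerProcess R ℱ μ W)
    (X₀ : Ω → H) (hX₀ : Measurable[ℱ 0] X₀)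
    (T : ℝ≥0)
    (hTr : FDP.trace e R < ∞ ∨ FDP.trace e (FDP.covOp U R T) < ∞) :
    -- the mild formula defines a process, and it solves the equation weakly
    (∃ X : ℝ≥0 → Ω → H, FDP.IsMildSolution R ℱ μ W U X₀ T X) ∧
    ∀ X : ℝ≥0 → Ω → H, FDP.IsMildSolution R ℱ μ W U X₀ T X →
      FDP.IsWeakSolution ℱ μ W A X₀ T X ∧
      ∀ t : ℝ≥0, 0 < t → t ≤ T →
        -- the diagonal case
        (∀ b r : ι → ℝ,
          (∀ j, ∃ hj : e j ∈ A.domain, A ⟨e j, hj⟩ = b j • e j) →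
          (∀ j, R (e j) = r j • e j) →
          ∀ k, b k ≠ 0 →
            FDP.covOp U R t (e k) = (r k * ((Real.exp (2 * b k * t) - 1) / (2 * b k))) • e k) ∧
        ((∀ k, e k ∈ Set.range (FDP.covOp U R t)) →
          -- the score of the law of `X t`
          ((∀ᵐ x ∂(μ.map (X t)), Integrable (fun x₀ => x₀) (condDistrib X₀ (X t) μ x)) →
            FDP.IsScore e (μ.map (X t)) fun x k =>
              -FDP.invCoord (FDP.covOp U R t) (e k)
                (x - U t (∫ x₀, x₀ ∂(condDistrib X₀ (X t) μ x)))) ∧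
          -- the score of the conditional law of `X t` given `X₀ = x₀`
          (∀ᵐ x₀ ∂(μ.map X₀),
            FDP.IsScore e (condDistrib (X t) X₀ μ x₀) fun x k =>
              -FDP.invCoord (FDP.covOp U R t) (e k) (x - U t x₀))) := by
  have hX₀m : Measurable X₀ := hX₀.mono (ℱ.le 0) le_rfl
  have htr : FDP.trace e (FDP.covOp U R T) < ∞ :=
    hTr.elim (hW.trace_covOp_lt_top hR hU e T) id
  refine ⟨hW.exists_isMildSolution hR hU e hX₀ htr, fun X hX => ?_⟩
  refine ⟨hX.isWeakSolution hW hR hU e hX₀m htr hA, fun t _ ht => ?_⟩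
  refine ⟨fun b r hb hr k hk => hU.covOp_eigenvector hA e hb hr t hk, fun hrange => ?_⟩
  exact ⟨hX.isScore_map hW hR hU e hX₀ ht hrange, hX.isScore_condDistrib hW hR hU e hX₀ ht hrange⟩
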